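/- All 2-categories are strict. An *icon* $\alpha\colon F\Rightarrow G$ between pseudofunctors $F,G\colon \mathcal{X}\to\mathcal{Y}$ of 2-categories exists only if $Fx=Gx$ for all objects $x$, and then consists of natural transformations $\alpha_{x,y}\colon F_{x,y}\Rightarrow G_{x,y}\colon \mathcal{X}(x,y)\to\mathcal{Y}(Fx,Fy)$ for all objects $x,y$, compatible with the unit and composition constraints of $F$ and $G$. Let $\mathbf{2Cat}_{p,i}$ be the 2-category of small 2-categories, pseudofunctors and icons, and let $\mathbf{2Cat}_{2,i}$ be the 2-category of small 2-categories, 2-functors and icons, with its inclusion $i\colon \mathbf{2Cat}_{2,i}\hookrightarrow\mathbf{2Cat}_{p,i}$. Let $\mathcal{A}$ be a small 2-category. Write $[\mathcal{A},\mathbf{2Cat}_{2,i}]$ for the 2-category of 2-functors, 2-natural transformations and modifications from $\mathcal{A}$ to $\mathbf{2Cat}_{2,i}$, and $\mathrm{Bicat}(\mathcal{A},\mathbf{2Cat}_{p,i})$ for the 2-category of pseudofunctors, pseudonatural transformations and modifications from $\mathcal{A}$ to $\mathbf{2Cat}_{p,i}$. Then the inclusion 2-functor $$J\colon [\mathcal{A},\mathbf{2Cat}_{2,i}]\hookrightarrow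 \mathrm{Bicat}(\mathcal{A},\mathbf{2Cat}_{p,i}),$$ given by composition with $i$, has a left 2-adjoint $Q$: there are a 2-functor $Q$ in the other direction and 2-natural transformations $\eta\colon 1\Rightarrow JQ$ and $\varepsilon\colon QJ\Rightarrow 1$ which satisfy the triangle identities strictly. Moreover, for every pseudofunctor $X\colon\mathcal{A}\to\mathbf{2Cat}_{p,i}$ the unit component $\eta_X\colon X\to JQX$, and for every 2-functor $Y\colon\mathcal{A}\to\mathbf{2Cat}_{2,i}$ the 1-cell $J\varepsilon_Y\colon JQJY\to JY$, is an internal equivalence in $\mathrm{Bicat}(\mathcal{A},\mathbf{2Cat}_{p,i})$, i.e. a 1-cell $f$ that admits a 1-cell $g$ in the other direction with invertible 2-cells $g f\cong 1$ and $f g\cong 1$. -/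

import Mathlib

open CategoryTheory Bicategory

universe u w₁ w₂ w₃ w₄ v₁ v₂ v₃ v₄ u₁ u₂ u₃ u₄

namespace TwoDim

section Icons

variable {B : Type u₁} [Bicategory.{w₁, v₁} B] {C : Type u₂} [Bicategory.{w₂, v₂} C]
  {D : Type u₃} [Bicategory.{w₃, v₃} D]

/-- Identification of hom-categories along equalities of objects; it is the identity functor
when both equalities are `rfl`. -/
abbrev homCast {a a' b b' : C} (h : a = a') (h' : b = b') : (a' ⟶ b') ⥤ (a ⟶ b) :=
  match a', b', h, h' with
  | _, _, rfl, rfl => 𝟭 _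

lemma homCast_id {a a' : C} (h : a = a') : (homCast h h).obj (𝟙 a') = 𝟙 a := by
  subst h; rfl

lemma homCast_comp {a a' b b' c c' : C} (ha : a = a') (hb : b = b') (hc : c = c')
    (f : a' ⟶ b') (g : b' ⟶ c') :
    (homCast ha hc).obj (f ≫ g) = (homCast ha hb).obj f ≫ (homCast hb hc).obj g := by
  subst ha hb hc; rfl

lemma homCast_trans {a a' a'' b b' b'' : C} (ha : a = a') (ha' : a' = a'') (hb : b = b')
    (hb' : b' = b'') (f : a'' ⟶ b'') :
    (homCast ha hb).obj ((homCast ha' hb').obj f) =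
      (homCast (ha.trans ha') (hb.trans hb')).obj f := by
  subst ha ha' hb hb'; rfl

lemma map_homCast (F : C ⥤ᵖ D) {a a' b b' : C} (ha : a = a') (hb : b = b') (f : a' ⟶ b') :
    F.map ((homCast ha hb).obj f) =
      (homCast (congrArg F.obj ha) (congrArg F.obj hb)).obj (F.map f) := by
  subst ha hb; rfl

/-- An icon between pseudofunctors: `F` and `G` agree on objects, and there are natural
transformations between the functors on hom-categories, compatible with the unit and
composition constraints. -/
structure Icon (F G : B ⥤ᵖ C) where
  obj_eq (a : B) : F.obj a = G.obj a
  app {a b : B} (f : a ⟶ b) : F.map f ⟶ (homCast (obj_eq a) (obj_eq b)).obj (G.map f)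
  naturality {a b : B} {f g : a ⟶ b} (η : f ⟶ g) :
    F.map₂ η ≫ app g = app f ≫ (homCast (obj_eq a) (obj_eq b)).map (G.map₂ η)
  app_id (a : B) :
    app (𝟙 a) ≫ (homCast (obj_eq a) (obj_eq a)).map (G.mapId a).hom ≫
      eqToHom (homCast_id (obj_eq a)) = (F.mapId a).hom
  app_comp {a b c : B} (f : a ⟶ b) (g : b ⟶ c) :
    app (f ≫ g) ≫ (homCast (obj_eq a) (obj_eq c)).map (G.mapComp f g).hom ≫
      eqToHom (homCast_comp (obj_eq a) (obj_eq b) (obj_eq c) (G.map f) (G.map g)) =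
    (F.mapComp f g).hom ≫ app f ▷ F.map g ≫
      (homCast (obj_eq a) (obj_eq b)).obj (G.map f) ◁ app g

namespace Icon

/-- Icons are determined by their components. -/
lemma ext' {F G : B ⥤ᵖ C} {α β : Icon F G}
    (h : ∀ {a b : B} (f : a ⟶ b), α.app f = β.app f) : α = β := by
  cases α; cases β
  congr
  funext a b f
  exact h f

/-- The identity icon. -/
def id (F : B ⥤ᵖ C) : Icon F F where
  obj_eq _ := rfl
  app f := 𝟙 (F.map f)
  naturality η := by simp
  app_id a := by simp
  app_comp f g := by simp

lemma homCast_map_trans {a a' a'' b b' b'' : C} (ha : a = a') (ha' : a' = a'') (hb : b = b')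
    (hb' : b' = b'') {f g : a'' ⟶ b''} (η : f ⟶ g) :
    (homCast ha hb).map ((homCast ha' hb').map η) =
      eqToHom (homCast_trans ha ha' hb hb' f) ≫
        (homCast (ha.trans ha') (hb.trans hb')).map η ≫
        eqToHom (homCast_trans ha ha' hb hb' g).symm := by
  subst ha ha' hb hb'; simp

lemma map₂_homCast (F : C ⥤ᵖ D) {a a' b b' : C} (ha : a = a') (hb : b = b') {f g : a' ⟶ b'}
    (η : f ⟶ g) :
    F.map₂ ((homCast ha hb).map η) = eqToHom (map_homCast F ha hb f) ≫
      (homCast (congrArg F.obj ha) (congrArg F.obj hb)).map (F.map₂ η) ≫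
      eqToHom (map_homCast F ha hb g).symm := by
  subst ha hb; simp

lemma homCast_map_eqToHom {a a' b b' : C} (ha : a = a') (hb : b = b') {f g : a' ⟶ b'}
    (h : f = g) : (homCast ha hb).map (eqToHom h) = eqToHom (by rw [h]) := by
  subst h; simp

lemma homCast_whiskerRight {a a' b b' c c' : C} (ha : a = a') (hb : b = b') (hc : c = c')
    {f g : a' ⟶ b'} (η : f ⟶ g) (k : b' ⟶ c') :
    (homCast ha hc).map (η ▷ k) = eqToHom (homCast_comp ha hb hc f k) ≫
      (homCast ha hb).map η ▷ (homCast hb hc).obj k ≫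
        eqToHom (homCast_comp ha hb hc g k).symm := by
  subst ha hb hc; simp

lemma homCast_whiskerLeft {a a' b b' c c' : C} (ha : a = a') (hb : b = b') (hc : c = c')
    (k : a' ⟶ b') {f g : b' ⟶ c'} (η : f ⟶ g) :
    (homCast ha hc).map (k ◁ η) = eqToHom (homCast_comp ha hb hc k f) ≫
      (homCast ha hb).obj k ◁ (homCast hb hc).map η ≫
        eqToHom (homCast_comp ha hb hc k g).symm := by
  subst ha hb hc; simp

lemma comp_aux {x y z x' y' z' x'' y'' z'' : C} (hx : x = x') (hy : y = y') (hz : z = z')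
    (hx' : x' = x'') (hy' : y' = y'') (hz' : z' = z'')
    {f : x ⟶ y} {g : y ⟶ z} {k : x ⟶ z} {f' : x' ⟶ y'} {g' : y' ⟶ z'} {k' : x' ⟶ z'}
    {f'' : x'' ⟶ y''} {g'' : y'' ⟶ z''} {k'' : x'' ⟶ z''}
    (m : k ⟶ f ≫ g) (m' : k' ⟶ f' ≫ g') (m'' : k'' ⟶ f'' ≫ g'')
    (p : f ⟶ (homCast hx hy).obj f') (q : g ⟶ (homCast hy hz).obj g')
    (r : k ⟶ (homCast hx hz).obj k') (p' : f' ⟶ (homCast hx' hy').obj f'')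
    (q' : g' ⟶ (homCast hy' hz').obj g'') (r' : k' ⟶ (homCast hx' hz').obj k'')
    (h : r ≫ (homCast hx hz).map m' ≫ eqToHom (homCast_comp hx hy hz f' g') =
      m ≫ p ▷ g ≫ (homCast hx hy).obj f' ◁ q)
    (h' : r' ≫ (homCast hx' hz').map m'' ≫ eqToHom (homCast_comp hx' hy' hz' f'' g'') =
      m' ≫ p' ▷ g' ≫ (homCast hx' hy').obj f'' ◁ q') :
    (r ≫ (homCast hx hz).map r' ≫ eqToHom (homCast_trans hx hx' hz hz' k'')) ≫
      (homCast (hx.trans hx') (hz.trans hz')).map m'' ≫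
      eqToHom (homCast_comp (hx.trans hx') (hy.trans hy') (hz.trans hz') f'' g'') =
    m ≫ (p ≫ (homCast hx hy).map p' ≫ eqToHom (homCast_trans hx hx' hy hy' f'')) ▷ g ≫
      (homCast (hx.trans hx') (hy.trans hy')).obj f'' ◁
        (q ≫ (homCast hy hz).map q' ≫ eqToHom (homCast_trans hy hy' hz hz' g'')) := by
  subst hx hy hz hx' hy' hz'
  simp only [homCast, Functor.id_map, Functor.id_obj, eqToHom_refl, Category.comp_id,
    Category.assoc] at h h' ⊢
  rw [h', reassoc_of% h]
  simp [whisker_exchange_assoc]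

lemma whiskerRight_aux (H : C ⥤ᵖ D) {x y z x' y' z' : C} (hx : x = x') (hy : y = y')
    (hz : z = z') {f : x ⟶ y} {g : y ⟶ z} {k : x ⟶ z} {f' : x' ⟶ y'} {g' : y' ⟶ z'}
    {k' : x' ⟶ z'} (m : k ⟶ f ≫ g) (m' : k' ⟶ f' ≫ g')
    (p : f ⟶ (homCast hx hy).obj f') (q : g ⟶ (homCast hy hz).obj g')
    (r : k ⟶ (homCast hx hz).obj k')
    (h : r ≫ (homCast hx hz).map m' ≫ eqToHom (homCast_comp hx hy hz f' g') =
      m ≫ p ▷ g ≫ (homCast hx hy).obj f' ◁ q) :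
    (H.map₂ r ≫ eqToHom (map_homCast H hx hz k')) ≫
      (homCast (congrArg H.obj hx) (congrArg H.obj hz)).map
        (H.map₂ m' ≫ (H.mapComp f' g').hom) ≫
      eqToHom (homCast_comp (congrArg H.obj hx) (congrArg H.obj hy) (congrArg H.obj hz) _ _) =
    (H.map₂ m ≫ (H.mapComp f g).hom) ≫
      (H.map₂ p ≫ eqToHom (map_homCast H hx hy f')) ▷ H.map g ≫
      (homCast (congrArg H.obj hx) (congrArg H.obj hy)).obj (H.map f') ◁
        (H.map₂ q ≫ eqToHom (map_homCast H hy hz g')) := by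
  subst hx hy hz
  simp only [homCast, Functor.id_map, Functor.id_obj, eqToHom_refl, Category.comp_id,
    Category.assoc] at h ⊢
  rw [← H.map₂_comp_assoc, h]
  simp

lemma whiskerRight_aux' (H : C ⥤ᵖ D) {x x' : C} (hx : x = x') {k : x ⟶ x} {k' : x' ⟶ x'}
    (m : k ⟶ 𝟙 x) (m' : k' ⟶ 𝟙 x') (r : k ⟶ (homCast hx hx).obj k')
    (h : r ≫ (homCast hx hx).map m' ≫ eqToHom (homCast_id hx) = m) :
    (H.map₂ r ≫ eqToHom (map_homCast H hx hx k')) ≫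
      (homCast (congrArg H.obj hx) (congrArg H.obj hx)).map
        (H.map₂ m' ≫ (H.mapId x').hom) ≫
      eqToHom (homCast_id (congrArg H.obj hx)) =
    H.map₂ m ≫ (H.mapId x).hom := by
  subst hx
  simp only [homCast, Functor.id_map, Functor.id_obj, eqToHom_refl, Category.comp_id] at h ⊢
  rw [← H.map₂_comp_assoc, h]

lemma comp_whiskerRight_aux (K : C ⥤ᵖ D) {x x' x'' y y' y'' : C} (hx : x = x') (hy : y = y')
    (hx' : x' = x'') (hy' : y' = y'') {f : x ⟶ y} {f' : x' ⟶ y'} {f'' : x'' ⟶ y''}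
    (p : f ⟶ (homCast hx hy).obj f') (p' : f' ⟶ (homCast hx' hy').obj f'') :
    K.map₂ (p ≫ (homCast hx hy).map p' ≫ eqToHom (homCast_trans hx hx' hy hy' f'')) ≫
      eqToHom (map_homCast K (hx.trans hx') (hy.trans hy') f'') =
    (K.map₂ p ≫ eqToHom (map_homCast K hx hy f')) ≫
      (homCast (congrArg K.obj hx) (congrArg K.obj hy)).map
        (K.map₂ p' ≫ eqToHom (map_homCast K hx' hy' f'')) ≫
      eqToHom (homCast_trans _ _ _ _ _) := by
  subst hx hy hx' hy'
  simp [homCast]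

lemma whiskerRight_comp_aux {E : Type u₄} [Bicategory.{w₄, v₄} E] (H : C ⥤ᵖ D) (K : D ⥤ᵖ E)
    {x x' y y' : C} (hx : x = x') (hy : y = y') {f : x ⟶ y} {f' : x' ⟶ y'}
    (p : f ⟶ (homCast hx hy).obj f') :
    K.map₂ (H.map₂ p) ≫ eqToHom (map_homCast (H.comp K) hx hy f') =
    K.map₂ (H.map₂ p ≫ eqToHom (map_homCast H hx hy f')) ≫
      eqToHom (map_homCast K (congrArg H.obj hx) (congrArg H.obj hy) (H.map f')) := by
  subst hx hy
  change f ⟶ f' at p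
  change K.map₂ (H.map₂ p) ≫ eqToHom rfl = K.map₂ (H.map₂ p ≫ eqToHom rfl) ≫ eqToHom rfl
  simp

lemma whisker_exchange_aux {H K : C ⥤ᵖ D} (β : Icon H K) {x x' y y' : C} (hx : x = x')
    (hy : y = y') {f : x ⟶ y} {f' : x' ⟶ y'} (p : f ⟶ (homCast hx hy).obj f') :
    β.app f ≫ (homCast (β.obj_eq x) (β.obj_eq y)).map
        (K.map₂ p ≫ eqToHom (map_homCast K hx hy f')) ≫ eqToHom (homCast_trans _ _ _ _ _) =
      (H.map₂ p ≫ eqToHom (map_homCast H hx hy f')) ≫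
        (homCast (congrArg H.obj hx) (congrArg H.obj hy)).map (β.app f') ≫
        eqToHom (homCast_trans _ _ _ _ _) := by
  subst hx hy
  change f ⟶ f' at p
  change β.app f ≫ (homCast _ _).map (K.map₂ p ≫ eqToHom rfl) ≫ eqToHom rfl =
    (H.map₂ p ≫ eqToHom rfl) ≫ β.app f' ≫ eqToHom rfl
  simp [β.naturality p]

/-- Vertical composition of icons. -/
def comp {F G H : B ⥤ᵖ C} (α : Icon F G) (β : Icon G H) : Icon F H where
  obj_eq a := (α.obj_eq a).trans (β.obj_eq a)
  app {a b} f := α.app f ≫ (homCast (α.obj_eq a) (α.obj_eq b)).map (β.app f) ≫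
    eqToHom (homCast_trans _ _ _ _ _)
  naturality {a b f g} η := by
    have h1 := α.naturality η
    have h2 := congrArg (homCast (α.obj_eq a) (α.obj_eq b)).map (β.naturality η)
    rw [Functor.map_comp, Functor.map_comp, homCast_map_trans] at h2
    rw [reassoc_of% h1, reassoc_of% h2]
    simp
  app_id a := by
    have h1 := α.app_id a
    have h2 := congrArg (homCast (α.obj_eq a) (α.obj_eq a)).map (β.app_id a)
    rw [Functor.map_comp, Functor.map_comp, homCast_map_trans] at h2
    rw [← h1, ← h2]
    simp [homCast_map_eqToHom]
  app_comp {a b c} f g := comp_aux _ _ _ _ _ _ _ _ _ _ _ _ _ _ _ (α.app_comp f g) (β.app_comp f g)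

/-- Whiskering of an icon with a pseudofunctor applied before it. -/
def whiskerLeft (F : B ⥤ᵖ C) {G H : C ⥤ᵖ D} (α : Icon G H) : Icon (F.comp G) (F.comp H) where
  obj_eq a := α.obj_eq (F.obj a)
  app f := α.app (F.map f)
  naturality η := α.naturality _
  app_id a := by
    have h1 := α.naturality (F.mapId a).hom
    have h2 := α.app_id (F.obj a)
    have h3 : α.app (F.map (𝟙 a)) ≫
        (homCast (α.obj_eq (F.obj a)) (α.obj_eq (F.obj a))).map
          (H.map₂ (F.mapId a).hom ≫ (H.mapId (F.obj a)).hom) ≫ eqToHom (homCast_id _) =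
        G.map₂ (F.mapId a).hom ≫ (G.mapId (F.obj a)).hom := by
      rw [Functor.map_comp, Category.assoc, ← reassoc_of% h1, h2]
    exact h3
  app_comp {a b c} f g := by
    have h1 := α.naturality (F.mapComp f g).hom
    have h2 := α.app_comp (F.map f) (F.map g)
    have h3 : α.app (F.map (f ≫ g)) ≫
        (homCast (α.obj_eq (F.obj a)) (α.obj_eq (F.obj c))).map
          (H.map₂ (F.mapComp f g).hom ≫ (H.mapComp (F.map f) (F.map g)).hom) ≫
          eqToHom (homCast_comp _ (α.obj_eq (F.obj b)) _ _ _) =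
        (G.map₂ (F.mapComp f g).hom ≫ (G.mapComp (F.map f) (F.map g)).hom) ≫
          α.app (F.map f) ▷ G.map (F.map g) ≫ (homCast _ _).obj (H.map (F.map f)) ◁
            α.app (F.map g) := by
      rw [Functor.map_comp, Category.assoc, ← reassoc_of% h1, h2, Category.assoc]
    exact h3

/-- Whiskering of an icon with a pseudofunctor applied after it. -/
def whiskerRight {F G : B ⥤ᵖ C} (α : Icon F G) (H : C ⥤ᵖ D) : Icon (F.comp H) (G.comp H) where
  obj_eq a := congrArg H.obj (α.obj_eq a)
  app f := H.map₂ (α.app f) ≫ eqToHom (map_homCast H _ _ _)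
  naturality {a b f g} η := by
    have h1 := congrArg H.map₂ (α.naturality η)
    rw [H.map₂_comp, H.map₂_comp, map₂_homCast] at h1
    have h2 : H.map₂ (F.map₂ η) ≫ H.map₂ (α.app g) ≫ eqToHom (map_homCast H _ _ _) =
      (H.map₂ (α.app f) ≫ eqToHom (map_homCast H _ _ _)) ≫
        (homCast (congrArg H.obj (α.obj_eq a)) (congrArg H.obj (α.obj_eq b))).map
          (H.map₂ (G.map₂ η)) := by
      rw [reassoc_of% h1]; simp
    exact h2
  app_id a := whiskerRight_aux' H _ _ _ _ (α.app_id a)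
  app_comp f g := whiskerRight_aux H _ _ _ _ _ _ _ _ (α.app_comp f g)

lemma comp_whiskerRight {F G H : B ⥤ᵖ C} (α : Icon F G) (β : Icon G H) (K : C ⥤ᵖ D) :
    (α.comp β).whiskerRight K = (α.whiskerRight K).comp (β.whiskerRight K) :=
  ext' fun _ => comp_whiskerRight_aux K _ _ _ _ _ _

lemma whiskerRight_comp {E : Type u₄} [Bicategory.{w₄, v₄} E] {F G : B ⥤ᵖ C} (α : Icon F G)
    (H : C ⥤ᵖ D) (K : D ⥤ᵖ E) {a b : B} (f : a ⟶ b) :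
    (α.whiskerRight (H.comp K)).app f = ((α.whiskerRight H).whiskerRight K).app f :=
  whiskerRight_comp_aux H K _ _ _

lemma whisker_exchange {F G : B ⥤ᵖ C} {H K : C ⥤ᵖ D} (α : Icon F G) (β : Icon H K) :
    (β.whiskerLeft F).comp (α.whiskerRight K) = (α.whiskerRight H).comp (β.whiskerLeft G) :=
  ext' fun _ => whisker_exchange_aux β _ _ _

/-- The icon with identity components between the two ways of composing three
pseudofunctors. -/
def assocHom {E : Type u₄} [Bicategory.{w₄, v₄} E] (F : B ⥤ᵖ C) (G : C ⥤ᵖ D) (H : D ⥤ᵖ E) :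
    Icon ((F.comp G).comp H) (F.comp (G.comp H)) where
  obj_eq _ := rfl
  app f := 𝟙 (H.map (G.map (F.map f)))
  naturality η := (Category.comp_id _).trans (Category.id_comp _).symm
  app_id a := by
    change 𝟙 _ ≫ (H.map₂ (G.map₂ (F.mapId a).hom) ≫ H.map₂ (G.mapId _).hom ≫
      (H.mapId _).hom) ≫ eqToHom rfl =
      H.map₂ (G.map₂ (F.mapId a).hom ≫ (G.mapId _).hom) ≫ (H.mapId _).hom
    simp
  app_comp f g := by
    change 𝟙 _ ≫ (H.map₂ (G.map₂ (F.mapComp f g).hom) ≫ H.map₂ (G.mapComp _ _).hom ≫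
      (H.mapComp _ _).hom) ≫ eqToHom rfl =
      (H.map₂ (G.map₂ (F.mapComp f g).hom ≫ (G.mapComp _ _).hom) ≫ (H.mapComp _ _).hom) ≫
        𝟙 (H.map (G.map (F.map f))) ▷ H.map (G.map (F.map g)) ≫
        H.map (G.map (F.map f)) ◁ 𝟙 (H.map (G.map (F.map g)))
    simp

/-- The inverse of `assocHom`. -/
def assocInv {E : Type u₄} [Bicategory.{w₄, v₄} E] (F : B ⥤ᵖ C) (G : C ⥤ᵖ D) (H : D ⥤ᵖ E) :
    Icon (F.comp (G.comp H)) ((F.comp G).comp H) where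
  obj_eq _ := rfl
  app f := 𝟙 (H.map (G.map (F.map f)))
  naturality η := (Category.comp_id _).trans (Category.id_comp _).symm
  app_id a := by
    change 𝟙 _ ≫ (H.map₂ (G.map₂ (F.mapId a).hom ≫ (G.mapId _).hom) ≫ (H.mapId _).hom) ≫
      eqToHom rfl = H.map₂ (G.map₂ (F.mapId a).hom) ≫ H.map₂ (G.mapId _).hom ≫ (H.mapId _).hom
    simp
  app_comp f g := by
    change 𝟙 _ ≫ (H.map₂ (G.map₂ (F.mapComp f g).hom ≫ (G.mapComp _ _).hom) ≫
        (H.mapComp _ _).hom) ≫ eqToHom rfl =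
      (H.map₂ (G.map₂ (F.mapComp f g).hom) ≫ H.map₂ (G.mapComp _ _).hom ≫
        (H.mapComp _ _).hom) ≫ 𝟙 (H.map (G.map (F.map f))) ▷ H.map (G.map (F.map g)) ≫
        H.map (G.map (F.map f)) ◁ 𝟙 (H.map (G.map (F.map g)))
    simp

/-- The icon with identity components from `𝟙 ≫ F` to `F`. -/
def leftUnitHom (F : B ⥤ᵖ C) : Icon ((Pseudofunctor.id B).comp F) F where
  obj_eq _ := rfl
  app f := 𝟙 (F.map f)
  naturality η := (Category.comp_id _).trans (Category.id_comp _).symm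
  app_id a := by
    change 𝟙 _ ≫ (F.mapId a).hom ≫ eqToHom rfl = F.map₂ (𝟙 _) ≫ (F.mapId a).hom
    simp
  app_comp f g := by
    change 𝟙 _ ≫ (F.mapComp f g).hom ≫ eqToHom rfl = (F.map₂ (𝟙 _) ≫ (F.mapComp f g).hom) ≫
      𝟙 (F.map f) ▷ F.map g ≫ F.map f ◁ 𝟙 (F.map g)
    simp

/-- The inverse of `leftUnitHom`. -/
def leftUnitInv (F : B ⥤ᵖ C) : Icon F ((Pseudofunctor.id B).comp F) where
  obj_eq _ := rfl
  app f := 𝟙 (F.map f)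
  naturality η := (Category.comp_id _).trans (Category.id_comp _).symm
  app_id a := by
    change 𝟙 _ ≫ (F.map₂ (𝟙 _) ≫ (F.mapId a).hom) ≫ eqToHom rfl = (F.mapId a).hom
    simp
  app_comp f g := by
    change 𝟙 _ ≫ (F.map₂ (𝟙 _) ≫ (F.mapComp f g).hom) ≫ eqToHom rfl = (F.mapComp f g).hom ≫
      𝟙 (F.map f) ▷ F.map g ≫ F.map f ◁ 𝟙 (F.map g)
    simp

/-- The icon with identity components from `F ≫ 𝟙` to `F`. -/
def rightUnitHom (F : B ⥤ᵖ C) : Icon (F.comp (Pseudofunctor.id C)) F where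
  obj_eq _ := rfl
  app f := 𝟙 (F.map f)
  naturality η := (Category.comp_id _).trans (Category.id_comp _).symm
  app_id a := by
    change 𝟙 _ ≫ (F.mapId a).hom ≫ eqToHom rfl = (F.mapId a).hom ≫ 𝟙 _
    simp
  app_comp f g := by
    change 𝟙 _ ≫ (F.mapComp f g).hom ≫ eqToHom rfl = ((F.mapComp f g).hom ≫ 𝟙 _) ≫
      𝟙 (F.map f) ▷ F.map g ≫ F.map f ◁ 𝟙 (F.map g)
    simp

/-- The inverse of `rightUnitHom`. -/
def rightUnitInv (F : B ⥤ᵖ C) : Icon F (F.comp (Pseudofunctor.id C)) where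
  obj_eq _ := rfl
  app f := 𝟙 (F.map f)
  naturality η := (Category.comp_id _).trans (Category.id_comp _).symm
  app_id a := by
    change 𝟙 _ ≫ ((F.mapId a).hom ≫ 𝟙 _) ≫ eqToHom rfl = (F.mapId a).hom
    simp
  app_comp f g := by
    change 𝟙 _ ≫ ((F.mapComp f g).hom ≫ 𝟙 _) ≫ eqToHom rfl = (F.mapComp f g).hom ≫
      𝟙 (F.map f) ▷ F.map g ≫ F.map f ◁ 𝟙 (F.map g)
    simp

end Icon

end Icons

/-- The objects of the 2-category `2Cat_{p,i}`: small (strict) 2-categories. -/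
structure TwoCatPI : Type (u + 1) where
  carrier : Type u
  [bicategory : Bicategory.{u, u} carrier]
  [strict : Strict carrier]

attribute [instance] TwoCatPI.bicategory TwoCatPI.strict

namespace TwoCatPI

/-- The 1-cells of `2Cat_{p,i}`: pseudofunctors. -/
structure Hom (X Y : TwoCatPI.{u}) where
  fn : X.carrier ⥤ᵖ Y.carrier

@[ext]
lemma Hom.ext' {X Y : TwoCatPI.{u}} {F G : Hom X Y} (h : F.fn = G.fn) : F = G := by
  cases F; cases G; congr

instance : CategoryStruct TwoCatPI.{u} where
  Hom X Y := Hom X Y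
  id X := ⟨Pseudofunctor.id X.carrier⟩
  comp F G := ⟨F.fn.comp G.fn⟩

/-- The 2-cells of `2Cat_{p,i}`: icons. -/
structure Hom₂ {X Y : TwoCatPI.{u}} (F G : X ⟶ Y) where
  icon : Icon F.fn G.fn

lemma Hom₂.ext' {X Y : TwoCatPI.{u}} {F G : X ⟶ Y} (α β : Hom₂ F G)
    (h : ∀ {a b : X.carrier} (f : a ⟶ b), α.icon.app f = β.icon.app f) : α = β := by
  cases α; cases β
  congr
  exact Icon.ext' h

instance homCategory (X Y : TwoCatPI.{u}) : Category (X ⟶ Y) where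
  Hom F G := Hom₂ F G
  id F := ⟨Icon.id F.fn⟩
  comp α β := ⟨α.icon.comp β.icon⟩
  id_comp {F G} α := Hom₂.ext' _ _ fun f => by
    change 𝟙 _ ≫ α.icon.app f ≫ eqToHom rfl = _
    simp
  comp_id {F G} α := Hom₂.ext' _ _ fun {a b} f => by
    change α.icon.app f ≫ (homCast (α.icon.obj_eq a) (α.icon.obj_eq b)).map (𝟙 _) ≫
      eqToHom rfl = _
    simp
  assoc α β γ := Hom₂.ext' _ _ fun {a b} f => by
    change (α.icon.app f ≫ (homCast _ _).map (β.icon.app f) ≫ eqToHom _) ≫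
        (homCast _ _).map (γ.icon.app f) ≫ eqToHom _ =
      α.icon.app f ≫ (homCast _ _).map (β.icon.app f ≫ (homCast _ _).map (γ.icon.app f) ≫
        eqToHom _) ≫ eqToHom _
    simp [Icon.homCast_map_trans, Icon.homCast_map_eqToHom]

@[simp]
lemma id_fn (X : TwoCatPI.{u}) : Hom.fn (𝟙 X) = Pseudofunctor.id X.carrier := rfl

@[simp]
lemma comp_fn {X Y Z : TwoCatPI.{u}} (F : X ⟶ Y) (G : Y ⟶ Z) :
    Hom.fn (F ≫ G) = F.fn.comp G.fn := rfl

@[simp]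
lemma id_app {X Y : TwoCatPI.{u}} (F : X ⟶ Y) {a b : X.carrier} (f : a ⟶ b) :
    (Hom₂.icon (𝟙 F)).app f = 𝟙 (F.fn.map f) := rfl

@[simp]
lemma comp_app {X Y : TwoCatPI.{u}} {F G H : X ⟶ Y} (α : F ⟶ G) (β : G ⟶ H) {a b : X.carrier}
    (f : a ⟶ b) :
    (Hom₂.icon (α ≫ β)).app f = α.icon.app f ≫
      (homCast (α.icon.obj_eq a) (α.icon.obj_eq b)).map (β.icon.app f) ≫
        eqToHom (homCast_trans _ _ _ _ _) := rfl

/-- The 2-category `2Cat_{p,i}` of 2-categories, pseudofunctors and icons. -/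
instance instBicategory : Bicategory TwoCatPI.{u} where
  toCategoryStruct := inferInstance
  homCategory := homCategory
  whiskerLeft F _ _ α := Hom₂.mk (α.icon.whiskerLeft F.fn)
  whiskerRight α H := Hom₂.mk (α.icon.whiskerRight H.fn)
  associator F G H :=
    { hom := ⟨Icon.assocHom F.fn G.fn H.fn⟩
      inv := ⟨Icon.assocInv F.fn G.fn H.fn⟩
      hom_inv_id := Hom₂.ext' _ _ fun f => by
        change 𝟙 _ ≫ 𝟙 _ ≫ eqToHom rfl = 𝟙 _
        simp
      inv_hom_id := Hom₂.ext' _ _ fun f => by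
        change 𝟙 _ ≫ 𝟙 _ ≫ eqToHom rfl = 𝟙 _
        simp }
  leftUnitor F :=
    { hom := ⟨Icon.leftUnitHom F.fn⟩
      inv := ⟨Icon.leftUnitInv F.fn⟩
      hom_inv_id := Hom₂.ext' _ _ fun f => by
        change 𝟙 _ ≫ 𝟙 _ ≫ eqToHom rfl = 𝟙 _
        simp
      inv_hom_id := Hom₂.ext' _ _ fun f => by
        change 𝟙 _ ≫ 𝟙 _ ≫ eqToHom rfl = 𝟙 _
        simp }
  rightUnitor F :=
    { hom := ⟨Icon.rightUnitHom F.fn⟩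
      inv := ⟨Icon.rightUnitInv F.fn⟩
      hom_inv_id := Hom₂.ext' _ _ fun f => by
        change 𝟙 _ ≫ 𝟙 _ ≫ eqToHom rfl = 𝟙 _
        simp
      inv_hom_id := Hom₂.ext' _ _ fun f => by
        change 𝟙 _ ≫ 𝟙 _ ≫ eqToHom rfl = 𝟙 _
        simp }
  whiskerLeft_id F G := rfl
  whiskerLeft_comp F _ _ _ α β := rfl
  id_whiskerLeft {X Y F G} α := Hom₂.ext' _ _ fun {a b} f => by
    change α.icon.app f = 𝟙 _ ≫ (α.icon.app f ≫
      (homCast (α.icon.obj_eq a) (α.icon.obj_eq b)).map (𝟙 _) ≫ eqToHom rfl) ≫ eqToHom rfl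
    simp
  comp_whiskerLeft F G _ _ α := Hom₂.ext' _ _ fun {a b} f => by
    change α.icon.app (G.fn.map (F.fn.map f)) = 𝟙 _ ≫ (α.icon.app (G.fn.map (F.fn.map f)) ≫
      (homCast _ _).map (𝟙 _) ≫ eqToHom rfl) ≫ eqToHom rfl
    simp
  id_whiskerRight F G := Hom₂.ext' _ _ fun {a b} f => by
    change G.fn.map₂ (𝟙 _) ≫ eqToHom rfl = 𝟙 _
    simp
  comp_whiskerRight α β H := congrArg Hom₂.mk (Icon.comp_whiskerRight α.icon β.icon H.fn)
  whiskerRight_id {X Y F G} α := Hom₂.ext' _ _ fun {a b} f => by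
    change α.icon.app f ≫ eqToHom _ = 𝟙 _ ≫ (α.icon.app f ≫
      (homCast (α.icon.obj_eq a) (α.icon.obj_eq b)).map (𝟙 _) ≫ eqToHom rfl) ≫ eqToHom rfl
    simp
  whiskerRight_comp α G H := Hom₂.ext' _ _ fun {a b} f => by
    refine (Icon.whiskerRight_comp α.icon G.fn H.fn f).trans ?_
    change _ = 𝟙 _ ≫ (((α.icon.whiskerRight G.fn).whiskerRight H.fn).app f ≫
        (homCast _ _).map (𝟙 _) ≫ eqToHom rfl) ≫ eqToHom rfl
    simp
  whisker_assoc F _ _ α H := Hom₂.ext' _ _ fun {a b} f => by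
    change H.fn.map₂ (α.icon.app (F.fn.map f)) ≫ eqToHom _ =
      𝟙 _ ≫ ((H.fn.map₂ (α.icon.app (F.fn.map f)) ≫ eqToHom _) ≫
        (homCast _ _).map (𝟙 _) ≫ eqToHom rfl) ≫ eqToHom rfl
    simp
  whisker_exchange α β := congrArg Hom₂.mk (Icon.whisker_exchange α.icon β.icon)
  pentagon F G H K := Hom₂.ext' _ _ fun {a b} f => by
    change (K.fn.map₂ (𝟙 (H.fn.map (G.fn.map (F.fn.map f)))) ≫ eqToHom rfl) ≫
      (𝟙 (K.fn.map (H.fn.map (G.fn.map (F.fn.map f)))) ≫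
        𝟙 (K.fn.map (H.fn.map (G.fn.map (F.fn.map f)))) ≫ eqToHom rfl) ≫ eqToHom rfl =
      𝟙 (K.fn.map (H.fn.map (G.fn.map (F.fn.map f)))) ≫
        𝟙 (K.fn.map (H.fn.map (G.fn.map (F.fn.map f)))) ≫ eqToHom rfl
    simp
  triangle F G := Hom₂.ext' _ _ fun {a b} f => by
    change 𝟙 (G.fn.map (F.fn.map f)) ≫ 𝟙 (G.fn.map (F.fn.map f)) ≫ eqToHom rfl =
      G.fn.map₂ (𝟙 (F.fn.map f)) ≫ eqToHom rfl
    simp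

lemma pseudofunctor_ext {B : Type u₁} [Bicategory.{w₁, v₁} B] {C : Type u₂}
    [Bicategory.{w₂, v₂} C] {F G : B ⥤ᵖ C} (h : F.toPrelaxFunctor = G.toPrelaxFunctor)
    (hId : ∀ a, HEq (F.mapId a).hom (G.mapId a).hom)
    (hComp : ∀ {a b c : B} (f : a ⟶ b) (g : b ⟶ c),
      HEq (F.mapComp f g).hom (G.mapComp f g).hom) : F = G := by
  obtain ⟨P, i, m, _, _, _, _, _⟩ := F
  obtain ⟨P', i', m', _, _, _, _, _⟩ := G
  obtain rfl : P = P' := h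
  obtain rfl : i = i' := by
    funext a; exact Iso.ext (eq_of_heq (hId a))
  obtain rfl : @m = @m' := by
    funext a b c f g; exact Iso.ext (eq_of_heq (hComp f g))
  rfl

lemma eqToHom_app {X Y : TwoCatPI.{u}} {F G : X ⟶ Y} (h : F = G) {a b : X.carrier} (f : a ⟶ b) :
    (Hom₂.icon (eqToHom h)).app f = eqToHom (by subst h; rfl) := by
  subst h; rfl

/-- `2Cat_{p,i}` is a strict 2-category. -/
instance : Strict TwoCatPI.{u} where
  id_comp F := Hom.ext' (pseudofunctor_ext rfl
    (fun a => heq_of_eq (by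
      change F.fn.map₂ (𝟙 _) ≫ (F.fn.mapId a).hom = _
      simp))
    (fun f g => heq_of_eq (by
      change F.fn.map₂ (𝟙 _) ≫ (F.fn.mapComp f g).hom = _
      simp)))
  comp_id F := Hom.ext' (pseudofunctor_ext rfl
    (fun a => heq_of_eq (Category.comp_id _))
    (fun f g => heq_of_eq (Category.comp_id _)))
  assoc F G H := Hom.ext' (pseudofunctor_ext rfl
    (fun a => heq_of_eq (by
      change H.fn.map₂ (G.fn.map₂ (F.fn.mapId a).hom ≫ (G.fn.mapId _).hom) ≫
          (H.fn.mapId _).hom =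
        H.fn.map₂ (G.fn.map₂ (F.fn.mapId a).hom) ≫ H.fn.map₂ (G.fn.mapId _).hom ≫
          (H.fn.mapId _).hom
      simp))
    (fun f g => heq_of_eq (by
      change H.fn.map₂ (G.fn.map₂ (F.fn.mapComp f g).hom ≫ (G.fn.mapComp _ _).hom) ≫
          (H.fn.mapComp _ _).hom =
        H.fn.map₂ (G.fn.map₂ (F.fn.mapComp f g).hom) ≫ H.fn.map₂ (G.fn.mapComp _ _).hom ≫
          (H.fn.mapComp _ _).hom
      simp)))
  leftUnitor_eqToIso F := Iso.ext (Hom₂.ext' _ _ fun f => by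
    rw [eqToIso.hom, eqToHom_app]; rfl)
  rightUnitor_eqToIso F := Iso.ext (Hom₂.ext' _ _ fun f => by
    rw [eqToIso.hom, eqToHom_app]; rfl)
  associator_eqToIso F G H := Iso.ext (Hom₂.ext' _ _ fun f => by
    rw [eqToIso.hom, eqToHom_app]; rfl)

end TwoCatPI

section LocallyFull

variable {B : Type u₁} [Bicategory.{w₁, v₁} B] {C : Type u₂} (φ : C → B)

/-- A class of 1-cells, closed under identities and composition, between the objects `φ x`
of a bicategory. -/
structure OneCellClass where
  holds {x y : C} (f : φ x ⟶ φ y) : Prop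
  id_holds (x : C) : holds (𝟙 (φ x))
  comp_holds {x y z : C} {f : φ x ⟶ φ y} {g : φ y ⟶ φ z} :
    holds f → holds g → holds (f ≫ g)

variable {φ}

/-- The bicategory with objects the `x : C`, with 1-cells `x ⟶ y` the 1-cells `φ x ⟶ φ y` in the
class `P`, and with all 2-cells between these. -/
structure LocallyFull (P : OneCellClass φ) where
  obj : C

namespace LocallyFull

variable {P : OneCellClass φ}

/-- The 1-cells: those in the class `P`. -/
@[ext]
structure Hom (X Y : LocallyFull P) where
  cell : φ X.obj ⟶ φ Y.obj
  property : P.holds cell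

@[simps id_cell comp_cell]
instance : CategoryStruct (LocallyFull P) where
  Hom X Y := Hom X Y
  id X := ⟨𝟙 (φ X.obj), P.id_holds _⟩
  comp f g := ⟨f.cell ≫ g.cell, P.comp_holds f.property g.property⟩

@[ext]
lemma hom_ext {X Y : LocallyFull P} {f g : X ⟶ Y} (h : f.cell = g.cell) : f = g :=
  Hom.ext h

/-- The 2-cells: all 2-cells of the ambient bicategory. -/
@[ext]
structure Hom₂ {X Y : LocallyFull P} (f g : X ⟶ Y) where
  cell : f.cell ⟶ g.cell

@[simps!]
instance homCategory (X Y : LocallyFull P) : Category (X ⟶ Y) where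
  Hom f g := Hom₂ f g
  id f := ⟨𝟙 f.cell⟩
  comp η θ := ⟨η.cell ≫ θ.cell⟩

@[ext]
lemma hom₂_ext {X Y : LocallyFull P} {f g : X ⟶ Y} {η θ : f ⟶ g} (h : η.cell = θ.cell) :
    η = θ :=
  Hom₂.ext h

/-- Invertible 2-cells of the ambient bicategory are invertible. -/
@[simps]
def isoMk {X Y : LocallyFull P} {f g : X ⟶ Y} (e : f.cell ≅ g.cell) : f ≅ g where
  hom := ⟨e.hom⟩
  inv := ⟨e.inv⟩

@[simps!]
instance bicategory : Bicategory (LocallyFull P) where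
  toCategoryStruct := inferInstance
  homCategory := homCategory
  whiskerLeft f _ _ η := Hom₂.mk (f.cell ◁ Hom₂.cell η)
  whiskerRight η h := Hom₂.mk (Hom₂.cell η ▷ h.cell)
  associator f g h := isoMk (α_ f.cell g.cell h.cell)
  leftUnitor f := isoMk (λ_ f.cell)
  rightUnitor f := isoMk (ρ_ f.cell)
  whisker_exchange η θ := by ext; exact whisker_exchange _ _

attribute [-simp] bicategory_comp_cell bicategory_Hom

lemma eqToHom_cell {X Y : LocallyFull P} {f g : X ⟶ Y} (h : f = g) :
    (eqToHom h).cell = eqToHom (h ▸ rfl) := by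
  subst h; rfl

instance [Strict B] : Strict (LocallyFull P) where
  id_comp f := hom_ext (Strict.id_comp f.cell)
  comp_id f := hom_ext (Strict.comp_id f.cell)
  assoc f g h := hom_ext (Strict.assoc f.cell g.cell h.cell)
  leftUnitor_eqToIso f := by
    ext; simp [eqToHom_cell, Strict.leftUnitor_eqToIso]
  rightUnitor_eqToIso f := by
    ext; simp [eqToHom_cell, Strict.rightUnitor_eqToIso]
  associator_eqToIso f g h := by
    ext; simp [eqToHom_cell, Strict.associator_eqToIso]

variable (P) in
/-- The inclusion 2-functor into the ambient bicategory. -/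
@[simps!]
def inclusion : StrictPseudofunctor (LocallyFull P) B :=
  StrictPseudofunctor.mk'
    { obj X := φ X.obj
      map f := f.cell
      map₂ η := η.cell }

end LocallyFull

end LocallyFull

section FunctorBicategory

open scoped Pseudofunctor.StrongTrans

variable {A : Type u₁} [Bicategory.{w₁, v₁} A] {K : Type u₂} [Bicategory.{w₂, v₂} K]
  {L : Type u₃} [Bicategory.{w₃, v₃} L]

lemma eq_of_modification {F G : A ⥤ᵖ K} {α β : F ⟶ G} (Γ : α ⟶ β)
    (h : ∀ a, α.app a = β.app a) (hΓ : ∀ a, Γ.as.app a = eqToHom (h a)) : α = β := by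
  obtain ⟨⟨γ, hγ⟩⟩ := Γ
  obtain ⟨p, n, _, _, _⟩ := α
  obtain ⟨q, m, _, _, _⟩ := β
  obtain rfl : p = q := funext h
  obtain rfl : γ = fun a => 𝟙 (p a) := funext hΓ
  obtain rfl : @n = @m := by
    funext a b f
    apply Iso.ext
    simpa using (hγ f).symm
  rfl

lemma eqToHom_as_app {F G : A ⥤ᵖ K} {α β : F ⟶ G} (h : α = β) (a : A) :
    (eqToHom h).as.app a = eqToHom (by rw [h]) := by
  subst h; rfl

/-- `Bicat(A, K)` is a strict 2-category if `K` is one. -/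
instance [Strict K] : Strict (A ⥤ᵖ K) where
  id_comp α := eq_of_modification (λ_ α).hom (fun _ => Strict.id_comp _) fun a => by
    change (λ_ (α.app a)).hom = _
    rw [Strict.leftUnitor_eqToIso]; rfl
  comp_id α := eq_of_modification (ρ_ α).hom (fun _ => Strict.comp_id _) fun a => by
    change (ρ_ (α.app a)).hom = _
    rw [Strict.rightUnitor_eqToIso]; rfl
  assoc α β γ := eq_of_modification (α_ α β γ).hom (fun _ => Strict.assoc _ _ _) fun a => by
    change (α_ (α.app a) (β.app a) (γ.app a)).hom = _
    rw [Strict.associator_eqToIso]; rfl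
  leftUnitor_eqToIso α := by
    ext a
    simp only [eqToIso.hom, eqToHom_as_app, Strict.leftUnitor_eqToIso,
      Pseudofunctor.StrongTrans.leftUnitor_hom_as_app]
    rfl
  rightUnitor_eqToIso α := by
    ext a
    simp only [eqToIso.hom, eqToHom_as_app, Strict.rightUnitor_eqToIso,
      Pseudofunctor.StrongTrans.rightUnitor_hom_as_app]
    rfl
  associator_eqToIso α β γ := by
    ext a
    simp only [eqToIso.hom, eqToHom_as_app, Strict.associator_eqToIso,
      Pseudofunctor.StrongTrans.associator_hom_as_app]
    rfl

lemma twoNatural_aux [Strict K] {x x' x'' y y' y'' : K} {f : x ⟶ y} {f' : x' ⟶ y'}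
    {f'' : x'' ⟶ y''} {p : x ⟶ x'} {q : y ⟶ y'} {p' : x' ⟶ x''} {q' : y' ⟶ y''}
    (h : f ≫ q = p ≫ f') (h' : f' ≫ q' = p' ≫ f'') :
    (α_ f q q').inv ≫ (eqToIso h).hom ▷ q' ≫ (α_ p f' q').hom ≫ p ◁ (eqToIso h').hom ≫
      (α_ p p' f'').inv = eqToHom (by
        rw [← Strict.assoc, h, Strict.assoc, h', Strict.assoc]) := by
  simp [Strict.associator_eqToIso]

variable (A K) in
/-- The pseudonatural transformations between 2-functors which are 2-natural, i.e. whose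
pseudonaturality isomorphisms are identities. -/
def twoNatural [Strict K] :
    OneCellClass (fun F : StrictPseudofunctor A K => F.toPseudofunctor) where
  holds α := ∀ ⦃a b : A⦄ (f : a ⟶ b), ∃ h, α.naturality f = eqToIso h
  id_holds F a b f := ⟨(Strict.comp_id _).trans (Strict.id_comp _).symm, by
    change ρ_ (F.map f) ≪≫ (λ_ (F.map f)).symm = _
    rw [Strict.leftUnitor_eqToIso, Strict.rightUnitor_eqToIso]
    exact Iso.ext (eqToHom_trans (Strict.comp_id _) (Strict.id_comp _).symm)⟩
  comp_holds {F G H α β} hα hβ a b f := by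
    obtain ⟨h, e⟩ := hα f
    obtain ⟨h', e'⟩ := hβ f
    refine ⟨?_, ?_⟩
    · simp only [Pseudofunctor.StrongTrans.comp_app]
      rw [← Strict.assoc, h, Strict.assoc, h', Strict.assoc]
    · ext
      rw [Pseudofunctor.StrongTrans.categoryStruct_comp_naturality_hom, e, e']
      exact twoNatural_aux h h'

lemma map₂_associator_inv (i : K ⥤ᵖ L) {a b c d : K} (f : a ⟶ b) (g : b ⟶ c) (h : c ⟶ d) :
    i.map₂ (α_ f g h).inv = (i.mapComp f (g ≫ h)).hom ≫ i.map f ◁ (i.mapComp g h).hom ≫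
      (α_ (i.map f) (i.map g) (i.map h)).inv ≫ (i.mapComp f g).inv ▷ i.map h ≫
      (i.mapComp (f ≫ g) h).inv := by
  rw [i.map₂_iso_inv]
  apply IsIso.inv_eq_of_hom_inv_id
  simp

lemma postcomp_aux_id (i : K ⥤ᵖ L) {x x' : K} (p : x ⟶ x') {k : x ⟶ x} {k' : x' ⟶ x'}
    (m : k ⟶ 𝟙 x) (m' : k' ⟶ 𝟙 x') (n : k ≫ p ⟶ p ≫ k')
    (h : n ≫ p ◁ m' = m ▷ p ≫ (λ_ p).hom ≫ (ρ_ p).inv) :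
    ((i.mapComp k p).inv ≫ i.map₂ n ≫ (i.mapComp p k').hom) ≫
        i.map p ◁ (i.map₂ m' ≫ (i.mapId x').hom) =
      (i.map₂ m ≫ (i.mapId x).hom) ▷ i.map p ≫ (λ_ (i.map p)).hom ≫ (ρ_ (i.map p)).inv := by
  have h' : n ≫ p ◁ m' ≫ (ρ_ p).hom = m ▷ p ≫ (λ_ p).hom := by
    rw [reassoc_of% h]; simp
  have h'' := congrArg i.map₂ h'
  simp only [PrelaxFunctor.map₂_comp, i.map₂_whisker_left, i.map₂_whisker_right,
    i.map₂_left_unitor, i.map₂_right_unitor, Category.assoc, Iso.inv_hom_id_assoc] at h''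
  rw [← cancel_mono (ρ_ (i.map p)).hom, ← cancel_epi (i.mapComp k p).hom]
  simp only [Category.assoc, Iso.hom_inv_id_assoc, whiskerLeft_comp, comp_whiskerRight,
    Iso.inv_hom_id, Category.comp_id]
  exact h''

lemma postcomp_aux_comp (i : K ⥤ᵖ L) {x y z x' y' z' : K} {p : x ⟶ x'} {q : y ⟶ y'}
    {r : z ⟶ z'} {f : x ⟶ y} {g : y ⟶ z} {k : x ⟶ z} {f' : x' ⟶ y'} {g' : y' ⟶ z'}
    {k' : x' ⟶ z'} (m : k ⟶ f ≫ g) (m' : k' ⟶ f' ≫ g') (n : f ≫ q ⟶ p ≫ f')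
    (n' : g ≫ r ⟶ q ≫ g') (n'' : k ≫ r ⟶ p ≫ k')
    (h : n'' ≫ p ◁ m' = m ▷ r ≫ (α_ f g r).hom ≫ f ◁ n' ≫ (α_ f q g').inv ≫ n ▷ g' ≫
      (α_ p f' g').hom) :
    ((i.mapComp k r).inv ≫ i.map₂ n'' ≫ (i.mapComp p k').hom) ≫
        i.map p ◁ (i.map₂ m' ≫ (i.mapComp f' g').hom) =
      (i.map₂ m ≫ (i.mapComp f g).hom) ▷ i.map r ≫ (α_ _ _ _).hom ≫
        i.map f ◁ ((i.mapComp g r).inv ≫ i.map₂ n' ≫ (i.mapComp q g').hom) ≫ (α_ _ _ _).inv ≫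
        ((i.mapComp f q).inv ≫ i.map₂ n ≫ (i.mapComp p f').hom) ▷ i.map g' ≫
          (α_ _ _ _).hom := by
  have h' := congrArg i.map₂ h
  simp only [PrelaxFunctor.map₂_comp, i.map₂_whisker_left, i.map₂_whisker_right,
    i.map₂_associator, map₂_associator_inv, Category.assoc, Iso.inv_hom_id_assoc] at h'
  rw [← cancel_epi (i.mapComp k r).hom, ← cancel_mono (i.map p ◁ (i.mapComp f' g').inv),
    ← cancel_mono (i.mapComp p (f' ≫ g')).inv]
  simp only [Category.assoc, Iso.hom_inv_id_assoc, whiskerLeft_comp, comp_whiskerRight,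
    whiskerLeft_hom_inv_assoc, h']

/-- The pseudonatural transformation obtained by applying a pseudofunctor `i`. -/
def postcompTrans (i : K ⥤ᵖ L) {F G : A ⥤ᵖ K} (α : F ⟶ G) : F.comp i ⟶ G.comp i where
  app a := i.map (α.app a)
  naturality {a b} f := (i.mapComp (F.map f) (α.app b)).symm ≪≫ i.map₂Iso (α.naturality f) ≪≫
    i.mapComp (α.app a) (G.map f)
  naturality_naturality {a b f g} η := by
    have h := congrArg i.map₂ (α.naturality_naturality η)
    change i.map₂ (F.map₂ η) ▷ i.map (α.app b) ≫ (i.mapComp _ _).inv ≫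
        i.map₂ (α.naturality g).hom ≫ (i.mapComp _ _).hom =
      ((i.mapComp _ _).inv ≫ i.map₂ (α.naturality f).hom ≫ (i.mapComp _ _).hom) ≫
        i.map (α.app a) ◁ i.map₂ (G.map₂ η)
    rw [i.map₂_comp, i.map₂_comp, i.map₂_whisker_left, i.map₂_whisker_right] at h
    simp only [Category.assoc] at h ⊢
    rw [← cancel_epi (i.mapComp (F.map f) (α.app b)).hom, reassoc_of% h]
    simp
  naturality_id a := by
    change ((i.mapComp _ _).inv ≫ i.map₂ (α.naturality (𝟙 a)).hom ≫ (i.mapComp _ _).hom) ≫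
        i.map (α.app a) ◁ (i.map₂ (G.mapId a).hom ≫ (i.mapId _).hom) =
      (i.map₂ (F.mapId a).hom ≫ (i.mapId _).hom) ▷ i.map (α.app a) ≫
        (λ_ (i.map (α.app a))).hom ≫ (ρ_ (i.map (α.app a))).inv
    exact postcomp_aux_id i _ _ _ _ (α.naturality_id a)
  naturality_comp {a b c} f g := by
    change ((i.mapComp _ _).inv ≫ i.map₂ (α.naturality (f ≫ g)).hom ≫ (i.mapComp _ _).hom) ≫
        i.map (α.app a) ◁ (i.map₂ (G.mapComp f g).hom ≫ (i.mapComp _ _).hom) =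
      (i.map₂ (F.mapComp f g).hom ≫ (i.mapComp _ _).hom) ▷ i.map (α.app c) ≫
        (α_ _ _ _).hom ≫ i.map (F.map f) ◁ ((i.mapComp _ _).inv ≫
          i.map₂ (α.naturality g).hom ≫ (i.mapComp _ _).hom) ≫ (α_ _ _ _).inv ≫
        ((i.mapComp _ _).inv ≫ i.map₂ (α.naturality f).hom ≫ (i.mapComp _ _).hom) ▷
          i.map (G.map g) ≫ (α_ _ _ _).hom
    exact postcomp_aux_comp i _ _ _ _ _ (α.naturality_comp f g)

lemma postcomp_aux_mod (i : K ⥤ᵖ L) {x y x' y' : K} {p p' : x ⟶ x'} {q q' : y ⟶ y'}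
    {f : x ⟶ y} {f' : x' ⟶ y'} (n : f ≫ q ⟶ p ≫ f') (n' : f ≫ q' ⟶ p' ≫ f')
    (s : p ⟶ p') (t : q ⟶ q') (h : f ◁ t ≫ n' = n ≫ s ▷ f') :
    i.map f ◁ i.map₂ t ≫ (i.mapComp f q').inv ≫ i.map₂ n' ≫ (i.mapComp p' f').hom =
      ((i.mapComp f q).inv ≫ i.map₂ n ≫ (i.mapComp p f').hom) ≫ i.map₂ s ▷ i.map f' := by
  have h' := congrArg i.map₂ h
  simp only [PrelaxFunctor.map₂_comp, i.map₂_whisker_left, i.map₂_whisker_right,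
    Category.assoc] at h'
  rw [← cancel_epi (i.mapComp f q).hom, reassoc_of% h']
  simp

lemma postcomp_aux_mapId (i : K ⥤ᵖ L) {x y : K} (f : x ⟶ y) :
    i.map f ◁ (i.mapId y).hom ≫ (ρ_ (i.map f)).hom ≫ (λ_ (i.map f)).inv =
      ((i.mapComp f (𝟙 y)).inv ≫ i.map₂ ((ρ_ f).hom ≫ (λ_ f).inv) ≫
        (i.mapComp (𝟙 x) f).hom) ≫ (i.mapId x).hom ▷ i.map f := by
  rw [i.whiskerRight_mapId_hom, i.whiskerLeft_mapId_hom]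
  simp only [PrelaxFunctor.map₂_comp, Category.assoc, Iso.hom_inv_id_assoc, Iso.inv_hom_id_assoc,
    PrelaxFunctor.map₂_inv_hom_assoc]

lemma postcomp_aux_mapComp (i : K ⥤ᵖ L) {x x' x'' y y' y'' : K} {f : x ⟶ y} {f' : x' ⟶ y'}
    {f'' : x'' ⟶ y''} {p : x ⟶ x'} {q : y ⟶ y'} {p' : x' ⟶ x''} {q' : y' ⟶ y''}
    (n : f ≫ q ⟶ p ≫ f') (n' : f' ≫ q' ⟶ p' ≫ f'') :
    i.map f ◁ (i.mapComp q q').hom ≫ (α_ (i.map f) (i.map q) (i.map q')).inv ≫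
        ((i.mapComp f q).inv ≫ i.map₂ n ≫ (i.mapComp p f').hom) ▷ i.map q' ≫
        (α_ (i.map p) (i.map f') (i.map q')).hom ≫
        i.map p ◁ ((i.mapComp f' q').inv ≫ i.map₂ n' ≫ (i.mapComp p' f'').hom) ≫
        (α_ (i.map p) (i.map p') (i.map f'')).inv =
      ((i.mapComp f (q ≫ q')).inv ≫ i.map₂ ((α_ f q q').inv ≫ n ▷ q' ≫ (α_ p f' q').hom ≫
        p ◁ n' ≫ (α_ p p' f'').inv) ≫ (i.mapComp (p ≫ p') f'').hom) ≫
        (i.mapComp p p').hom ▷ i.map f'' := by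
  simp [map₂_associator_inv]

variable (A K) in
/-- `[A, K]`: the 2-category of 2-functors, 2-natural transformations and modifications. -/
abbrev TwoFunctorCat [Strict K] := LocallyFull (twoNatural A K)

/-- Postcomposition with a pseudofunctor, between 2-categories of pseudofunctors,
pseudonatural transformations and modifications. -/
def postcompPseudo (A : Type u₁) [Bicategory.{w₁, v₁} A] (i : K ⥤ᵖ L) :
    (A ⥤ᵖ K) ⥤ᵖ (A ⥤ᵖ L) where
  obj F := F.comp i
  map α := postcompTrans i α
  map₂ Γ := ⟨{
    app a := i.map₂ (Γ.as.app a)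
    naturality f := postcomp_aux_mod i _ _ _ _ (Γ.as.naturality f) }⟩
  map₂_id α := by
    ext a; exact i.map₂_id _
  map₂_comp Γ Γ' := by
    ext a; exact i.map₂_comp _ _
  mapId F := Pseudofunctor.StrongTrans.isoMk (fun a => i.mapId (F.obj a))
    (fun f => postcomp_aux_mapId i (F.map f))
  mapComp α β := Pseudofunctor.StrongTrans.isoMk (fun a => i.mapComp (α.app a) (β.app a))
    (fun f => postcomp_aux_mapComp i (α.naturality f).hom (β.naturality f).hom)
  map₂_whisker_left α _ _ Γ := by
    ext a; exact i.map₂_whisker_left _ _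
  map₂_whisker_right Γ α := by
    ext a; exact i.map₂_whisker_right _ _
  map₂_associator α β γ := by
    ext a; exact i.map₂_associator _ _ _
  map₂_left_unitor α := by
    ext a; exact i.map₂_left_unitor _
  map₂_right_unitor α := by
    ext a; exact i.map₂_right_unitor _

/-- Postcomposition with a 2-functor `i`: the 2-functor `i_* : Bicat(A, K) ⟶ Bicat(A, L)`. -/
def postcomp (A : Type u₁) [Bicategory.{w₁, v₁} A] (i : StrictPseudofunctor K L) :
    StrictPseudofunctor (A ⥤ᵖ K) (A ⥤ᵖ L) where
  __ := postcompPseudo A i.toPseudofunctor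
  map_id F := eq_of_modification ((postcompPseudo A i.toPseudofunctor).mapId F).hom
    (fun a => i.map_id (F.obj a)) (fun a => by
      change (i.mapId _).hom = _
      rw [i.mapId_eq_eqToIso]; rfl)
  mapId_eq_eqToIso F := by
    ext a
    simp only [eqToIso.hom, eqToHom_as_app]
    change (i.mapId _).hom = _
    rw [i.mapId_eq_eqToIso]; rfl
  map_comp α β := eq_of_modification ((postcompPseudo A i.toPseudofunctor).mapComp α β).hom
    (fun a => i.map_comp (α.app a) (β.app a)) (fun a => by
      change (i.mapComp _ _).hom = _
      rw [i.mapComp_eq_eqToIso]; rfl)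
  mapComp_eq_eqToIso α β := by
    ext a
    simp only [eqToIso.hom, eqToHom_as_app]
    change (i.mapComp _ _).hom = _
    rw [i.mapComp_eq_eqToIso]; rfl

end FunctorBicategory

section TwoAdjunction

variable {B : Type u₁} [Bicategory.{w₁, v₁} B] {C : Type u₂} [Bicategory.{w₂, v₂} C]

/-- A 2-natural transformation between 2-functors. -/
structure TwoNatTrans (F G : StrictPseudofunctor B C) where
  app (b : B) : F.obj b ⟶ G.obj b
  naturality {b b' : B} (f : b ⟶ b') : F.map f ≫ app b' = app b ≫ G.map f
  naturality₂ {b b' : B} {f g : b ⟶ b'} (η : f ⟶ g) :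
    F.map₂ η ▷ app b' ≫ eqToHom (naturality g) = eqToHom (naturality f) ≫ app b ◁ G.map₂ η

/-- A 2-adjunction `L ⊣ R` between 2-categories: 2-natural unit and counit satisfying the triangle
identities on the nose. -/
structure TwoAdjunction [Strict B] [Strict C] (L : StrictPseudofunctor B C)
    (R : StrictPseudofunctor C B) where
  unit : TwoNatTrans (StrictPseudofunctor.id B) (L.comp R)
  counit : TwoNatTrans (R.comp L) (StrictPseudofunctor.id C)
  left_triangle (b : B) : L.map (unit.app b) ≫ counit.app (L.obj b) = 𝟙 (L.obj b)
  right_triangle (c : C) : unit.app (R.obj c) ≫ R.map (counit.app c) = 𝟙 (R.obj c)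

/-- A 1-cell `f` is an internal equivalence if it has an inverse up to invertible 2-cells. -/
def IsInternalEquivalence {a b : B} (f : a ⟶ b) : Prop :=
  ∃ g : b ⟶ a, Nonempty (f ≫ g ≅ 𝟙 a) ∧ Nonempty (g ≫ f ≅ 𝟙 b)

end TwoAdjunction

section Inclusion

open scoped Pseudofunctor.StrongTrans

/-- A pseudofunctor is a (strict) 2-functor if its structure isomorphisms are identities. -/
def IsTwoFunctor {B : Type u₁} [Bicategory.{w₁, v₁} B] {C : Type u₂} [Bicategory.{w₂, v₂} C]
    (F : B ⥤ᵖ C) : Prop :=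
  (∀ a, ∃ h, F.mapId a = eqToIso h) ∧
    ∀ ⦃a b c : B⦄ (f : a ⟶ b) (g : b ⟶ c), ∃ h, F.mapComp f g = eqToIso h

/-- The 2-functors among the 1-cells of `2Cat_{p,i}`. -/
def twoFunctors : OneCellClass (fun X : TwoCatPI.{u} => X) where
  holds F := IsTwoFunctor F.fn
  id_holds _ := ⟨fun _ => ⟨rfl, rfl⟩, fun _ _ _ _ _ => ⟨rfl, rfl⟩⟩
  comp_holds {X Y Z F G} hF hG := by
    refine ⟨fun a => ?_, fun a b c f g => ?_⟩
    · obtain ⟨h, e⟩ := hF.1 a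
      obtain ⟨h', e'⟩ := hG.1 (F.fn.obj a)
      refine ⟨(congrArg G.fn.map h).trans h', ?_⟩
      change G.fn.map₂Iso (F.fn.mapId a) ≪≫ G.fn.mapId (F.fn.obj a) = _
      rw [e, e', PrelaxFunctor.map₂Iso_eqToIso]
      exact eqToIso_trans _ _
    · obtain ⟨h, e⟩ := hF.2 f g
      obtain ⟨h', e'⟩ := hG.2 (F.fn.map f) (F.fn.map g)
      refine ⟨(congrArg G.fn.map h).trans h', ?_⟩
      change G.fn.map₂Iso (F.fn.mapComp f g) ≪≫ G.fn.mapComp (F.fn.map f) (F.fn.map g) = _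
      rw [e, e', PrelaxFunctor.map₂Iso_eqToIso]
      exact eqToIso_trans _ _

/-- The 2-category `2Cat_{2,i}` of small 2-categories, 2-functors and icons. -/
abbrev TwoCatTwoI := LocallyFull twoFunctors.{u}

/-- The inclusion 2-functor `J : [A, 2Cat_{2,i}] ⟶ Bicat(A, 2Cat_{p,i})`. -/
def inclusionJ (A : Type u) [Bicategory.{u, u} A] :
    StrictPseudofunctor (TwoFunctorCat A TwoCatTwoI.{u}) (A ⥤ᵖ TwoCatPI.{u}) :=
  (LocallyFull.inclusion (twoNatural A TwoCatTwoI.{u})).comp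
    (postcomp A (LocallyFull.inclusion twoFunctors.{u}))

end Inclusion

end TwoDim

open TwoDim

open scoped Pseudofunctor.StrongTrans

/-
For a pseudofunctor `X`, the 2-category `(QX) a` has the objects of `X a`, and its 1-cells are the
words of formal 1-cells `(f, v)` with `f : b ⟶ a` in `A` and `v` a 1-cell of `X b`. Evaluating
`(f, v)` at `(X f) v` turns words into 1-cells of `X a`, and the 2-cells of `(QX) a` are pulled back
along this evaluation. Acting on words through composition in `A`, the construction is strictly
functorial, and evaluation `QX ⟶ X` is a pseudonatural transformation whose components are the
identity on objects and equivalences on hom-categories. Hence it is an equivalence, with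
pseudo-inverse the unit `v ↦ (𝟙, v)`.

A transformation from `X` to a 2-functor `Y` extends along the unit in exactly one strict way: the
value on `(f, v)` is forced to be the value of `Y f` at the image of `v`. Together with the
bijection on 2-cells given by whiskering with an equivalence, this makes the unit a 2-dimensional
universal arrow, whence the 2-adjunction. Finally `J ε_Y` is a retraction of the equivalence
`η_{JY}`, hence an equivalence.
-/

namespace TwoDim

section EqUpTo

variable {C : Type u₁} [Category.{v₁} C] {D : Type u₂} [Category.{v₂} D]

/-- A morphism is an *identity up to equality* if it is `eqToHom` of an equality between its source
and its target. -/
def IsEqToHom {x y : C} (m : x ⟶ y) : Prop :=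
  ∃ h : x = y, m = eqToHom h

namespace IsEqToHom

variable {x y z : C}

lemma eqToHom (h : x = y) : IsEqToHom (eqToHom h) := ⟨h, rfl⟩

lemma id (x : C) : IsEqToHom (𝟙 x) := ⟨rfl, rfl⟩

lemma comp {m : x ⟶ y} {n : y ⟶ z} (hm : IsEqToHom m) (hn : IsEqToHom n) :
    IsEqToHom (m ≫ n) := by
  obtain ⟨rfl, rfl⟩ := hm
  obtain ⟨rfl, rfl⟩ := hn
  exact ⟨rfl, by simp⟩

lemma of_comp {m : x ⟶ y} {n : y ⟶ z} (h : IsEqToHom (m ≫ n)) (hn : IsEqToHom n) :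
    IsEqToHom m := by
  obtain ⟨rfl, rfl⟩ := hn
  simpa using h

lemma eq {m n : x ⟶ y} (hm : IsEqToHom m) (hn : IsEqToHom n) : m = n := by
  obtain ⟨_, rfl⟩ := hm
  obtain ⟨_, rfl⟩ := hn
  rfl

lemma map (F : C ⥤ D) {m : x ⟶ y} (h : IsEqToHom m) : IsEqToHom (F.map m) := by
  obtain ⟨rfl, rfl⟩ := h
  exact ⟨rfl, by simp⟩

lemma of_map (F : C ⥤ D) [F.Faithful] {m : x ⟶ y} (h : x = y) (hm : IsEqToHom (F.map m)) :
    IsEqToHom m := by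
  subst h
  exact ⟨rfl, F.map_injective (hm.eq ((id x).map F))⟩

end IsEqToHom

/-- Equality of morphisms up to equalities of their sources and targets. -/
def EqUpTo {x y x' y' : C} (m : x ⟶ y) (n : x' ⟶ y') : Prop :=
  ∃ (hx : x = x') (hy : y = y'), m = eqToHom hx ≫ n ≫ eqToHom hy.symm

namespace EqUpTo

variable {x y z x' y' z' x'' y'' : C}

lemma refl (m : x ⟶ y) : EqUpTo m m := ⟨rfl, rfl, by simp⟩

lemma of_eq {m n : x ⟶ y} (h : m = n) : EqUpTo m n := h ▸ refl m

lemma eq {m n : x ⟶ y} (h : EqUpTo m n) : m = n := by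
  obtain ⟨_, _, rfl⟩ := h
  simp

lemma symm {m : x ⟶ y} {n : x' ⟶ y'} (h : EqUpTo m n) : EqUpTo n m := by
  obtain ⟨rfl, rfl, rfl⟩ := h
  exact ⟨rfl, rfl, by simp⟩

lemma trans {m : x ⟶ y} {n : x' ⟶ y'} {k : x'' ⟶ y''} (h : EqUpTo m n) (h' : EqUpTo n k) :
    EqUpTo m k := by
  obtain ⟨rfl, rfl, rfl⟩ := h
  obtain ⟨rfl, rfl, rfl⟩ := h'
  exact ⟨rfl, rfl, by simp⟩

lemma comp {m : x ⟶ y} {n : y ⟶ z} {m' : x' ⟶ y'} {n' : y' ⟶ z'} (h : EqUpTo m m')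
    (h' : EqUpTo n n') : EqUpTo (m ≫ n) (m' ≫ n') := by
  obtain ⟨rfl, rfl, rfl⟩ := h
  obtain ⟨_, rfl, rfl⟩ := h'
  exact ⟨rfl, rfl, by simp⟩

lemma inv {m : x ≅ y} {n : x' ≅ y'} (h : EqUpTo m.hom n.hom) : EqUpTo m.inv n.inv := by
  obtain ⟨rfl, rfl, h⟩ := h
  obtain rfl : m = n := Iso.ext (by simpa using h)
  exact refl _

lemma map (F : C ⥤ D) {m : x ⟶ y} {n : x' ⟶ y'} (h : EqUpTo m n) :
    EqUpTo (F.map m) (F.map n) := by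
  obtain ⟨rfl, rfl, h⟩ := h
  exact of_eq (congrArg F.map (by simpa using h))

lemma app {F G : C ⥤ D} (α : F ⟶ G) (h : x = y) : EqUpTo (α.app x) (α.app y) := by
  subst h
  exact refl _

lemma eqToHom_conj (h : x = x') (m : x' ⟶ y') (h' : y' = y) :
    EqUpTo (eqToHom h ≫ m ≫ eqToHom h') m :=
  ⟨h, h'.symm, rfl⟩

lemma comp_eqToHom {m : x ⟶ y} {n : x' ⟶ y'} (h : EqUpTo m n) (hx : x = x') (hy : y = y') :
    m ≫ eqToHom hy = eqToHom hx ≫ n := by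
  obtain ⟨rfl, rfl, rfl⟩ := h
  simp

lemma of_isEqToHom {m : x ⟶ y} {m' : x' ⟶ y'} (h : IsEqToHom m) (h' : IsEqToHom m')
    (hx : x = x') : EqUpTo m m' := by
  subst hx
  obtain ⟨rfl, rfl⟩ := h
  obtain ⟨rfl, rfl⟩ := h'
  exact refl _

lemma isEqToHom {m : x ⟶ y} {m' : x' ⟶ y'} (h : EqUpTo m m') (h' : IsEqToHom m') :
    IsEqToHom m := by
  obtain ⟨rfl, rfl, rfl⟩ := h
  simpa using h'

lemma isEqToHom_comp {i : x ⟶ y} (hi : IsEqToHom i) (m : y ⟶ z) : EqUpTo (i ≫ m) m := by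
  obtain ⟨rfl, rfl⟩ := hi
  exact of_eq (by simp)

lemma isEqToHom_comp_inv {m : x ⟶ y} {n : x' ≅ y} (h : EqUpTo m n.hom) :
    IsEqToHom (m ≫ n.inv) := by
  obtain ⟨rfl, _, rfl⟩ := h
  exact ⟨rfl, by simp⟩

lemma of_isEqToHom_comp_inv {m : x ⟶ y} {n : x' ≅ y} (h : IsEqToHom (m ≫ n.inv)) :
    EqUpTo m n.hom := by
  obtain ⟨rfl, h⟩ := h
  exact of_eq ((Iso.comp_inv_eq _).1 h |>.trans (Category.id_comp _))

lemma of_comp {m : x ⟶ y} {n : y ≅ z} {m' : x' ⟶ y'} {n' : y' ≅ z'}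
    (h : EqUpTo (m ≫ n.hom) (m' ≫ n'.hom)) (hn : EqUpTo n.hom n'.hom) : EqUpTo m m' := by
  obtain ⟨rfl, rfl, hn⟩ := hn
  obtain rfl : n = n' := Iso.ext (by simpa using hn)
  obtain ⟨rfl, _, h⟩ := h
  exact of_eq (by simpa using h)

lemma of_map (F : C ⥤ D) [F.Faithful] {m : x ⟶ y} {n : x' ⟶ y'} (hx : x = x') (hy : y = y')
    (h : EqUpTo (F.map m) (F.map n)) : EqUpTo m n := by
  subst hx hy
  exact .of_eq (F.map_injective h.eq)

end EqUpTo

end EqUpTo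

section ArrowCategory

variable {B : Type u₁} [Bicategory.{w₁, v₁} B] {C : Type u₂} [Bicategory.{w₂, v₂} C]
  {D : Type u₃} [Bicategory.{w₃, v₃} D]

variable (C) in
/-- The 1-cells of a bicategory, as the objects of a category whose morphisms are the 2-cells
between 1-cells with propositionally equal ends. Icons are natural transformations between the
functors induced on these categories, without any transport along equalities of objects. -/
structure Arr where
  of ::
  {src : C}
  {tgt : C}
  hom : src ⟶ tgt

namespace Arr

/-- A 2-cell between 1-cells with propositionally equal ends. -/
structure Hom (p q : Arr C) where
  src_eq : p.src = q.src
  tgt_eq : p.tgt = q.tgt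
  cell : p.hom ⟶ (homCast src_eq tgt_eq).obj q.hom

instance : Quiver (Arr C) := ⟨Hom⟩

/-- A 2-cell as a morphism of the arrow category. -/
def ofCell {a b : C} {f g : a ⟶ b} (η : f ⟶ g) : of f ⟶ of g := ⟨rfl, rfl, η⟩

@[elab_as_elim]
lemma hom_induction {a b : C} {f : a ⟶ b} {motive : ∀ q : Arr C, (of f ⟶ q) → Prop}
    (ofCell : ∀ {g : a ⟶ b} (η : f ⟶ g), motive (of g) (ofCell η))
    {q : Arr C} (m : of f ⟶ q) : motive q m := by
  obtain ⟨g⟩ := q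
  obtain ⟨h, h', m⟩ := m
  dsimp only at h h'
  subst h h'
  exact ofCell m

instance : Category (Arr C) where
  id p := ofCell (𝟙 p.hom)
  comp m n := ⟨m.src_eq.trans n.src_eq, m.tgt_eq.trans n.tgt_eq,
    m.cell ≫ (homCast m.src_eq m.tgt_eq).map n.cell ≫ eqToHom (homCast_trans _ _ _ _ _)⟩
  id_comp {p q} m := by
    obtain ⟨f⟩ := p
    induction m using hom_induction
    simp [ofCell, homCast]
  comp_id {p q} m := by
    obtain ⟨f⟩ := p
    induction m using hom_induction
    simp [ofCell, homCast]
  assoc {p q r s} m n k := by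
    obtain ⟨f⟩ := p
    induction m using hom_induction
    induction n using hom_induction
    induction k using hom_induction
    simp [ofCell, homCast]

lemma ofCell_id {a b : C} (f : a ⟶ b) : ofCell (𝟙 f) = 𝟙 (of f) := rfl

lemma ofCell_comp {a b : C} {f g h : a ⟶ b} (η : f ⟶ g) (θ : g ⟶ h) :
    ofCell (η ≫ θ) = ofCell η ≫ ofCell θ := by
  change ofCell (η ≫ θ) = ofCell (η ≫ θ ≫ 𝟙 _)
  rw [Category.comp_id]

lemma ofCell_injective {a b : C} {f g : a ⟶ b} {η θ : f ⟶ g} (h : ofCell η = ofCell θ) :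
    η = θ := by
  injection h

lemma ofCell_inj {a b : C} {f g : a ⟶ b} {η θ : f ⟶ g} : ofCell η = ofCell θ ↔ η = θ :=
  ⟨ofCell_injective, congrArg ofCell⟩

/-- The 2-cell underlying a morphism between parallel 1-cells. -/
def toCell {a b : C} {f g : a ⟶ b} (m : of f ⟶ of g) : f ⟶ g := m.cell

@[simp]
lemma ofCell_toCell {a b : C} {f g : a ⟶ b} (m : of f ⟶ of g) : ofCell (toCell m) = m := rfl

/-- An invertible 2-cell as an isomorphism of the arrow category. -/
@[simps]
def ofIso {a b : C} {f g : a ⟶ b} (e : f ≅ g) : of f ≅ of g where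
  hom := ofCell e.hom
  inv := ofCell e.inv
  hom_inv_id := by rw [← ofCell_comp, e.hom_inv_id, ofCell_id]
  inv_hom_id := by rw [← ofCell_comp, e.inv_hom_id, ofCell_id]

/-- The invertible 2-cell underlying an isomorphism between parallel 1-cells. -/
def toIso {a b : C} {f g : a ⟶ b} (e : of f ≅ of g) : f ≅ g where
  hom := toCell e.hom
  inv := toCell e.inv
  hom_inv_id := ofCell_injective (by simp [ofCell_comp, ofCell_id])
  inv_hom_id := ofCell_injective (by simp [ofCell_comp, ofCell_id])

lemma of_homCast {a a' b b' : C} (h : a = a') (h' : b = b') (f : a' ⟶ b') :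
    of ((homCast h h').obj f) = of f := by
  subst h h'; rfl

lemma isEqToHom_ofCell {a b : C} {f g : a ⟶ b} {η : f ⟶ g} (h : IsEqToHom η) :
    IsEqToHom (ofCell η) := by
  obtain ⟨rfl, rfl⟩ := h
  exact ⟨rfl, rfl⟩

lemma eqUpTo_ofCell {a b : C} {f g f' g' : a ⟶ b} {η : f ⟶ g} {θ : f' ⟶ g'}
    (h : EqUpTo η θ) : EqUpTo (ofCell η) (ofCell θ) := by
  obtain ⟨rfl, rfl, h⟩ := h
  exact .of_eq (congrArg ofCell (by simpa using h))

/-- The functor between arrow categories induced by a pseudofunctor. -/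
abbrev map (F : B ⥤ᵖ C) : Arr B ⥤ Arr C where
  obj p := of (F.map p.hom)
  map m := ⟨congrArg F.obj m.src_eq, congrArg F.obj m.tgt_eq,
    F.map₂ m.cell ≫ eqToHom (map_homCast F _ _ _)⟩
  map_id p := congrArg ofCell ((Category.comp_id _).trans (F.map₂_id p.hom))
  map_comp {p q r} m n := by
    obtain ⟨f⟩ := p
    induction m using hom_induction
    induction n using hom_induction
    simp [ofCell, homCast, CategoryStruct.comp]

lemma map_map_ofCell (F : B ⥤ᵖ C) {a b : B} {f g : a ⟶ b} (η : f ⟶ g) :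
    (map F).map (ofCell η) = ofCell (F.map₂ η) := congrArg ofCell (Category.comp_id _)

lemma map_id_map {p q : Arr B} (m : p ⟶ q) : (map (Pseudofunctor.id B)).map m = m := by
  obtain ⟨f⟩ := p
  induction m using hom_induction
  exact map_map_ofCell _ _

lemma map_comp_map (F : B ⥤ᵖ C) (G : C ⥤ᵖ D) {p q : Arr B} (m : p ⟶ q) :
    (map (F.comp G)).map m = (map G).map ((map F).map m) := by
  obtain ⟨f⟩ := p
  induction m using hom_induction
  rw [map_map_ofCell, map_map_ofCell, map_map_ofCell]
  rfl

/-- Horizontal composition in the arrow category. -/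
def hcomp {a b c a' b' c' : C} {f : a ⟶ b} {g : b ⟶ c} {f' : a' ⟶ b'} {g' : b' ⟶ c'}
    (m : of f ⟶ of f') (n : of g ⟶ of g') : of (f ≫ g) ⟶ of (f' ≫ g') :=
  ⟨m.src_eq, n.tgt_eq, m.cell ▷ g ≫ (homCast m.src_eq m.tgt_eq).obj f' ◁ n.cell ≫
    eqToHom (homCast_comp m.src_eq m.tgt_eq n.tgt_eq f' g').symm⟩

lemma hcomp_ofCell {a b c : C} {f f' : a ⟶ b} {g g' : b ⟶ c} (η : f ⟶ f') (θ : g ⟶ g') :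
    hcomp (ofCell η) (ofCell θ) = ofCell (η ▷ g ≫ f' ◁ θ) := by
  change ofCell (η ▷ g ≫ f' ◁ θ ≫ 𝟙 _) = _
  rw [Category.comp_id]

@[elab_as_elim]
lemma hcomp_induction {a b c : C} {f : a ⟶ b} {g : b ⟶ c}
    {motive : ∀ {a' b' c' : C} (f' : a' ⟶ b') (g' : b' ⟶ c'),
      (of f ⟶ of f') → (of g ⟶ of g') → Prop}
    (ofCell : ∀ {f' : a ⟶ b} {g' : b ⟶ c} (η : f ⟶ f') (θ : g ⟶ g'),
      motive f' g' (ofCell η) (ofCell θ))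
    {a' b' c' : C} {f' : a' ⟶ b'} {g' : b' ⟶ c'} (m : of f ⟶ of f') (n : of g ⟶ of g') :
    motive f' g' m n := by
  obtain ⟨i, i', m⟩ := m
  obtain ⟨j, j', n⟩ := n
  dsimp only at i i' j j'
  subst i i' j'
  exact ofCell m n

lemma map_map_hcomp (F : B ⥤ᵖ C) {a b c a' b' c' : B} {f : a ⟶ b} {g : b ⟶ c} {f' : a' ⟶ b'}
    {g' : b' ⟶ c'} (m : of f ⟶ of f') (n : of g ⟶ of g') :
    (map F).map (hcomp m n) ≫ ofCell (F.mapComp f' g').hom =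
      ofCell (F.mapComp f g).hom ≫ hcomp ((map F).map m) ((map F).map n) := by
  induction m, n using hcomp_induction
  rw [hcomp_ofCell, map_map_ofCell, map_map_ofCell, map_map_ofCell, hcomp_ofCell, ← ofCell_comp,
    ← ofCell_comp]
  simp

lemma isEqToHom_hcomp {a b c a' b' c' : C} {f : a ⟶ b} {g : b ⟶ c} {f' : a' ⟶ b'}
    {g' : b' ⟶ c'} {m : of f ⟶ of f'} {n : of g ⟶ of g'} (hm : IsEqToHom m)
    (hn : IsEqToHom n) : IsEqToHom (hcomp m n) := by
  obtain ⟨h, rfl⟩ := hm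
  obtain ⟨h', rfl⟩ := hn
  cases h
  cases h'
  exact ⟨rfl, (hcomp_ofCell (𝟙 f) (𝟙 g)).trans (by simp [ofCell_id])⟩

lemma ofCell_comp_eq_comp_ofCell_iff {x y x' y' : C} (hx : x = x') (hy : y = y') {f g : x ⟶ y}
    {f' g' : x' ⟶ y'} (m : f ⟶ g) (m' : f' ⟶ g') (p : of f ⟶ of f') (q : of g ⟶ of g') :
    ofCell m ≫ q = p ≫ ofCell m' ↔ m ≫ q.cell = p.cell ≫ (homCast hx hy).map m' := by
  subst hx hy
  change ofCell m ≫ ofCell q.cell = ofCell p.cell ≫ ofCell m' ↔ m ≫ q.cell = p.cell ≫ m'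
  rw [← ofCell_comp, ← ofCell_comp, ofCell_inj]

lemma comp_ofCell_eq_ofCell_id_iff {x x' : C} (h : x = x') {k : x ⟶ x} {k' : x' ⟶ x'}
    (m : k ⟶ 𝟙 x) (m' : k' ⟶ 𝟙 x') (r : of k ⟶ of k') :
    r ≫ ofCell m' = ofCell m ≫ eqToHom (congrArg (fun x => of (𝟙 x)) h) ↔
      r.cell ≫ (homCast h h).map m' ≫ eqToHom (homCast_id h) = m := by
  subst h
  change ofCell r.cell ≫ ofCell m' = ofCell m ≫ 𝟙 _ ↔ r.cell ≫ m' ≫ 𝟙 _ = m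
  rw [← ofCell_comp, Category.comp_id, Category.comp_id, ofCell_inj]

lemma comp_ofCell_eq_ofCell_hcomp_iff {x y z x' y' z' : C} (hx : x = x') (hy : y = y')
    (hz : z = z') {f : x ⟶ y} {g : y ⟶ z} {k : x ⟶ z} {f' : x' ⟶ y'} {g' : y' ⟶ z'}
    {k' : x' ⟶ z'} (m : k ⟶ f ≫ g) (m' : k' ⟶ f' ≫ g') (p : of f ⟶ of f')
    (q : of g ⟶ of g') (r : of k ⟶ of k') :
    r ≫ ofCell m' = ofCell m ≫ hcomp p q ↔
      r.cell ≫ (homCast hx hz).map m' ≫ eqToHom (homCast_comp hx hy hz f' g') =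
        m ≫ p.cell ▷ g ≫ (homCast hx hy).obj f' ◁ q.cell := by
  subst hx hy hz
  change ofCell r.cell ≫ ofCell m' = ofCell m ≫ hcomp (ofCell p.cell) (ofCell q.cell) ↔
    r.cell ≫ m' ≫ 𝟙 _ = m ≫ p.cell ▷ g ≫ f' ◁ q.cell
  rw [← ofCell_comp, hcomp_ofCell, ← ofCell_comp, Category.comp_id, ofCell_inj]
  exact Iff.rfl

end Arr

namespace Icon

variable {F G : B ⥤ᵖ C}

/-- The natural transformation between arrow categories induced by an icon. -/
def arr (α : Icon F G) : Arr.map F ⟶ Arr.map G where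
  app p := ⟨α.obj_eq p.src, α.obj_eq p.tgt, α.app p.hom⟩
  naturality {p q} m := by
    obtain ⟨f⟩ := p
    induction m using Arr.hom_induction
    rw [Arr.map_map_ofCell, Arr.map_map_ofCell]
    exact (Arr.ofCell_comp_eq_comp_ofCell_iff (α.obj_eq _) (α.obj_eq _) _ _ _ _).2
      (α.naturality _)

lemma arr_app_id (α : Icon F G) (a : B) :
    α.arr.app (.of (𝟙 a)) ≫ Arr.ofCell (G.mapId a).hom = Arr.ofCell (F.mapId a).hom ≫
      eqToHom (congrArg (fun x => Arr.of (𝟙 x)) (α.obj_eq a)) :=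
  (Arr.comp_ofCell_eq_ofCell_id_iff (α.obj_eq a) _ _ _).2 (α.app_id a)

lemma arr_app_comp (α : Icon F G) {a b c : B} (f : a ⟶ b) (g : b ⟶ c) :
    α.arr.app (.of (f ≫ g)) ≫ Arr.ofCell (G.mapComp f g).hom =
      Arr.ofCell (F.mapComp f g).hom ≫ Arr.hcomp (α.arr.app (.of f)) (α.arr.app (.of g)) :=
  (Arr.comp_ofCell_eq_ofCell_hcomp_iff (α.obj_eq a) (α.obj_eq b) (α.obj_eq c) _ _ _ _ _).2
    (α.app_comp f g)

lemma arr_injective {α β : Icon F G} (h : α.arr = β.arr) : α = β :=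
  ext' fun f => by
    have := congrArg (fun k => k.app (.of f)) h
    injection this

/-- The icon corresponding to a natural transformation between arrow categories that is compatible
with the unit and composition constraints. -/
def ofArr (m : Arr.map F ⟶ Arr.map G) (obj_eq : ∀ a, F.obj a = G.obj a)
    (id : ∀ a : B, m.app (.of (𝟙 a)) ≫ Arr.ofCell (G.mapId a).hom =
      Arr.ofCell (F.mapId a).hom ≫ eqToHom (congrArg (fun x => Arr.of (𝟙 x)) (obj_eq a)))
    (comp : ∀ {a b c : B} (f : a ⟶ b) (g : b ⟶ c),
      m.app (.of (f ≫ g)) ≫ Arr.ofCell (G.mapComp f g).hom =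
        Arr.ofCell (F.mapComp f g).hom ≫ Arr.hcomp (m.app (.of f)) (m.app (.of g))) :
    Icon F G where
  obj_eq := obj_eq
  app f := (m.app (.of f)).cell
  naturality {a b _ _} η :=
    (Arr.ofCell_comp_eq_comp_ofCell_iff (obj_eq a) (obj_eq b) _ _ _ _).1 <| by
      rw [← Arr.map_map_ofCell, ← Arr.map_map_ofCell]
      exact m.naturality (Arr.ofCell η)
  app_id a := (Arr.comp_ofCell_eq_ofCell_id_iff (obj_eq a) _ _ _).1 (id a)
  app_comp {a b c} f g :=
    (Arr.comp_ofCell_eq_ofCell_hcomp_iff (obj_eq a) (obj_eq b) (obj_eq c) _ _ _ _ _).1 (comp f g)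

lemma eq_of_isEqToHom_arr (α : Icon F G) (h : ∀ p, IsEqToHom (α.arr.app p)) : F = G := by
  obtain ⟨⟨⟨⟨Fo, Fm⟩, F₂⟩, Fi, Fc⟩, FI, FC, _, _, _, _, _⟩ := F
  obtain ⟨⟨⟨⟨Go, Gm⟩, G₂⟩, Gi, Gc⟩, GI, GC, _, _, _, _, _⟩ := G
  obtain rfl : Fo = Go := funext α.obj_eq
  obtain rfl : @Fm = @Gm := by
    funext a b f
    obtain ⟨e, -⟩ := h (.of f)
    injection e with _ _ e
  have app_eq_id {a b : B} (f : a ⟶ b) : α.app f = 𝟙 _ :=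
    Arr.ofCell_injective (h (.of f)).2
  obtain rfl : @F₂ = @G₂ := by
    funext a b f g η
    have := α.naturality η
    rw [app_eq_id, app_eq_id] at this
    exact (Category.comp_id _).symm.trans (this.trans (Category.id_comp _))
  obtain rfl : FI = GI := by
    funext a
    have := α.app_id a
    rw [app_eq_id] at this
    exact Iso.ext (this.symm.trans ((Category.id_comp _).trans (Category.comp_id _)))
  obtain rfl : @FC = @GC := by
    funext a b c f g
    have := α.app_comp f g
    rw [app_eq_id, app_eq_id, app_eq_id, id_whiskerRight] at this
    refine Iso.ext ((Category.comp_id _).symm.trans (Eq.trans ?_ this.symm) |>.trans ?_)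
    · refine congrArg (_ ≫ ·) ((Category.id_comp _).trans (whiskerLeft_id _ _)).symm
    · exact (Category.id_comp _).trans (Category.comp_id _)
  rfl

end Icon

end ArrowCategory

section Presentations

variable {B : Type u₁} [Bicategory.{w₁, v₁} B] {C : Type u₂} [Bicategory.{w₂, v₂} C]
  {D : Type u₃} [Bicategory.{w₃, v₃} D]

variable (C) in
/-- A family of formal generators for the 1-cells of a bicategory. -/
structure Generators where
  Gen : C → C → Type v₁
  ev {x y : C} : Gen x y → (x ⟶ y)

/-- Transport of a pseudofunctor along isomorphisms with new values on 1-cells. -/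
def transport (H : B ⥤ᵖ C) (m : ∀ {a b : B}, (a ⟶ b) → (H.obj a ⟶ H.obj b))
    (ω : ∀ {a b : B} (f : a ⟶ b), H.map f ≅ m f) : B ⥤ᵖ C where
  obj := H.obj
  map := m
  map₂ {a b f g} η := (ω f).inv ≫ H.map₂ η ≫ (ω g).hom
  mapId a := (ω (𝟙 a)).symm ≪≫ H.mapId a
  mapComp f g := (ω (f ≫ g)).symm ≪≫ H.mapComp f g ≪≫ whiskerRightIso (ω f) (H.map g) ≪≫
    whiskerLeftIso (m f) (ω g)
  map₂_whisker_left f g h η := by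
    simp [← whisker_exchange_assoc]
  map₂_whisker_right {_ _ _ f g} η h := by
    simp [whisker_exchange_assoc]
  map₂_associator f g h := by
    simp only [Iso.trans_hom, Iso.symm_hom, Iso.trans_inv, Iso.symm_inv,
      whiskerRightIso_hom, whiskerRightIso_inv, whiskerLeftIso_hom, whiskerLeftIso_inv,
      Pseudofunctor.map₂_associator, Category.assoc, comp_whiskerRight, whiskerLeft_comp]
    rw [whisker_exchange_assoc]
    simp only [hom_inv_whiskerRight_assoc, whiskerLeft_hom_inv_assoc]
    rw [whisker_exchange_assoc, associator_naturality_middle_assoc,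
      associator_naturality_left_assoc, ← whiskerLeft_comp_assoc, ← whiskerLeft_comp_assoc,
      ← whisker_exchange (ω g).hom, Category.assoc, hom_inv_whiskerRight, Category.comp_id,
      ← whisker_exchange_assoc (ω f).hom, ← associator_naturality_right_assoc,
      whiskerLeft_hom_inv_assoc, ← whisker_exchange_assoc (ω f).hom, hom_inv_whiskerRight_assoc]
  map₂_left_unitor f := by
    simp [whisker_exchange_assoc]
  map₂_right_unitor f := by
    simp [← whisker_exchange_assoc]

namespace Generators

variable (P : Generators.{w₂, v₄, v₂} C)

/-- Composable strings of generators. -/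
inductive Word (x : C) : C → Type (max u₂ v₄)
  | nil : Word x x
  | cons {y z : C} (p : Word x y) (e : P.Gen y z) : Word x z

namespace Word

variable {P}

/-- The string consisting of one generator. -/
def single {x y : C} (e : P.Gen x y) : P.Word x y := nil.cons e

/-- Concatenation. -/
def comp {x y z : C} (p : P.Word x y) : P.Word y z → P.Word x z
  | nil => p
  | cons q e => (p.comp q).cons e

lemma comp_nil {x y : C} (p : P.Word x y) : p.comp nil = p := rfl

lemma nil_comp {x y : C} (p : P.Word x y) : nil.comp p = p := by
  induction p with
  | nil => rfl
  | cons p e ih => exact congrArg (fun q => cons q e) ih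

lemma comp_assoc {x y z w : C} (p : P.Word x y) (q : P.Word y z) (r : P.Word z w) :
    (p.comp q).comp r = p.comp (q.comp r) := by
  induction r with
  | nil => rfl
  | cons r e ih => exact congrArg (fun q => cons q e) ih

/-- The composite of a string of generators. -/
def eval {x y : C} : P.Word x y → (x ⟶ y)
  | nil => 𝟙 x
  | cons p e => p.eval ≫ P.ev e

lemma eval_comp [Strict C] {x y z : C} (p : P.Word x y) (q : P.Word y z) :
    (p.comp q).eval = p.eval ≫ q.eval := by
  induction q with
  | nil => exact (Strict.comp_id _).symm
  | cons q e ih => exact (congrArg (· ≫ P.ev e) ih).trans (Strict.assoc _ _ _)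

lemma eval_single [Strict C] {x y : C} (e : P.Gen x y) : (single e).eval = P.ev e :=
  Strict.id_comp _

end Word

/-- The 2-category with the objects of `C`, the strings of generators as 1-cells, and the 2-cells
of `C` between their composites as 2-cells. -/
@[ext]
structure Full (P : Generators.{w₂, v₄, v₂} C) where
  of ::
  base : C

namespace Full

variable {P}

instance : CategoryStruct P.Full where
  Hom x y := P.Word x.base y.base
  id _ := Word.nil
  comp p q := Word.comp p q

/-- The composite in `C` of a 1-cell of `P.Full`. -/
def ev {x y : P.Full} (p : x ⟶ y) : x.base ⟶ y.base := Word.eval p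

/-- The 2-cells of `P.Full`. -/
@[ext]
structure Cell {x y : P.Full} (p q : x ⟶ y) where
  val : ev p ⟶ ev q

instance homCategory (x y : P.Full) : Category (x ⟶ y) where
  Hom p q := Cell p q
  id p := ⟨𝟙 (ev p)⟩
  comp η θ := ⟨η.val ≫ θ.val⟩
  id_comp η := Cell.ext (Category.id_comp η.val)
  comp_id η := Cell.ext (Category.comp_id η.val)
  assoc η θ κ := Cell.ext (Category.assoc η.val θ.val κ.val)

@[ext]
lemma cell_ext {x y : P.Full} {p q : x ⟶ y} {η θ : p ⟶ q} (h : η.val = θ.val) : η = θ :=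
  Cell.ext h

@[simp]
lemma id_val {x y : P.Full} (p : x ⟶ y) : Cell.val (𝟙 p) = 𝟙 (ev p) := rfl

@[simp]
lemma comp_val {x y : P.Full} {p q r : x ⟶ y} (η : p ⟶ q) (θ : q ⟶ r) :
    Cell.val (η ≫ θ) = η.val ≫ θ.val := rfl

@[simp]
lemma eqToHom_val {x y : P.Full} {p q : x ⟶ y} (h : p = q) :
    Cell.val (eqToHom h) = eqToHom (congrArg ev h) := by
  subst h; rfl

/-- Invertible 2-cells of `C` are invertible in `P.Full`. -/
@[simps]
def isoMk {x y : P.Full} {p q : x ⟶ y} (e : ev p ≅ ev q) : p ≅ q where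
  hom := ⟨e.hom⟩
  inv := ⟨e.inv⟩

lemma ev_id (x : P.Full) : ev (𝟙 x) = 𝟙 x.base := rfl

lemma whiskerLeft_congr {x y z : C} {f f' : x ⟶ y} (h : f = f') {g g' : y ⟶ z} (η : g ⟶ g') :
    f ◁ η = eqToHom (h ▸ rfl) ≫ f' ◁ η ≫ eqToHom (h ▸ rfl) := by
  subst h; simp

lemma whiskerRight_congr {x y z : C} {f f' : x ⟶ y} (η : f ⟶ f') {g g' : y ⟶ z} (h : g = g') :
    η ▷ g = eqToHom (h ▸ rfl) ≫ η ▷ g' ≫ eqToHom (h ▸ rfl) := by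
  subst h; simp

variable [Strict C]

lemma ev_comp {x y z : P.Full} (p : x ⟶ y) (q : y ⟶ z) :
    ev (p ≫ q) = ev p ≫ ev q := Word.eval_comp p q

instance bicategory : Bicategory P.Full where
  homCategory := homCategory
  whiskerLeft {x y z} p q q' η := ⟨eqToHom (ev_comp p q) ≫
    ev p ◁ η.val ≫ eqToHom (ev_comp p q').symm⟩
  whiskerRight {x y z p p'} η q := ⟨eqToHom (ev_comp p q) ≫
    η.val ▷ ev q ≫ eqToHom (ev_comp p' q).symm⟩
  associator p q r := eqToIso (Word.comp_assoc p q r)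
  leftUnitor p := eqToIso (Word.nil_comp p)
  rightUnitor p := eqToIso (Word.comp_nil p)
  whiskerLeft_id p q := by ext; simp
  whiskerLeft_comp p _ _ _ η θ := by ext; simp
  id_whiskerLeft {x y p q} η := by
    ext
    simp only [comp_val, eqToIso.hom, eqToIso.inv, eqToHom_val]
    rw [whiskerLeft_congr (ev_id x), Bicategory.id_whiskerLeft]
    simp [Strict.leftUnitor_eqToIso]
  comp_whiskerLeft p q _ _ η := by
    ext
    simp only [comp_val, eqToIso.hom, eqToIso.inv, eqToHom_val]
    rw [whiskerLeft_congr (ev_comp p q), Bicategory.comp_whiskerLeft]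
    simp [Strict.associator_eqToIso]
  id_whiskerRight p q := by ext; simp
  comp_whiskerRight η θ p := by ext; simp
  whiskerRight_id {x y p q} η := by
    ext
    simp only [comp_val, eqToIso.hom, eqToIso.inv, eqToHom_val]
    rw [whiskerRight_congr _ (ev_id y), Bicategory.whiskerRight_id]
    simp [Strict.rightUnitor_eqToIso]
  whiskerRight_comp η p q := by
    ext
    simp only [comp_val, eqToIso.hom, eqToIso.inv, eqToHom_val]
    rw [whiskerRight_congr _ (ev_comp p q), Bicategory.whiskerRight_comp]
    simp [Strict.associator_eqToIso]
  whisker_assoc p _ _ η q := by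
    ext
    simp [Strict.associator_eqToIso]
  whisker_exchange {x y z p q r s} η θ := by
    ext
    have := Bicategory.whisker_exchange η.val θ.val
    simp [reassoc_of% this]
  pentagon p q r s := by ext; simp
  triangle p q := by ext; simp

lemma whiskerLeft_val {x y z : P.Full} (p : x ⟶ y) {q q' : y ⟶ z} (η : q ⟶ q') :
    Cell.val (p ◁ η) = eqToHom (ev_comp p q) ≫ ev p ◁ η.val ≫ eqToHom (ev_comp p q').symm := rfl

lemma whiskerRight_val {x y z : P.Full} {p p' : x ⟶ y} (η : p ⟶ p') (q : y ⟶ z) :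
    Cell.val (η ▷ q) = eqToHom (ev_comp p q) ≫ η.val ▷ ev q ≫ eqToHom (ev_comp p' q).symm := rfl

instance : Strict P.Full where
  id_comp p := Word.nil_comp p
  comp_id p := Word.comp_nil p
  assoc p q r := Word.comp_assoc p q r
  leftUnitor_eqToIso _ := rfl
  rightUnitor_eqToIso _ := rfl
  associator_eqToIso _ _ _ := rfl

variable (P) in
/-- The 2-functor sending a string of generators to its composite. -/
def proj : P.Full ⥤ᵖ C where
  obj x := x.base
  map p := ev p
  map₂ η := η.val
  map₂_id _ := rfl
  map₂_comp _ _ := rfl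
  mapId x := eqToIso (ev_id x)
  mapComp p q := eqToIso (ev_comp p q)
  map₂_whisker_left p _ _ η := by simp [whiskerLeft_val]
  map₂_whisker_right η p := by simp [whiskerRight_val]
  map₂_associator p q r := by
    simp [Strict.associator_eqToIso]
  map₂_left_unitor p := by
    simp [Strict.leftUnitor_eqToIso]
  map₂_right_unitor p := by
    simp [Strict.rightUnitor_eqToIso]

lemma proj_isTwoFunctor : IsTwoFunctor (proj P) :=
  ⟨fun _ => ⟨_, rfl⟩, fun _ _ _ _ _ => ⟨_, rfl⟩⟩

lemma ev_homCast {x x' y y' : P.Full} (h : x = x') (h' : y = y') (p : x' ⟶ y') :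
    ev ((homCast h h').obj p) =
      (homCast (congrArg base h) (congrArg base h')).obj (ev p) := by
  subst h h'; rfl

/-- `proj P` is bijective on 2-cells between 1-cells with propositionally equal ends. -/
def fullyFaithfulProj : (Arr.map (proj P)).FullyFaithful where
  preimage {_ q} m :=
    ⟨Full.ext m.src_eq, Full.ext m.tgt_eq, ⟨m.cell ≫ eqToHom (ev_homCast _ _ q.hom).symm⟩⟩
  map_preimage {p q} m := by
    obtain @⟨⟨x⟩, ⟨y⟩, p⟩ := p
    obtain @⟨⟨x'⟩, ⟨y'⟩, q⟩ := q
    obtain ⟨h, h', m⟩ := m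
    obtain rfl : x = x' := h
    obtain rfl : y = y' := h'
    change (Arr.map (proj P)).map (Arr.ofCell ⟨m ≫ 𝟙 _⟩) = Arr.ofCell m
    rw [Arr.map_map_ofCell]
    exact congrArg Arr.ofCell (Category.comp_id _)
  preimage_map {p q} m := by
    obtain ⟨p⟩ := p
    induction m using Arr.hom_induction
    rw [Arr.map_map_ofCell]
    exact congrArg Arr.ofCell (Cell.ext (Category.comp_id _))

/-- Icons between pseudofunctors into `P.Full` are icons between the composites with `proj P`. -/
def iconLift {F G : B ⥤ᵖ P.Full} (α : Icon (F.comp (proj P)) (G.comp (proj P))) : Icon F G :=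
  let m (p : Arr B) : (Arr.map (proj P)).obj ((Arr.map F).obj p) ⟶
    (Arr.map (proj P)).obj ((Arr.map G).obj p) := α.arr.app p
  Icon.ofArr
    { app p := fullyFaithfulProj.preimage (m p)
      naturality {p q} n := fullyFaithfulProj.map_injective <| by
        rw [Functor.map_comp, Functor.map_comp, fullyFaithfulProj.map_preimage,
          fullyFaithfulProj.map_preimage, ← Arr.map_comp_map, ← Arr.map_comp_map]
        exact α.arr.naturality n }
    (fun a => Full.ext (α.obj_eq a))
    (fun a => fullyFaithfulProj.map_injective <| by
      have mapId_comp_proj (F : B ⥤ᵖ P.Full) :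
          ((F.comp (proj P)).mapId a).hom = (F.mapId a).hom.val := Category.comp_id _
      have h := α.arr_app_id a
      rw [mapId_comp_proj, mapId_comp_proj] at h
      rw [Functor.map_comp, Functor.map_comp, fullyFaithfulProj.map_preimage,
        Arr.map_map_ofCell, Arr.map_map_ofCell, eqToHom_map]
      exact h)
    (fun {a b c} f g => fullyFaithfulProj.map_injective <| by
      have h := α.arr_app_comp f g
      change m (.of (f ≫ g)) ≫ Arr.ofCell ((proj P).map₂ (G.mapComp f g).hom ≫
        ((proj P).mapComp (G.map f) (G.map g)).hom) = _ at h
      rw [← cancel_mono (Arr.ofIso ((proj P).mapComp (G.map f) (G.map g))).hom, Arr.ofIso_hom,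
        Functor.map_comp, Functor.map_comp, Category.assoc, Category.assoc, Arr.map_map_hcomp,
        fullyFaithfulProj.map_preimage, fullyFaithfulProj.map_preimage,
        fullyFaithfulProj.map_preimage, Arr.map_map_ofCell, Arr.map_map_ofCell, ← Arr.ofCell_comp,
        ← Category.assoc, ← Arr.ofCell_comp]
      exact h)

lemma map_proj_arr_iconLift {F G : B ⥤ᵖ P.Full}
    (α : Icon (F.comp (proj P)) (G.comp (proj P))) (p : Arr B) :
    (Arr.map (proj P)).map ((iconLift α).arr.app p) = α.arr.app p :=
  fullyFaithfulProj.map_preimage _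

section Lift

variable (H : B ⥤ᵖ C) (w : ∀ {a b : B}, (a ⟶ b) → ((⟨H.obj a⟩ : P.Full) ⟶ ⟨H.obj b⟩))
  (ω : ∀ {a b : B} (f : a ⟶ b), H.map f ≅ ev (w f))

/-- The lift of a pseudofunctor along `proj P` for a choice of strings of generators whose
composites are isomorphic to its values. -/
def lift : B ⥤ᵖ P.Full where
  obj a := ⟨H.obj a⟩
  map f := w f
  map₂ {_ _ f g} η := ⟨(ω f).inv ≫ H.map₂ η ≫ (ω g).hom⟩
  mapId a := isoMk ((ω (𝟙 a)).symm ≪≫ H.mapId a ≪≫ eqToIso (ev_id ⟨H.obj a⟩).symm)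
  mapComp f g := isoMk ((ω (f ≫ g)).symm ≪≫ H.mapComp f g ≪≫ whiskerRightIso (ω f) (H.map g) ≪≫
    whiskerLeftIso (ev (w f)) (ω g) ≪≫ eqToIso (ev_comp (w f) (w g)).symm)
  map₂_id f := by ext; simp
  map₂_comp η θ := by ext; simp
  map₂_whisker_left f g h η := by
    ext
    simp [whiskerLeft_val, ← whisker_exchange_assoc]
  map₂_whisker_right {_ _ _ f g} η h := by
    ext
    simp [whiskerRight_val, whisker_exchange_assoc]
  map₂_associator f g h := by
    ext
    refine ((transport H (fun f => ev (w f)) ω).map₂_associator f g h).trans ?_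
    dsimp +instances only [transport]
    simp [whiskerRight_val, whiskerLeft_val, Strict.associator_eqToIso]
  map₂_left_unitor f := by
    ext
    refine ((transport H (fun f => ev (w f)) ω).map₂_left_unitor f).trans ?_
    dsimp +instances only [transport]
    simp [whiskerRight_val, Strict.leftUnitor_eqToIso]
  map₂_right_unitor f := by
    ext
    refine ((transport H (fun f => ev (w f)) ω).map₂_right_unitor f).trans ?_
    dsimp +instances only [transport]
    simp [whiskerLeft_val, Strict.rightUnitor_eqToIso]

/-- The lift of `H` is a lift up to an invertible icon. -/
def liftIcon : Icon ((lift H w ω).comp (proj P)) H where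
  obj_eq _ := rfl
  app f := (ω f).inv
  naturality η := by
    change ((ω _).inv ≫ H.map₂ η ≫ (ω _).hom) ≫ (ω _).inv = (ω _).inv ≫ H.map₂ η
    simp
  app_id a := by
    change (ω (𝟙 a)).inv ≫ (H.mapId a).hom ≫ 𝟙 _ =
      ((ω (𝟙 a)).inv ≫ (H.mapId a).hom ≫ 𝟙 _) ≫ 𝟙 _
    simp
  app_comp f g := by
    change (ω (f ≫ g)).inv ≫ (H.mapComp f g).hom ≫ 𝟙 _ =
      (((ω (f ≫ g)).inv ≫ (H.mapComp f g).hom ≫ (ω f).hom ▷ H.map g ≫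
        ev (w f) ◁ (ω g).hom ≫ eqToHom (ev_comp (w f) (w g)).symm) ≫
          eqToHom (ev_comp (w f) (w g))) ≫
        (ω f).inv ▷ ev (w g) ≫ H.map f ◁ (ω g).inv
    simp [whisker_exchange_assoc]

/-- The inverse of `liftIcon`. -/
def liftIconInv : Icon H ((lift H w ω).comp (proj P)) where
  obj_eq _ := rfl
  app f := (ω f).hom
  naturality η := by
    change H.map₂ η ≫ (ω _).hom = (ω _).hom ≫ (ω _).inv ≫ H.map₂ η ≫ (ω _).hom
    simp
  app_id a := by
    change (ω (𝟙 a)).hom ≫ (((ω (𝟙 a)).inv ≫ (H.mapId a).hom ≫ 𝟙 _) ≫ 𝟙 _) ≫ 𝟙 _ =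
      (H.mapId a).hom
    simp
  app_comp f g := by
    change (ω (f ≫ g)).hom ≫
      (((ω (f ≫ g)).inv ≫ (H.mapComp f g).hom ≫ (ω f).hom ▷ H.map g ≫
        ev (w f) ◁ (ω g).hom ≫ eqToHom (ev_comp (w f) (w g)).symm) ≫
          eqToHom (ev_comp (w f) (w g))) ≫ 𝟙 _ = (H.mapComp f g).hom ≫
        (ω f).hom ▷ H.map g ≫ ev (w f) ◁ (ω g).hom
    simp

end Lift

end Full

end Generators

end Presentations

section TwoFunctors

variable {B : Type u₁} [Bicategory.{w₁, v₁} B] {C : Type u₂} [Bicategory.{w₂, v₂} C]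
  {D : Type u₃} [Bicategory.{w₃, v₃} D]

lemma IsTwoFunctor.isEqToHom_mapId {F : B ⥤ᵖ C} (h : IsTwoFunctor F) (a : B) :
    IsEqToHom (F.mapId a).hom := by
  obtain ⟨e, h⟩ := h.1 a
  exact ⟨e, by rw [h]; rfl⟩

lemma IsTwoFunctor.isEqToHom_mapComp {F : B ⥤ᵖ C} (h : IsTwoFunctor F) {a b c : B} (f : a ⟶ b)
    (g : b ⟶ c) : IsEqToHom (F.mapComp f g).hom := by
  obtain ⟨e, h⟩ := h.2 f g
  exact ⟨e, by rw [h]; rfl⟩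

lemma IsTwoFunctor.comp {F : B ⥤ᵖ C} {G : C ⥤ᵖ D} (hF : IsTwoFunctor F) (hG : IsTwoFunctor G) :
    IsTwoFunctor (F.comp G) := by
  refine ⟨fun a => ?_, fun a b c f g => ?_⟩
  · obtain ⟨h, e⟩ := hF.1 a
    obtain ⟨h', e'⟩ := hG.1 (F.obj a)
    refine ⟨(congrArg G.map h).trans h', ?_⟩
    change G.map₂Iso (F.mapId a) ≪≫ G.mapId (F.obj a) = _
    rw [e, e', PrelaxFunctor.map₂Iso_eqToIso]
    exact eqToIso_trans _ _
  · obtain ⟨h, e⟩ := hF.2 f g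
    obtain ⟨h', e'⟩ := hG.2 (F.map f) (F.map g)
    refine ⟨(congrArg G.map h).trans h', ?_⟩
    change G.map₂Iso (F.mapComp f g) ≪≫ G.mapComp (F.map f) (F.map g) = _
    rw [e, e', PrelaxFunctor.map₂Iso_eqToIso]
    exact eqToIso_trans _ _

namespace Generators

variable {P : Generators.{w₂, v₄, v₂} C}

/-- A generator, as a 1-cell of `P.Full`. -/
def Full.gen {x y : C} (e : P.Gen x y) : (⟨x⟩ : P.Full) ⟶ ⟨y⟩ := Word.single e

variable [Strict C]

lemma Full.isEqToHom_arr {F G : P.Full ⥤ᵖ D} (hF : IsTwoFunctor F) (hG : IsTwoFunctor G)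
    (α : Icon F G) (h : ∀ {x y : C} (e : P.Gen x y), IsEqToHom (α.arr.app (.of (gen e))))
    (p : Arr P.Full) : IsEqToHom (α.arr.app p) := by
  obtain @⟨⟨x⟩, ⟨y⟩, p⟩ := p
  change P.Word x y at p
  induction p with
  | nil =>
    refine IsEqToHom.of_comp ?_ (Arr.isEqToHom_ofCell (hG.isEqToHom_mapId ⟨x⟩))
    exact (α.arr_app_id ⟨x⟩) ▸ (Arr.isEqToHom_ofCell (hF.isEqToHom_mapId ⟨x⟩)).comp (.eqToHom _)
  | @cons y z p e ih =>
    let p' : (⟨x⟩ : P.Full) ⟶ ⟨y⟩ := p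
    refine IsEqToHom.of_comp ?_ (Arr.isEqToHom_ofCell (hG.isEqToHom_mapComp p' (gen e)))
    exact (α.arr_app_comp p' (gen e)) ▸
      (Arr.isEqToHom_ofCell (hF.isEqToHom_mapComp p' (gen e))).comp (Arr.isEqToHom_hcomp ih (h e))

end Generators

end TwoFunctors

section WordMap

variable {C : Type u₂} [Bicategory.{w₂, v₂} C] {D : Type u₃} [Bicategory.{w₃, v₃} D]

namespace Generators

variable {P : Generators.{w₂, v₄, v₂} C} {P' : Generators.{w₃, v₄, v₃} D} (H : C ⥤ᵖ D)
  (φ : ∀ {x y : C}, P.Gen x y → P'.Gen (H.obj x) (H.obj y))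

/-- The effect on strings of a map of generators. -/
def Word.map {x y : C} : P.Word x y → P'.Word (H.obj x) (H.obj y)
  | nil => nil
  | cons p e => (p.map).cons (φ e)

lemma Word.map_comp {x y z : C} (p : P.Word x y) (q : P.Word y z) :
    (p.comp q).map H φ = (p.map H φ).comp (q.map H φ) := by
  induction q with
  | nil => rfl
  | cons q e ih => exact congrArg (fun q => cons q (φ e)) ih

variable (κ : ∀ {x y : C} (e : P.Gen x y), H.map (P.ev e) ≅ P'.ev (φ e))

/-- The comparison between the composites of a string of generators and of its image. -/
def Word.mapEval {x y : C} : ∀ p : P.Word x y, H.map p.eval ≅ (p.map H φ).eval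
  | nil => H.mapId x
  | cons p e => H.mapComp p.eval (P.ev e) ≪≫ whiskerRightIso p.mapEval (H.map (P.ev e)) ≪≫
      whiskerLeftIso (p.map H φ).eval (κ e)

lemma mapComp_hom_comp_of_eq_comp [Strict C] [Strict D] {x y z t : C}
    {p : x ⟶ y} {q : y ⟶ z} {e : z ⟶ t}
    {k : x ⟶ z} (h : k = p ≫ q) {p' : H.obj x ⟶ H.obj y} {q' : H.obj y ⟶ H.obj z}
    {e' : H.obj z ⟶ H.obj t} {k' : H.obj x ⟶ H.obj z} (h' : p' ≫ q' = k') (a : H.map p ⟶ p')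
    (b : H.map q ⟶ q') (c : H.map e ⟶ e') {m : H.map k ⟶ k'}
    (hm : m = H.map₂ (eqToHom h) ≫ (H.mapComp p q).hom ≫ a ▷ H.map q ≫ p' ◁ b ≫ eqToHom h') :
    (H.mapComp k e).hom ≫ m ▷ H.map e ≫ k' ◁ c =
      H.map₂ (eqToHom ((congrArg (· ≫ e) h).trans (Strict.assoc p q e))) ≫
        (H.mapComp p (q ≫ e)).hom ≫ a ▷ H.map (q ≫ e) ≫
        p' ◁ ((H.mapComp q e).hom ≫ b ▷ H.map e ≫ q' ◁ c) ≫
        eqToHom ((Strict.assoc p' q' e').symm.trans (congrArg (· ≫ e') h')) := by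
  subst h h' hm
  have h₁ : eqToHom ((congrArg (· ≫ e) rfl).trans (Strict.assoc p q e)) = (α_ p q e).hom := by
    rw [Strict.associator_eqToIso]; rfl
  have h₂ : eqToHom ((Strict.assoc p' q' e').symm.trans (congrArg (· ≫ e') rfl)) =
      (α_ p' q' e').inv := by
    rw [Strict.associator_eqToIso]; rfl
  rw [h₁, h₂, H.map₂_associator]
  simp only [eqToHom_refl, PrelaxFunctor.map₂_id, Category.id_comp, Category.comp_id,
    Category.assoc, comp_whiskerRight, whiskerLeft_comp, Iso.inv_hom_id_assoc]
  rw [← whisker_exchange_assoc a, whiskerLeft_inv_hom_assoc]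
  simp

lemma Word.mapEval_comp [Strict C] [Strict D] {x y z : C} (p : P.Word x y) (q : P.Word y z) :
    (Word.mapEval H φ κ (p.comp q)).hom = H.map₂ (eqToHom (eval_comp p q)) ≫
      (H.mapComp p.eval q.eval).hom ≫ (Word.mapEval H φ κ p).hom ▷ H.map q.eval ≫
      (p.map H φ).eval ◁ (Word.mapEval H φ κ q).hom ≫
      eqToHom ((eval_comp _ _).symm.trans (congrArg eval (Word.map_comp H φ p q).symm)) := by
  induction q with
  | nil =>
    have h₁ : eqToHom (eval_comp p nil) = (ρ_ p.eval).inv := by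
      rw [Strict.rightUnitor_eqToIso]; rfl
    have h₂ : eqToHom ((eval_comp _ _).symm.trans (congrArg eval (Word.map_comp H φ p nil).symm)) =
        (ρ_ (p.map H φ).eval).hom := by
      rw [Strict.rightUnitor_eqToIso]; rfl
    rw [h₁, h₂]
    change (Word.mapEval H φ κ p).hom = H.map₂ (ρ_ p.eval).inv ≫ (H.mapComp p.eval (𝟙 y)).hom ≫
      (Word.mapEval H φ κ p).hom ▷ H.map (𝟙 y) ≫ (p.map H φ).eval ◁ (H.mapId y).hom ≫ (ρ_ _).hom
    rw [← whisker_exchange_assoc, rightUnitor_naturality, ← H.map₂_right_unitor_assoc,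
      PrelaxFunctor.map₂_inv_hom_assoc]
  | cons q e ih =>
    change (H.mapComp (p.comp q).eval (P.ev e)).hom ≫
      (Word.mapEval H φ κ (p.comp q)).hom ▷ H.map (P.ev e) ≫
      ((p.comp q).map H φ).eval ◁ (κ e).hom = H.map₂ (eqToHom (eval_comp p (q.cons e))) ≫
      (H.mapComp p.eval (q.eval ≫ P.ev e)).hom ≫
      (Word.mapEval H φ κ p).hom ▷ H.map (q.eval ≫ P.ev e) ≫ (p.map H φ).eval ◁ (
        (H.mapComp q.eval (P.ev e)).hom ≫ (Word.mapEval H φ κ q).hom ▷ H.map (P.ev e) ≫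
      (q.map H φ).eval ◁ (κ e).hom) ≫ eqToHom _
    exact mapComp_hom_comp_of_eq_comp H _ _ _ _ _ ih

lemma Word.mapEval_single [Strict C] [Strict D] {x y : C} (e : P.Gen x y) :
    EqUpTo (Word.mapEval H φ κ (single e)).hom (κ e).hom := by
  refine ⟨congrArg H.map (eval_single e), eval_single (φ e), ?_⟩
  change (H.mapComp (𝟙 x) (P.ev e)).hom ≫ (H.mapId x).hom ▷ H.map (P.ev e) ≫ 𝟙 _ ◁ (κ e).hom = _
  rw [H.mapComp_id_left_hom, Strict.leftUnitor_eqToIso, eqToIso.hom, PrelaxFunctor.map₂_eqToHom]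
  simp [Strict.leftUnitor_eqToIso]
  rfl

variable [Strict C] [Strict D]

/-- The 2-functor induced by a map of generators which is compatible with a pseudofunctor up to
isomorphism. -/
def fullMap : P.Full ⥤ᵖ P'.Full :=
  Full.lift ((Full.proj P).comp H) (fun p => Word.map H φ p) (fun p => Word.mapEval H φ κ p)

lemma fullMap_isTwoFunctor : IsTwoFunctor (fullMap H φ κ) := by
  refine ⟨fun x => ⟨rfl, ?_⟩, fun x y z p q => ⟨Word.map_comp H φ p q, ?_⟩⟩
  · ext
    change (H.mapId x.base).inv ≫ (H.map₂ (𝟙 _) ≫ (H.mapId x.base).hom) ≫ 𝟙 _ = 𝟙 _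
    simp
  · ext
    refine Eq.trans ?_ (Full.eqToHom_val (Word.map_comp H φ p q)).symm
    change (Word.mapEval H φ κ (p.comp q)).inv ≫ (H.map₂ (eqToHom (Word.eval_comp p q)) ≫
      (H.mapComp p.eval q.eval).hom) ≫ (Word.mapEval H φ κ p).hom ▷ H.map q.eval ≫
      (p.map H φ).eval ◁ (Word.mapEval H φ κ q).hom ≫ eqToHom (Word.eval_comp _ _).symm =
        eqToHom (congrArg Word.eval (Word.map_comp H φ p q))
    have h := Word.mapEval_comp H φ κ p q
    rw [← cancel_mono (eqToHom (congrArg Word.eval (Word.map_comp H φ p q).symm)),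
      ← cancel_epi (Word.mapEval H φ κ (p.comp q)).hom]
    simp only [Category.assoc, eqToHom_trans, Iso.hom_inv_id_assoc, eqToHom_refl,
      Category.comp_id]
    exact h.symm

/-- The comparison of `fullMap` with the given pseudofunctor. -/
def fullMapIcon : Icon ((fullMap H φ κ).comp (Full.proj P')) ((Full.proj P).comp H) :=
  Full.liftIcon _ _ _

/-- The inverse of `fullMapIcon`. -/
def fullMapIconInv : Icon ((Full.proj P).comp H) ((fullMap H φ κ).comp (Full.proj P')) :=
  Full.liftIconInv _ _ _

lemma fullMapIconInv_arr_gen {x y : C} (e : P.Gen x y) :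
    EqUpTo ((fullMapIconInv H φ κ).arr.app (.of (Full.gen e))) (Arr.ofCell (κ e).hom) :=
  Arr.eqUpTo_ofCell (Word.mapEval_single H φ κ e)

end Generators

end WordMap

namespace TwoCatPI

variable {X Y Z W : TwoCatPI.{u}}

/-- The functor between arrow categories induced by a 1-cell of `2Cat_{p,i}`. -/
abbrev act (F : X ⟶ Y) : Arr X.carrier ⥤ Arr Y.carrier := Arr.map F.fn

/-- The natural transformation between arrow categories induced by a 2-cell of `2Cat_{p,i}`. -/
def arr {F G : X ⟶ Y} (α : F ⟶ G) : act F ⟶ act G := α.icon.arr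

lemma hom₂_ext_arr {F G : X ⟶ Y} {α β : F ⟶ G}
    (h : ∀ v : Arr X.carrier, (arr α).app v = (arr β).app v) : α = β :=
  Hom₂.ext' α β fun f => by
    rw [Icon.arr_injective (α := α.icon) (β := β.icon) (NatTrans.ext (funext h))]

@[simp]
lemma arr_id (F : X ⟶ Y) : arr (𝟙 F) = 𝟙 (act F) := rfl

@[simp]
lemma arr_comp {F G H : X ⟶ Y} (α : F ⟶ G) (β : G ⟶ H) : arr (α ≫ β) = arr α ≫ arr β := rfl

lemma arr_whiskerLeft_app (F : X ⟶ Y) {G H : Y ⟶ Z} (α : G ⟶ H) (v : Arr X.carrier) :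
    (arr (F ◁ α)).app v = (arr α).app ((act F).obj v) := rfl

lemma isEqToHom_arr {F G : X ⟶ Y} {α : F ⟶ G} (h : IsEqToHom α) (v : Arr X.carrier) :
    IsEqToHom ((arr α).app v) := by
  obtain ⟨rfl, rfl⟩ := h
  exact ⟨rfl, rfl⟩

lemma isEqToHom_of_arr {F G : X ⟶ Y} {α : F ⟶ G}
    (h : ∀ v : Arr X.carrier, IsEqToHom ((arr α).app v)) : IsEqToHom α := by
  obtain rfl : F = G := Hom.ext' (α.icon.eq_of_isEqToHom_arr h)
  exact ⟨rfl, hom₂_ext_arr fun v => (h v).eq (.id _)⟩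

lemma eqUpTo_of_arr {F G F' G' : X ⟶ Y} {α : F ⟶ G} {β : F' ⟶ G'} (hF : F = F') (hG : G = G')
    (h : ∀ v : Arr X.carrier, EqUpTo ((arr α).app v) ((arr β).app v)) : EqUpTo α β := by
  subst hF hG
  exact .of_eq (hom₂_ext_arr fun v => (h v).eq)

/-- The natural isomorphism between arrow categories induced by an invertible 2-cell of
`2Cat_{p,i}`. -/
def arrIso {F G : X ⟶ Y} (α : F ≅ G) : act F ≅ act G where
  hom := arr α.hom
  inv := arr α.inv
  hom_inv_id := by rw [← arr_comp, α.hom_inv_id, arr_id]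
  inv_hom_id := by rw [← arr_comp, α.inv_hom_id, arr_id]

/-- The natural isomorphism between arrow categories induced by an invertible 2-cell that fills a
square. -/
def squareArr {F : X ⟶ Y} {G : Y ⟶ W} {H : X ⟶ Z} {K : Z ⟶ W} (α : F ≫ G ≅ H ≫ K) :
    act F ⋙ act G ≅ act H ⋙ act K :=
  NatIso.ofComponents (fun v => (arrIso α).app v) fun m =>
    (congrArg (· ≫ _) (Arr.map_comp_map _ _ m).symm).trans
      (((arr α.hom).naturality m).trans (congrArg (_ ≫ ·) (Arr.map_comp_map _ _ m)))

/-- The natural isomorphism between arrow categories induced by an isomorphism of a composite with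
an identity. -/
def retractionArr {F : X ⟶ Y} {G : Y ⟶ X} (α : F ≫ G ≅ 𝟙 X) : act F ⋙ act G ≅ 𝟭 (Arr X.carrier) :=
  NatIso.ofComponents (fun v => (arrIso α).app v) fun m =>
    (congrArg (· ≫ _) (Arr.map_comp_map _ _ m).symm).trans
      (((arr α.hom).naturality m).trans (congrArg (_ ≫ ·) (Arr.map_id_map m)))

end TwoCatPI

lemma eq_conj_of_eqUpTo_cell {B : Type u₁} [Bicategory.{w₁, v₁} B] {C : Type u₂} {φ : C → B}
    {P : OneCellClass φ} {x y : LocallyFull P} {f g f' g' : x ⟶ y} (h : f = f') (h' : g = g')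
    {η : f ⟶ g} {θ : f' ⟶ g'} (e : EqUpTo η.cell θ.cell) :
    η = eqToHom h ≫ θ ≫ eqToHom h'.symm := by
  subst h h'
  exact LocallyFull.hom₂_ext (by simpa using e.eq)

open TwoCatPI

section Components

variable {A : Type u} [Bicategory.{u, u} A] (X : A ⥤ᵖ TwoCatPI.{u})

/-- The composition constraint of a pseudofunctor to `2Cat_{p,i}`, on arrow categories. -/
def compArr {a b c : A} (f : a ⟶ b) (g : b ⟶ c) :
    act (X.map (f ≫ g)) ≅ act (X.map f) ⋙ act (X.map g) :=
  NatIso.ofComponents (fun v => (arrIso (X.mapComp f g)).app v) fun m =>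
    ((arr (X.mapComp f g).hom).naturality m).trans (congrArg (_ ≫ ·) (Arr.map_comp_map _ _ m))

/-- The unit constraint of a pseudofunctor to `2Cat_{p,i}`, on arrow categories. -/
def idArr (a : A) : act (X.map (𝟙 a)) ≅ 𝟭 (Arr (X.obj a).carrier) :=
  NatIso.ofComponents (fun v => (arrIso (X.mapId a)).app v) fun m =>
    ((arr (X.mapId a).hom).naturality m).trans (congrArg (_ ≫ ·) (Arr.map_id_map m))

lemma compArr_assoc {a b c d : A} (f : a ⟶ b) (g : b ⟶ c) (h : c ⟶ d)
    (v : Arr (X.obj a).carrier) :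
    (compArr X (f ≫ g) h).hom.app v ≫ (act (X.map h)).map ((compArr X f g).hom.app v) =
      (arr (X.map₂ (α_ f g h).hom)).app v ≫ (compArr X f (g ≫ h)).hom.app v ≫
        (compArr X g h).hom.app ((act (X.map f)).obj v) :=
  (congrArg (fun α => (arr α).app v) (X.mapComp_assoc_left_hom f g h)).trans <|
    congrArg (fun k => (arr (X.map₂ (α_ f g h).hom)).app v ≫ (compArr X f (g ≫ h)).hom.app v ≫ k)
      (Category.comp_id ((compArr X g h).hom.app ((act (X.map f)).obj v)))

lemma compArr_id_right {a b : A} (f : a ⟶ b) (v : Arr (X.obj a).carrier) :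
    (compArr X f (𝟙 b)).hom.app v ≫ (idArr X b).hom.app ((act (X.map f)).obj v) =
      (arr (X.map₂ (ρ_ f).hom)).app v :=
  (congrArg (_ ≫ ·) (Category.comp_id _).symm).trans
    (congrArg (fun α => (arr α).app v) (X.map₂_right_unitor f)).symm

lemma compArr_whiskerLeft {a b c : A} (f : a ⟶ b) {g h : b ⟶ c} (η : g ⟶ h)
    (v : Arr (X.obj a).carrier) :
    (arr (X.map₂ (f ◁ η))).app v ≫ (compArr X f h).hom.app v =
      (compArr X f g).hom.app v ≫ (arr (X.map₂ η)).app ((act (X.map f)).obj v) :=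
  congrArg (fun α => (arr α).app v) (show X.map₂ (f ◁ η) ≫ (X.mapComp f h).hom =
    (X.mapComp f g).hom ≫ X.map f ◁ X.map₂ η by simp)

lemma compArr_whiskerRight {a b c : A} {f g : a ⟶ b} (η : f ⟶ g) (h : b ⟶ c)
    (v : Arr (X.obj a).carrier) :
    (arr (X.map₂ (η ▷ h))).app v ≫ (compArr X g h).hom.app v =
      (compArr X f h).hom.app v ≫ (act (X.map h)).map ((arr (X.map₂ η)).app v) :=
  congrArg (fun α => (arr α).app v) (show X.map₂ (η ▷ h) ≫ (X.mapComp g h).hom =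
    (X.mapComp f h).hom ≫ X.map₂ η ▷ X.map h by simp)

lemma isEqToHom_map₂ {a b : A} {f g : a ⟶ b} {η : f ⟶ g} (h : IsEqToHom η)
    (v : Arr (X.obj a).carrier) : IsEqToHom ((arr (X.map₂ η)).app v) := by
  obtain ⟨rfl, rfl⟩ := h
  exact isEqToHom_arr ⟨rfl, by simp⟩ v

end Components

open Generators

section Strictification

variable {A : Type u} [Bicategory.{u, u} A] (X : A ⥤ᵖ TwoCatPI.{u})

/-- The formal 1-cells `f(v)`, for `f : b ⟶ a` and a 1-cell `v` of `X b`. The ends are specified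
by equations, so that formal 1-cells can be pushed forward along 1-cells of `A`. -/
structure FormalCell (a : A) (x y : (X.obj a).carrier) : Type u where
  {b : A}
  f : b ⟶ a
  v : Arr (X.obj b).carrier
  src_eq : x = (X.map f).fn.obj v.src
  tgt_eq : y = (X.map f).fn.obj v.tgt

/-- The formal 1-cells, as generators for the 1-cells of `X a`. -/
def formalCells (a : A) : Generators.{u, u, u} (X.obj a).carrier where
  Gen := FormalCell X a
  ev e := (homCast e.src_eq e.tgt_eq).obj ((X.map e.f).fn.map e.v.hom)

lemma of_ev {a : A} {x y : (X.obj a).carrier} (e : (formalCells X a).Gen x y) :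
    Arr.of ((formalCells X a).ev e) = (act (X.map e.f)).obj e.v :=
  Arr.of_homCast _ _ _

/-- The action of the 1-cells of `A` on formal 1-cells. -/
def pushGen {a c : A} (g : a ⟶ c) {x y : (X.obj a).carrier} (e : (formalCells X a).Gen x y) :
    (formalCells X c).Gen ((X.map g).fn.obj x) ((X.map g).fn.obj y) where
  f := e.f ≫ g
  v := e.v
  src_eq := (congrArg (X.map g).fn.obj e.src_eq).trans
    ((X.mapComp e.f g).hom.icon.obj_eq e.v.src).symm
  tgt_eq := (congrArg (X.map g).fn.obj e.tgt_eq).trans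
    ((X.mapComp e.f g).hom.icon.obj_eq e.v.tgt).symm

/-- The comparison of the values of `g(f(v))` and `(fg)(v)`. -/
def pushGenIso {a c : A} (g : a ⟶ c) {x y : (X.obj a).carrier} (e : (formalCells X a).Gen x y) :
    (X.map g).fn.map ((formalCells X a).ev e) ≅ (formalCells X c).ev (pushGen X g e) :=
  Arr.toIso (eqToIso (congrArg (act (X.map g)).obj (of_ev X e)) ≪≫
    ((compArr X e.f g).app e.v).symm ≪≫ eqToIso (of_ev X (pushGen X g e)).symm)

/-- The values of the strictification on objects. -/
def strictObj (a : A) : TwoCatPI.{u} := ⟨(formalCells X a).Full⟩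

/-- The values of the strictification on 1-cells. -/
def strictMap {a c : A} (g : a ⟶ c) : strictObj X a ⟶ strictObj X c :=
  ⟨fullMap (X.map g).fn (pushGen X g) (pushGenIso X g)⟩

lemma strictMap_isTwoFunctor {a c : A} (g : a ⟶ c) : IsTwoFunctor (strictMap X g).fn :=
  fullMap_isTwoFunctor _ _ _

/-- The evaluation of words of formal 1-cells. -/
def evalHom (a : A) : strictObj X a ⟶ X.obj a := ⟨Full.proj (formalCells X a)⟩

/-- The pseudonaturality of the evaluation. -/
def evalIso {a c : A} (g : a ⟶ c) : strictMap X g ≫ evalHom X c ≅ evalHom X a ≫ X.map g where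
  hom := ⟨fullMapIcon (X.map g).fn (pushGen X g) (pushGenIso X g)⟩
  inv := ⟨fullMapIconInv (X.map g).fn (pushGen X g) (pushGenIso X g)⟩
  hom_inv_id := hom₂_ext_arr fun p =>
    (Arr.ofIso (Word.mapEval (X.map g).fn (pushGen X g) (pushGenIso X g) p.hom)).inv_hom_id
  inv_hom_id := hom₂_ext_arr fun p =>
    (Arr.ofIso (Word.mapEval (X.map g).fn (pushGen X g) (pushGenIso X g) p.hom)).hom_inv_id

/-- The pseudonaturality of the evaluation, on arrow categories. -/
def evalArr {a c : A} (g : a ⟶ c) :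
    act (strictMap X g) ⋙ act (evalHom X c) ≅ act (evalHom X a) ⋙ act (X.map g) :=
  squareArr (evalIso X g)

/-- A formal 1-cell, as a 1-cell of the strictification. -/
def gen {a b : A} (f : b ⟶ a) (v : Arr (X.obj b).carrier) : Arr (strictObj X a).carrier :=
  .of (Full.gen (P := formalCells X a) ⟨f, v, rfl, rfl⟩)

lemma of_gen {a : A} {x y : (X.obj a).carrier} (e : (formalCells X a).Gen x y) :
    (Arr.of (Full.gen e) : Arr (strictObj X a).carrier) = gen X e.f e.v := by
  obtain ⟨f, v, rfl, rfl⟩ := e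
  rfl

lemma evalHom_gen {a b : A} (f : b ⟶ a) (v : Arr (X.obj b).carrier) :
    (act (evalHom X a)).obj (gen X f v) = (act (X.map f)).obj v :=
  congrArg Arr.of (Word.eval_single (P := formalCells X a) ⟨f, v, rfl, rfl⟩)

lemma strictMap_gen {a b c : A} (f : b ⟶ a) (g : a ⟶ c) (v : Arr (X.obj b).carrier) :
    (act (strictMap X g)).obj (gen X f v) = gen X (f ≫ g) v :=
  of_gen X _

lemma evalArr_gen {a b c : A} (f : b ⟶ a) (g : a ⟶ c) (v : Arr (X.obj b).carrier) :
    EqUpTo ((evalArr X g).hom.app (gen X f v)) ((compArr X f g).hom.app v) := by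
  let e : (formalCells X a).Gen _ _ := ⟨f, v, rfl, rfl⟩
  have h := (fullMapIconInv_arr_gen (X.map g).fn (pushGen X g) (pushGenIso X g) e).trans
    (EqUpTo.eqToHom_conj (congrArg (act (X.map g)).obj (of_ev X e))
      ((compArr X f g).inv.app v) (of_ev X (pushGen X g e)).symm)
  exact h.inv (m := ((evalArr X g).app (gen X f v)).symm) (n := ((compArr X f g).app v).symm)

lemma strictObj_isEqToHom_arr {a : A} {Y : TwoCatPI.{u}} {F G : strictObj X a ⟶ Y}
    (hF : IsTwoFunctor F.fn) (hG : IsTwoFunctor G.fn) (α : F ⟶ G)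
    (h : ∀ {b : A} (f : b ⟶ a) (v : Arr (X.obj b).carrier), IsEqToHom ((arr α).app (gen X f v)))
    (p : Arr (strictObj X a).carrier) : IsEqToHom ((arr α).app p) :=
  Full.isEqToHom_arr hF hG α.icon (fun e => of_gen X e ▸ h e.f e.v) p

end Strictification

section Lift

variable {A : Type u} [Bicategory.{u, u} A] {X : A ⥤ᵖ TwoCatPI.{u}} {W : TwoCatPI.{u}} {c : A}
  {F G : W ⟶ strictObj X c}

instance : (act (evalHom X c)).Faithful := (Full.fullyFaithfulProj (P := formalCells X c)).faithful

/-- The lift of a 2-cell along the evaluation, which is locally fully faithful. -/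
def liftHom₂ (α : F ≫ evalHom X c ⟶ G ≫ evalHom X c) : F ⟶ G :=
  ⟨Full.iconLift α.icon⟩

lemma map_arr_liftHom₂ (α : F ≫ evalHom X c ⟶ G ≫ evalHom X c) (v : Arr W.carrier) :
    (act (evalHom X c)).map ((arr (liftHom₂ α)).app v) = (arr α).app v :=
  Full.map_proj_arr_iconLift α.icon v

@[simp]
lemma liftHom₂_whiskerRight (α : F ≫ evalHom X c ⟶ G ≫ evalHom X c) :
    liftHom₂ α ▷ evalHom X c = α :=
  hom₂_ext_arr fun v => map_arr_liftHom₂ α v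

lemma whiskerRight_evalHom_injective {α β : F ⟶ G} (h : α ▷ evalHom X c = β ▷ evalHom X c) :
    α = β :=
  hom₂_ext_arr fun v => (act (evalHom X c)).map_injective (congrArg (fun k => (arr k).app v) h)

/-- The lift of an invertible 2-cell along the evaluation. -/
def liftIso₂ (α : F ≫ evalHom X c ≅ G ≫ evalHom X c) : F ≅ G where
  hom := liftHom₂ α.hom
  inv := liftHom₂ α.inv
  hom_inv_id := whiskerRight_evalHom_injective (by simp)
  inv_hom_id := whiskerRight_evalHom_injective (by simp)

end Lift

section StrictConstraints

variable {A : Type u} [Bicategory.{u, u} A] (X : A ⥤ᵖ TwoCatPI.{u})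

/-- The composition constraint of the strictification, before it is known to be an identity. -/
def strictMapComp {a b c : A} (g : a ⟶ b) (h : b ⟶ c) :
    strictMap X (g ≫ h) ⟶ strictMap X g ≫ strictMap X h :=
  liftHom₂ ((evalIso X (g ≫ h)).hom ≫ evalHom X a ◁ (X.mapComp g h).hom ≫
    (α_ _ _ _).inv ≫ (evalIso X g).inv ▷ X.map h ≫ (α_ _ _ _).hom ≫
    strictMap X g ◁ (evalIso X h).inv ≫ (α_ _ _ _).inv)

/-- The unit constraint of the strictification, before it is known to be an identity. -/
def strictMapId (a : A) : strictMap X (𝟙 a) ⟶ 𝟙 (strictObj X a) :=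
  liftHom₂ ((evalIso X (𝟙 a)).hom ≫ evalHom X a ◁ (X.mapId a).hom ≫ (ρ_ _).hom ≫ (λ_ _).inv)

lemma map_arr_strictMapComp {a b c : A} (g : a ⟶ b) (h : b ⟶ c)
    (p : Arr (strictObj X a).carrier) :
    (act (evalHom X c)).map ((arr (strictMapComp X g h)).app p) =
      ((evalArr X (g ≫ h)).hom.app p ≫ (compArr X g h).hom.app ((act (evalHom X a)).obj p)) ≫
        ((evalArr X h).app ((act (strictMap X g)).obj p) ≪≫
          (act (X.map h)).mapIso ((evalArr X g).app p)).inv := by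
  refine (map_arr_liftHom₂ _ p).trans ?_
  change (evalArr X (g ≫ h)).hom.app p ≫ (compArr X g h).hom.app ((act (evalHom X a)).obj p) ≫
    𝟙 _ ≫ (act (X.map h)).map ((evalArr X g).inv.app p) ≫ 𝟙 _ ≫
      (evalArr X h).inv.app ((act (strictMap X g)).obj p) ≫ 𝟙 _ = _
  simp

lemma map_arr_strictMapId (a : A) (p : Arr (strictObj X a).carrier) :
    (act (evalHom X a)).map ((arr (strictMapId X a)).app p) =
      (evalArr X (𝟙 a)).hom.app p ≫ (idArr X a).hom.app ((act (evalHom X a)).obj p) := by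
  refine (map_arr_liftHom₂ _ p).trans ?_
  change (evalArr X (𝟙 a)).hom.app p ≫ (idArr X a).hom.app ((act (evalHom X a)).obj p) ≫
    𝟙 _ ≫ 𝟙 _ = _
  simp

variable [Strict A]

lemma isEqToHom_strictMapComp_gen {a b c d : A} (f : a ⟶ b) (g : b ⟶ c) (h : c ⟶ d)
    (v : Arr (X.obj a).carrier) : IsEqToHom ((arr (strictMapComp X g h)).app (gen X f v)) := by
  have hgen : (act (strictMap X (g ≫ h))).obj (gen X f v) =
      (act (strictMap X h)).obj ((act (strictMap X g)).obj (gen X f v)) := by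
    rw [strictMap_gen, strictMap_gen, strictMap_gen, Strict.assoc]
  refine .of_map (act (evalHom X d)) hgen ?_
  rw [map_arr_strictMapComp]
  refine EqUpTo.isEqToHom_comp_inv ?_
  have hsrc : EqUpTo ((evalArr X (g ≫ h)).hom.app (gen X f v) ≫
      (compArr X g h).hom.app ((act (evalHom X b)).obj (gen X f v)))
      ((compArr X f (g ≫ h)).hom.app v ≫ (compArr X g h).hom.app ((act (X.map f)).obj v)) :=
    (evalArr_gen X f (g ≫ h) v).comp (.app _ (evalHom_gen X f v))
  have htgt : EqUpTo ((evalArr X h).hom.app ((act (strictMap X g)).obj (gen X f v)) ≫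
      (act (X.map h)).map ((evalArr X g).hom.app (gen X f v)))
      ((compArr X (f ≫ g) h).hom.app v ≫ (act (X.map h)).map ((compArr X f g).hom.app v)) :=
    .comp ((EqUpTo.app _ (strictMap_gen X f g v)).trans (evalArr_gen X (f ≫ g) h v))
      ((evalArr_gen X f g v).map _)
  refine hsrc.trans (.trans ?_ htgt.symm)
  rw [compArr_assoc]
  exact (EqUpTo.isEqToHom_comp (isEqToHom_map₂ X
    ⟨Strict.assoc f g h, congrArg Iso.hom (Strict.associator_eqToIso f g h)⟩ v) _).symm

lemma isEqToHom_strictMapId_gen {a b : A} (f : a ⟶ b) (v : Arr (X.obj a).carrier) :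
    IsEqToHom ((arr (strictMapId X b)).app (gen X f v)) := by
  have hgen : (act (strictMap X (𝟙 b))).obj (gen X f v) = gen X f v := by
    rw [strictMap_gen, Strict.comp_id]
  refine .of_map (act (evalHom X b)) hgen ?_
  rw [map_arr_strictMapId]
  refine ((evalArr_gen X f (𝟙 b) v).comp (.app _ (evalHom_gen X f v))).isEqToHom ?_
  rw [compArr_id_right]
  exact isEqToHom_map₂ X ⟨Strict.comp_id f, congrArg Iso.hom (Strict.rightUnitor_eqToIso f)⟩ v

lemma isEqToHom_strictMapComp {a b c : A} (g : a ⟶ b) (h : b ⟶ c) :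
    IsEqToHom (strictMapComp X g h) :=
  isEqToHom_of_arr <| strictObj_isEqToHom_arr X (strictMap_isTwoFunctor X _)
    ((strictMap_isTwoFunctor X _).comp (strictMap_isTwoFunctor X _)) _
    fun f v => isEqToHom_strictMapComp_gen X f g h v

lemma isEqToHom_strictMapId (a : A) : IsEqToHom (strictMapId X a) :=
  isEqToHom_of_arr <| strictObj_isEqToHom_arr X (strictMap_isTwoFunctor X _)
    (twoFunctors.id_holds _) _ fun f v => isEqToHom_strictMapId_gen X f v

lemma evalArr_comp {a b c : A} (g : a ⟶ b) (h : b ⟶ c) (p : Arr (strictObj X a).carrier) :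
    EqUpTo ((evalArr X (g ≫ h)).hom.app p ≫ (compArr X g h).hom.app ((act (evalHom X a)).obj p))
      ((evalArr X h).hom.app ((act (strictMap X g)).obj p) ≫
        (act (X.map h)).map ((evalArr X g).hom.app p)) := by
  refine EqUpTo.of_isEqToHom_comp_inv (n := (evalArr X h).app ((act (strictMap X g)).obj p) ≪≫
    (act (X.map h)).mapIso ((evalArr X g).app p)) ?_
  rw [← map_arr_strictMapComp]
  exact (isEqToHom_arr (isEqToHom_strictMapComp X g h) p).map _

lemma evalArr_id (a : A) (p : Arr (strictObj X a).carrier) :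
    IsEqToHom ((evalArr X (𝟙 a)).hom.app p ≫
      (idArr X a).hom.app ((act (evalHom X a)).obj p)) := by
  rw [← map_arr_strictMapId]
  exact (isEqToHom_arr (isEqToHom_strictMapId X a) p).map _

end StrictConstraints

section Strictification

variable {A : Type u} [Bicategory.{u, u} A] (X : A ⥤ᵖ TwoCatPI.{u})

/-- The values of the strictification on 2-cells. -/
def strictMap₂ {a b : A} {f g : a ⟶ b} (η : f ⟶ g) : strictMap X f ⟶ strictMap X g :=
  liftHom₂ ((evalIso X f).hom ≫ evalHom X a ◁ X.map₂ η ≫ (evalIso X g).inv)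

lemma strictMap₂_whiskerRight {a b : A} {f g : a ⟶ b} (η : f ⟶ g) :
    strictMap₂ X η ▷ evalHom X b =
      (evalIso X f).hom ≫ evalHom X a ◁ X.map₂ η ≫ (evalIso X g).inv :=
  liftHom₂_whiskerRight _

lemma strictMap₂_id {a b : A} (f : a ⟶ b) : strictMap₂ X (𝟙 f) = 𝟙 _ :=
  whiskerRight_evalHom_injective (by simp [strictMap₂_whiskerRight])

lemma strictMap₂_comp {a b : A} {f g h : a ⟶ b} (η : f ⟶ g) (θ : g ⟶ h) :
    strictMap₂ X (η ≫ θ) = strictMap₂ X η ≫ strictMap₂ X θ :=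
  whiskerRight_evalHom_injective (by simp [strictMap₂_whiskerRight])

lemma evalArr_map₂ {a b : A} {f g : a ⟶ b} (η : f ⟶ g) (p : Arr (strictObj X a).carrier) :
    (act (evalHom X b)).map ((arr (strictMap₂ X η)).app p) ≫ (evalArr X g).hom.app p =
      (evalArr X f).hom.app p ≫ (arr (X.map₂ η)).app ((act (evalHom X a)).obj p) := by
  have h : strictMap₂ X η ▷ evalHom X b ≫ (evalIso X g).hom =
      (evalIso X f).hom ≫ evalHom X a ◁ X.map₂ η := by
    simp [strictMap₂_whiskerRight]
  exact congrArg (fun α => (arr α).app p) h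

lemma evalArr_map₂_whiskerLeft {a b c : A} (f : a ⟶ b) {g h : b ⟶ c} (η : g ⟶ h)
    (p : Arr (strictObj X a).carrier) :
    (act (evalHom X c)).map ((arr (strictMap₂ X (f ◁ η))).app p) ≫
      (evalArr X (f ≫ h)).hom.app p ≫ (compArr X f h).hom.app ((act (evalHom X a)).obj p) =
    ((evalArr X (f ≫ g)).hom.app p ≫ (compArr X f g).hom.app ((act (evalHom X a)).obj p)) ≫
      (arr (X.map₂ η)).app ((act (X.map f)).obj ((act (evalHom X a)).obj p)) := by
  rw [reassoc_of% (evalArr_map₂ X (f ◁ η) p), compArr_whiskerLeft, Category.assoc]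

lemma whiskerLeft_evalArr_map₂ {a b c : A} (f : a ⟶ b) {g h : b ⟶ c} (η : g ⟶ h)
    (p : Arr (strictObj X a).carrier) :
    (act (evalHom X c)).map ((arr (strictMap₂ X η)).app ((act (strictMap X f)).obj p)) ≫
      (evalArr X h).hom.app ((act (strictMap X f)).obj p) ≫
        (act (X.map h)).map ((evalArr X f).hom.app p) =
    ((evalArr X g).hom.app ((act (strictMap X f)).obj p) ≫
      (act (X.map g)).map ((evalArr X f).hom.app p)) ≫
        (arr (X.map₂ η)).app ((act (X.map f)).obj ((act (evalHom X a)).obj p)) := by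
  have hη := (arr (X.map₂ η)).naturality ((evalArr X f).hom.app p)
  have hp := reassoc_of% (evalArr_map₂ X η ((act (strictMap X f)).obj p))
  exact (hp _).trans ((congrArg (_ ≫ ·) hη.symm).trans (Category.assoc _ _ _).symm)

variable [Strict A]

lemma strictMap_id (a : A) : strictMap X (𝟙 a) = 𝟙 (strictObj X a) :=
  (isEqToHom_strictMapId X a).choose

lemma strictMap_comp {a b c : A} (f : a ⟶ b) (g : b ⟶ c) :
    strictMap X (f ≫ g) = strictMap X f ≫ strictMap X g :=
  (isEqToHom_strictMapComp X f g).choose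

lemma strictMap_comp_obj {a b c : A} (f : a ⟶ b) (g : b ⟶ c) (p : Arr (strictObj X a).carrier) :
    (act (strictMap X (f ≫ g))).obj p = (act (strictMap X g)).obj ((act (strictMap X f)).obj p) :=
  congrArg (fun F => (act F).obj p) (strictMap_comp X f g)

lemma strictMap₂_whiskerLeft {a b c : A} (f : a ⟶ b) {g h : b ⟶ c} (η : g ⟶ h) :
    EqUpTo (strictMap₂ X (f ◁ η)) (strictMap X f ◁ strictMap₂ X η) := by
  refine eqUpTo_of_arr (strictMap_comp X f g) (strictMap_comp X f h) fun p =>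
    .trans (.of_map (act (evalHom X c)) (strictMap_comp_obj X f g p) (strictMap_comp_obj X f h p)
      ?_) (.of_eq (arr_whiskerLeft_app (strictMap X f) (strictMap₂ X η) p).symm)
  refine .of_comp (n := (evalArr X (f ≫ h)).app p ≪≫
      (compArr X f h).app ((act (evalHom X a)).obj p))
    (n' := (evalArr X h).app ((act (strictMap X f)).obj p) ≪≫
      (act (X.map h)).mapIso ((evalArr X f).app p)) ?_ (evalArr_comp X f h p)
  have hm := (evalArr_comp X f g p).comp
    (.refl ((arr (X.map₂ η)).app ((act (X.map f)).obj ((act (evalHom X a)).obj p))))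
  rw [← evalArr_map₂_whiskerLeft] at hm
  exact hm.trans (.of_eq (whiskerLeft_evalArr_map₂ X f η p).symm)

lemma strictMap₂_whiskerRight_map {a b c : A} {f g : a ⟶ b} (η : f ⟶ g) (h : b ⟶ c) :
    EqUpTo (strictMap₂ X (η ▷ h)) (strictMap₂ X η ▷ strictMap X h) := by
  refine eqUpTo_of_arr (strictMap_comp X f h) (strictMap_comp X g h) fun p =>
    .of_map (act (evalHom X c)) (strictMap_comp_obj X f h p) (strictMap_comp_obj X g h p) ?_
  refine .of_comp (n := (evalArr X (g ≫ h)).app p ≪≫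
      (compArr X g h).app ((act (evalHom X a)).obj p))
    (n' := (evalArr X h).app ((act (strictMap X g)).obj p) ≪≫
      (act (X.map h)).mapIso ((evalArr X g).app p)) ?_ (evalArr_comp X g h p)
  let k := (act (X.map h)).map ((arr (X.map₂ η)).app ((act (evalHom X a)).obj p))
  have hl : (act (evalHom X c)).map ((arr (strictMap₂ X (η ▷ h))).app p) ≫
      (evalArr X (g ≫ h)).hom.app p ≫ (compArr X g h).hom.app ((act (evalHom X a)).obj p) =
      ((evalArr X (f ≫ h)).hom.app p ≫ (compArr X f h).hom.app ((act (evalHom X a)).obj p)) ≫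
        k := by
    rw [reassoc_of% (evalArr_map₂ X (η ▷ h) p), compArr_whiskerRight, Category.assoc]
  have hr : (act (strictMap X h) ⋙ act (evalHom X c)).map ((arr (strictMap₂ X η)).app p) ≫
      (evalArr X h).hom.app ((act (strictMap X g)).obj p) ≫
        (act (X.map h)).map ((evalArr X g).hom.app p) =
      ((evalArr X h).hom.app ((act (strictMap X f)).obj p) ≫
        (act (X.map h)).map ((evalArr X f).hom.app p)) ≫ k := by
    rw [(evalArr X h).hom.naturality_assoc, Category.assoc, Functor.comp_map]
    exact congrArg (_ ≫ ·) <| by rw [← Functor.map_comp, evalArr_map₂, Functor.map_comp]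
  have hm := (evalArr_comp X f h p).comp (.refl k)
  rw [← hl] at hm
  exact hm.trans (.of_eq hr.symm)

/-- The strictification of a pseudofunctor. -/
def strictification : StrictPseudofunctor A TwoCatTwoI.{u} :=
  StrictPseudofunctor.mk''
    { obj a := ⟨strictObj X a⟩
      map f := ⟨strictMap X f, strictMap_isTwoFunctor X f⟩
      map₂ η := ⟨strictMap₂ X η⟩
      map₂_id f := LocallyFull.hom₂_ext (strictMap₂_id X f)
      map₂_comp η θ := LocallyFull.hom₂_ext (strictMap₂_comp X η θ)
      map_id a := LocallyFull.hom_ext (strictMap_id X a)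
      map_comp f g := LocallyFull.hom_ext (strictMap_comp X f g)
      map₂_whisker_left f _ _ η := eq_conj_of_eqUpTo_cell
        (LocallyFull.hom_ext (strictMap_comp X f _)) (LocallyFull.hom_ext (strictMap_comp X f _))
        (strictMap₂_whiskerLeft X f η)
      map₂_whisker_right η h := eq_conj_of_eqUpTo_cell
        (LocallyFull.hom_ext (strictMap_comp X _ h)) (LocallyFull.hom_ext (strictMap_comp X _ h))
        (strictMap₂_whiskerRight_map X η h) }

end Strictification

section NatArr

namespace TwoCatPI

lemma hom₂_ext_arr_iff {X Y : TwoCatPI.{u}} {F G : X ⟶ Y} {α β : F ⟶ G} :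
    α = β ↔ ∀ v : Arr X.carrier, (arr α).app v = (arr β).app v :=
  ⟨fun h _ => h ▸ rfl, hom₂_ext_arr⟩

lemma naturality_id_iff {x y : TwoCatPI.{u}} {p : x ⟶ y} {k : x ⟶ x} {l : y ⟶ y}
    (m : k ⟶ 𝟙 x) (n : l ⟶ 𝟙 y) (θ : k ≫ p ≅ p ≫ l) :
    θ.hom ≫ p ◁ n = m ▷ p ≫ (λ_ p).hom ≫ (ρ_ p).inv ↔ ∀ v : Arr x.carrier,
      (squareArr θ).hom.app v ≫ (arr n).app ((act p).obj v) = (act p).map ((arr m).app v) :=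
  hom₂_ext_arr_iff.trans <| forall_congr' fun v => by
    change (squareArr θ).hom.app v ≫ (arr n).app ((act p).obj v) =
      (act p).map ((arr m).app v) ≫ 𝟙 _ ≫ 𝟙 _ ↔ _
    rw [Category.comp_id, Category.comp_id]

lemma naturality_comp_iff {x y z x' y' z' : TwoCatPI.{u}} {p : x ⟶ x'} {q : y ⟶ y'}
    {r : z ⟶ z'} {f : x ⟶ y} {g : y ⟶ z} {k : x ⟶ z} {f' : x' ⟶ y'} {g' : y' ⟶ z'}
    {k' : x' ⟶ z'} (m : k ⟶ f ≫ g) (m' : k' ⟶ f' ≫ g') (n : f ≫ q ≅ p ≫ f')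
    (n' : g ≫ r ≅ q ≫ g') (n'' : k ≫ r ≅ p ≫ k') :
    n''.hom ≫ p ◁ m' = m ▷ r ≫ (α_ f g r).hom ≫ f ◁ n'.hom ≫ (α_ f q g').inv ≫ n.hom ▷ g' ≫
      (α_ p f' g').hom ↔ ∀ v : Arr x.carrier,
      (squareArr n'').hom.app v ≫ (arr m').app ((act p).obj v) =
        (act r).map ((arr m).app v) ≫ (squareArr n').hom.app ((act f).obj v) ≫
          (act g').map ((squareArr n).hom.app v) :=
  hom₂_ext_arr_iff.trans <| forall_congr' fun v => by
    change (squareArr n'').hom.app v ≫ (arr m').app ((act p).obj v) =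
      (act r).map ((arr m).app v) ≫ 𝟙 _ ≫ (squareArr n').hom.app ((act f).obj v) ≫ 𝟙 _ ≫
        (act g').map ((squareArr n).hom.app v) ≫ 𝟙 _ ↔ _
    rw [Category.id_comp, Category.id_comp, Category.comp_id]

end TwoCatPI

variable {A : Type u} [Bicategory.{u, u} A] {F G : A ⥤ᵖ TwoCatPI.{u}}

/-- The pseudonaturality isomorphisms of a transformation between pseudofunctors to `2Cat_{p,i}`,
evaluated at an arrow. -/
def natArr (σ : F ⟶ G) {a b : A} (f : a ⟶ b) (v : Arr (F.obj a).carrier) :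
    (act (σ.app b)).obj ((act (F.map f)).obj v) ≅ (act (G.map f)).obj ((act (σ.app a)).obj v) :=
  (squareArr (σ.naturality f)).app v

lemma natArr_congr (σ : F ⟶ G) {a b : A} (f : a ⟶ b) {v w : Arr (F.obj a).carrier} (h : v = w) :
    EqUpTo (natArr σ f v).hom (natArr σ f w).hom := by
  subst h
  exact .refl _

lemma natArr_naturality (σ : F ⟶ G) {a b : A} (f : a ⟶ b) {v w : Arr (F.obj a).carrier}
    (m : v ⟶ w) :
    (act (σ.app b)).map ((act (F.map f)).map m) ≫ (natArr σ f w).hom =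
      (natArr σ f v).hom ≫ (act (G.map f)).map ((act (σ.app a)).map m) :=
  (squareArr (σ.naturality f)).hom.naturality m

lemma natArr_map₂ (σ : F ⟶ G) {a b : A} {f g : a ⟶ b} (η : f ⟶ g) (v : Arr (F.obj a).carrier) :
    (act (σ.app b)).map ((arr (F.map₂ η)).app v) ≫ (natArr σ g v).hom =
      (natArr σ f v).hom ≫ (arr (G.map₂ η)).app ((act (σ.app a)).obj v) :=
  congrArg (fun α => (arr α).app v) (σ.naturality_naturality η)

lemma natArr_id (σ : F ⟶ G) (a : A) (v : Arr (F.obj a).carrier) :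
    (natArr σ (𝟙 a) v).hom ≫ (idArr G a).hom.app ((act (σ.app a)).obj v) =
      (act (σ.app a)).map ((idArr F a).hom.app v) :=
  (naturality_id_iff _ _ _).1 (σ.naturality_id a) v

lemma natArr_comp (σ : F ⟶ G) {a b c : A} (f : a ⟶ b) (g : b ⟶ c) (v : Arr (F.obj a).carrier) :
    (natArr σ (f ≫ g) v).hom ≫ (compArr G f g).hom.app ((act (σ.app a)).obj v) =
      (act (σ.app c)).map ((compArr F f g).hom.app v) ≫
        (natArr σ g ((act (F.map f)).obj v)).hom ≫
          (act (G.map g)).map ((natArr σ f v).hom) :=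
  (naturality_comp_iff _ _ _ _ _).1 (σ.naturality_comp f g) v

/-- A pseudonatural transformation between pseudofunctors to `2Cat_{p,i}`, with axioms stated on
arrow categories. -/
def transOfArr (app : ∀ a, F.obj a ⟶ G.obj a)
    (nat : ∀ {a b : A} (f : a ⟶ b), F.map f ≫ app b ≅ app a ≫ G.map f)
    (nat₂ : ∀ {a b : A} {f g : a ⟶ b} (η : f ⟶ g) (v : Arr (F.obj a).carrier),
      (act (app b)).map ((arr (F.map₂ η)).app v) ≫ (squareArr (nat g)).hom.app v =
        (squareArr (nat f)).hom.app v ≫ (arr (G.map₂ η)).app ((act (app a)).obj v))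
    (nat_id : ∀ (a : A) (v : Arr (F.obj a).carrier),
      (squareArr (nat (𝟙 a))).hom.app v ≫ (idArr G a).hom.app ((act (app a)).obj v) =
        (act (app a)).map ((idArr F a).hom.app v))
    (nat_comp : ∀ {a b c : A} (f : a ⟶ b) (g : b ⟶ c) (v : Arr (F.obj a).carrier),
      (squareArr (nat (f ≫ g))).hom.app v ≫ (compArr G f g).hom.app ((act (app a)).obj v) =
        (act (app c)).map ((compArr F f g).hom.app v) ≫
          (squareArr (nat g)).hom.app ((act (F.map f)).obj v) ≫
            (act (G.map g)).map ((squareArr (nat f)).hom.app v)) : F ⟶ G where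
  app := app
  naturality := nat
  naturality_naturality η := hom₂_ext_arr (nat₂ η)
  naturality_id a := (naturality_id_iff _ _ _).2 (nat_id a)
  naturality_comp f g := (naturality_comp_iff _ _ _ _ _).2 (nat_comp f g)

end NatArr

section TwoFunctorToTwoCat

variable {A : Type u} [Bicategory.{u, u} A]

/-- A 2-functor to `2Cat_{2,i}`, as a pseudofunctor to `2Cat_{p,i}`. -/
abbrev inclObj (Y : StrictPseudofunctor A TwoCatTwoI.{u}) : A ⥤ᵖ TwoCatPI.{u} :=
  Y.toPseudofunctor.comp (LocallyFull.inclusion twoFunctors.{u}).toPseudofunctor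

lemma isEqToHom_cell {X Y : TwoCatTwoI.{u}} {F G : X ⟶ Y} {α : F ⟶ G} (h : IsEqToHom α) :
    IsEqToHom α.cell := by
  obtain ⟨rfl, rfl⟩ := h
  exact .id _

lemma isEqToHom_compArr (Y : StrictPseudofunctor A TwoCatTwoI.{u}) {a b c : A}
    (f : a ⟶ b) (g : b ⟶ c) (v : Arr ((inclObj Y).obj a).carrier) :
    IsEqToHom ((compArr (inclObj Y) f g).hom.app v) := by
  have h : IsEqToHom (Y.mapComp f g).hom := ⟨Y.map_comp f g, by simp [Y.mapComp_eq_eqToIso]⟩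
  exact isEqToHom_arr (α := ((inclObj Y).mapComp f g).hom) ((isEqToHom_cell h).comp (.id _)) v

lemma isEqToHom_idArr (Y : StrictPseudofunctor A TwoCatTwoI.{u}) (a : A)
    (v : Arr ((inclObj Y).obj a).carrier) : IsEqToHom ((idArr (inclObj Y) a).hom.app v) := by
  have h : IsEqToHom (Y.mapId a).hom := ⟨Y.map_id a, by simp [Y.mapId_eq_eqToIso]⟩
  exact isEqToHom_arr (α := ((inclObj Y).mapId a).hom) ((isEqToHom_cell h).comp (.id _)) v

end TwoFunctorToTwoCat

section PointwiseInverse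

lemma modification_of_arr {x y x' y' : TwoCatPI.{u}} {f : x ⟶ y} {p : x ⟶ x'} {q : y ⟶ y'}
    {f' : x' ⟶ y'} {p' : x' ⟶ x} {q' : y' ⟶ y} (n : f ≫ q ≅ p ≫ f') (n' : f' ≫ q' ≅ p' ≫ f)
    (t : p ≫ p' ≅ 𝟙 x) (t' : q ≫ q' ≅ 𝟙 y)
    (h : ∀ v : Arr x.carrier, (retractionArr t').hom.app ((act f).obj v) =
      (act q').map ((squareArr n).hom.app v) ≫ (squareArr n').hom.app ((act p).obj v) ≫
        (act f).map ((retractionArr t).hom.app v)) :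
    f ◁ t'.hom ≫ (ρ_ f).hom ≫ (λ_ f).inv =
      ((α_ f q q').inv ≫ n.hom ▷ q' ≫ (α_ p f' q').hom ≫ p ◁ n'.hom ≫ (α_ p p' f).inv) ≫
        t.hom ▷ f :=
  hom₂_ext_arr fun v => by
    change (retractionArr t').hom.app ((act f).obj v) ≫ 𝟙 _ ≫ 𝟙 _ =
      (𝟙 _ ≫ (act q').map ((squareArr n).hom.app v) ≫ 𝟙 _ ≫
        (squareArr n').hom.app ((act p).obj v) ≫ 𝟙 _) ≫ (act f).map ((retractionArr t).hom.app v)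
    simp only [Category.comp_id, Category.id_comp, Category.assoc, h]

variable {A : Type u} [Bicategory.{u, u} A] {Q X : A ⥤ᵖ TwoCatPI.{u}}

/-- A family of inverses of the components of a pseudonatural transformation `e` with locally
faithful components, and with compatible comparison 2-cells. -/
structure PointwiseInverse (e : Q ⟶ X) where
  faithful (a : A) : (act (e.app a)).Faithful
  inv (a : A) : X.obj a ⟶ Q.obj a
  invComp (a : A) : inv a ≫ e.app a ≅ 𝟙 (X.obj a)
  compInv (a : A) : e.app a ≫ inv a ≅ 𝟙 (Q.obj a)
  nat {a b : A} (f : a ⟶ b) : X.map f ≫ inv b ≅ inv a ≫ Q.map f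
  map_nat {a b : A} (f : a ⟶ b) (v : Arr (X.obj a).carrier) :
    (act (e.app b)).map ((squareArr (nat f)).hom.app v) ≫
      (natArr e f ((act (inv a)).obj v)).hom ≫
        (act (X.map f)).map ((retractionArr (invComp a)).hom.app v) =
      (retractionArr (invComp b)).hom.app ((act (X.map f)).obj v)
  map_compInv (a : A) (p : Arr (Q.obj a).carrier) :
    (act (e.app a)).map ((retractionArr (compInv a)).hom.app p) =
      (retractionArr (invComp a)).hom.app ((act (e.app a)).obj p)

namespace PointwiseInverse

variable {e : Q ⟶ X} (R : PointwiseInverse e)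

/-- The retractions `invComp`, evaluated at an arrow. -/
def retrArr (a : A) (v : Arr (X.obj a).carrier) :
    (act (e.app a)).obj ((act (R.inv a)).obj v) ≅ v :=
  (retractionArr (R.invComp a)).app v

/-- The retractions `compInv`, evaluated at an arrow. -/
def corArr (a : A) (p : Arr (Q.obj a).carrier) :
    (act (R.inv a)).obj ((act (e.app a)).obj p) ≅ p :=
  (retractionArr (R.compInv a)).app p

/-- The squares `nat`, evaluated at an arrow. -/
def secArr {a b : A} (f : a ⟶ b) (v : Arr (X.obj a).carrier) :
    (act (R.inv b)).obj ((act (X.map f)).obj v) ≅ (act (Q.map f)).obj ((act (R.inv a)).obj v) :=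
  (squareArr (R.nat f)).app v

lemma map_secArr {a b : A} (f : a ⟶ b) (v : Arr (X.obj a).carrier) :
    (act (e.app b)).map (R.secArr f v).hom ≫
      (natArr e f ((act (R.inv a)).obj v)).hom ≫
        (act (X.map f)).map (R.retrArr a v).hom =
      (R.retrArr b ((act (X.map f)).obj v)).hom :=
  R.map_nat f v

lemma retrArr_naturality (a : A) {v w : Arr (X.obj a).carrier} (m : v ⟶ w) :
    (act (e.app a)).map ((act (R.inv a)).map m) ≫ (R.retrArr a w).hom =
      (R.retrArr a v).hom ≫ m :=
  (retractionArr (R.invComp a)).hom.naturality m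

lemma secArr_map₂ {a b : A} {f g : a ⟶ b} (η : f ⟶ g) (v : Arr (X.obj a).carrier) :
    (act (R.inv b)).map ((arr (X.map₂ η)).app v) ≫ (R.secArr g v).hom =
      (R.secArr f v).hom ≫ (arr (Q.map₂ η)).app ((act (R.inv a)).obj v) := by
  have := R.faithful b
  apply (act (e.app b)).map_injective
  rw [← cancel_mono (natArr e g ((act (R.inv a)).obj v) ≪≫
    (act (X.map g)).mapIso (R.retrArr a v)).hom, Iso.trans_hom, Functor.mapIso_hom]
  have hη := (arr (X.map₂ η)).naturality (R.retrArr a v).hom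
  rw [Functor.map_comp, Functor.map_comp, Category.assoc, Category.assoc, R.map_secArr g v,
    retrArr_naturality, ← R.map_secArr f v,
    reassoc_of% (natArr_map₂ e η ((act (R.inv a)).obj v)), Category.assoc, Category.assoc]
  exact congrArg (_ ≫ _ ≫ ·) hη

lemma secArr_id (a : A) (v : Arr (X.obj a).carrier) :
    (R.secArr (𝟙 a) v).hom ≫ (idArr Q a).hom.app ((act (R.inv a)).obj v) =
      (act (R.inv a)).map ((idArr X a).hom.app v) := by
  have := R.faithful a
  apply (act (e.app a)).map_injective
  have hX := (idArr X a).hom.naturality (R.retrArr a v).hom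
  rw [← cancel_mono (R.retrArr a v).hom, retrArr_naturality, ← R.map_secArr (𝟙 a) v,
    Functor.map_comp, Category.assoc, Category.assoc, Category.assoc, ← natArr_id, Category.assoc]
  exact congrArg (_ ≫ _ ≫ ·) hX.symm

lemma secArr_comp {a b c : A} (f : a ⟶ b) (g : b ⟶ c) (v : Arr (X.obj a).carrier) :
    (R.secArr (f ≫ g) v).hom ≫ (compArr Q f g).hom.app ((act (R.inv a)).obj v) =
      (act (R.inv c)).map ((compArr X f g).hom.app v) ≫
        (R.secArr g ((act (X.map f)).obj v)).hom ≫
          (act (Q.map g)).map (R.secArr f v).hom := by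
  have := R.faithful c
  apply (act (e.app c)).map_injective
  rw [← cancel_mono (natArr e g ((act (Q.map f)).obj ((act (R.inv a)).obj v)) ≪≫
    (act (X.map g)).mapIso (natArr e f ((act (R.inv a)).obj v) ≪≫
      (act (X.map f)).mapIso (R.retrArr a v))).hom,
    Iso.trans_hom, Functor.mapIso_hom, Iso.trans_hom, Functor.mapIso_hom]
  have hX := (compArr X f g).hom.naturality (R.retrArr a v).hom
  rw [(act (e.app c)).map_comp, (act (e.app c)).map_comp, (act (e.app c)).map_comp,
    Category.assoc, Category.assoc, Category.assoc,
    ← Category.assoc ((act _).map ((act (Q.map g)).map _)), natArr_naturality, Category.assoc,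
    ← Functor.map_comp, R.map_secArr f v, R.map_secArr g, retrArr_naturality,
    ← R.map_secArr (f ≫ g) v, Category.assoc, Category.assoc, Functor.map_comp,
    ← reassoc_of% (natArr_comp e f g ((act (R.inv a)).obj v))]
  exact congrArg (_ ≫ _ ≫ ·) hX.symm

/-- The inverses of the components of `e` form a pseudonatural transformation. -/
def trans : X ⟶ Q :=
  transOfArr R.inv R.nat R.secArr_map₂ R.secArr_id R.secArr_comp

/-- The pseudonatural transformation `trans` is inverse to `e` on one side. -/
def transComp : R.trans ≫ e ≅ 𝟙 X :=
  Pseudofunctor.StrongTrans.isoMk R.invComp fun f =>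
    modification_of_arr (R.nat f) (e.naturality f) (R.invComp _) (R.invComp _)
      fun v => (R.map_nat f v).symm

lemma map_corArr (a : A) (p : Arr (Q.obj a).carrier) :
    (act (e.app a)).map (R.corArr a p).hom =
      (R.retrArr a ((act (e.app a)).obj p)).hom :=
  R.map_compInv a p

lemma corArr_map {a b : A} (f : a ⟶ b) (p : Arr (Q.obj a).carrier) :
    (R.corArr b ((act (Q.map f)).obj p)).hom =
      (act (R.inv b)).map (natArr e f p).hom ≫
        (R.secArr f ((act (e.app a)).obj p)).hom ≫
          (act (Q.map f)).map (R.corArr a p).hom := by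
  have := R.faithful b
  apply (act (e.app b)).map_injective
  rw [R.map_corArr, ← cancel_mono (natArr e f p).hom, Functor.map_comp, Functor.map_comp,
    Category.assoc, Category.assoc, natArr_naturality, R.map_corArr]
  refine (R.retrArr_naturality _ _).symm.trans ?_
  exact congrArg (_ ≫ ·) (R.map_secArr f _).symm

/-- The pseudonatural transformation `trans` is inverse to `e` on the other side. -/
def compTrans : e ≫ R.trans ≅ 𝟙 Q :=
  Pseudofunctor.StrongTrans.isoMk R.compInv fun f =>
    modification_of_arr (e.naturality f) (R.nat f) (R.compInv _) (R.compInv _) (R.corArr_map f)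

end PointwiseInverse

end PointwiseInverse

section Unit

variable {A : Type u} [Bicategory.{u, u} A] (X : A ⥤ᵖ TwoCatPI.{u})

/-- The formal 1-cell `1(v)`. -/
def idGen {a : A} {x y : (X.obj a).carrier} (v : x ⟶ y) : (formalCells X a).Gen x y where
  f := 𝟙 a
  v := .of v
  src_eq := ((X.mapId a).hom.icon.obj_eq x).symm
  tgt_eq := ((X.mapId a).hom.icon.obj_eq y).symm

/-- The comparison of `v` with the value of `1(v)`. -/
def idGenIso {a : A} {x y : (X.obj a).carrier} (v : x ⟶ y) :
    v ≅ (Word.single (idGen X v)).eval :=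
  Arr.toIso (((idArr X a).app (.of v)).symm ≪≫ eqToIso (of_ev X (idGen X v)).symm ≪≫
    eqToIso (congrArg Arr.of (Word.eval_single (idGen X v))).symm)

/-- The inclusion of the 1-cells as formal 1-cells. -/
def unitHom (a : A) : X.obj a ⟶ strictObj X a :=
  ⟨Full.lift (Pseudofunctor.id _) (fun v => Word.single (idGen X v)) (fun v => idGenIso X v)⟩

/-- The evaluation is a retraction of the inclusion of the 1-cells. -/
def unitEvalIso (a : A) : unitHom X a ≫ evalHom X a ≅ 𝟙 (X.obj a) where
  hom := ⟨Full.liftIcon _ _ _⟩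
  inv := ⟨Full.liftIconInv _ _ _⟩
  hom_inv_id := hom₂_ext_arr fun v => (Arr.ofIso (idGenIso X v.hom)).inv_hom_id
  inv_hom_id := hom₂_ext_arr fun v => (Arr.ofIso (idGenIso X v.hom)).hom_inv_id

lemma unitHom_obj {a : A} (v : Arr (X.obj a).carrier) :
    (act (unitHom X a)).obj v = gen X (𝟙 a) v :=
  of_gen X (idGen X v.hom)

/-- The isomorphism `unitEvalIso`, evaluated at an arrow. -/
def unitEvalArr (a : A) (v : Arr (X.obj a).carrier) :
    (act (evalHom X a)).obj ((act (unitHom X a)).obj v) ≅ v :=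
  (retractionArr (unitEvalIso X a)).app v

lemma unitEvalArr_eqUpTo {a : A} (v : Arr (X.obj a).carrier) :
    EqUpTo (unitEvalArr X a v).hom ((idArr X a).hom.app v) := by
  have h : (unitEvalArr X a v).hom = eqToHom (congrArg Arr.of (Word.eval_single (idGen X v.hom))) ≫
      eqToHom (of_ev X (idGen X v.hom)) ≫ (idArr X a).hom.app v := by
    change (((idArr X a).app v).symm ≪≫ eqToIso _ ≪≫ eqToIso _).inv = _
    rw [Iso.trans_inv, Iso.trans_inv, Category.assoc]
    rfl
  rw [h]
  exact (EqUpTo.isEqToHom_comp (.eqToHom _) _).trans (EqUpTo.isEqToHom_comp (.eqToHom _) _)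

/-- The pseudonaturality of the inclusion of the 1-cells. -/
def unitNat {a b : A} (f : a ⟶ b) : X.map f ≫ unitHom X b ≅ unitHom X a ≫ strictMap X f :=
  liftIso₂ (α_ _ _ _ ≪≫ whiskerLeftIso (X.map f) (unitEvalIso X b) ≪≫ ρ_ _ ≪≫ (λ_ _).symm ≪≫
    whiskerRightIso (unitEvalIso X a).symm (X.map f) ≪≫ α_ _ _ _ ≪≫
    whiskerLeftIso (unitHom X a) (evalIso X f).symm ≪≫ (α_ _ _ _).symm)

/-- The inclusion of the 1-cells is a retraction of the evaluation. -/
def evalUnitIso (a : A) : evalHom X a ≫ unitHom X a ≅ 𝟙 (strictObj X a) :=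
  liftIso₂ (α_ _ _ _ ≪≫ whiskerLeftIso (evalHom X a) (unitEvalIso X a) ≪≫ ρ_ _ ≪≫ (λ_ _).symm)

lemma map_arr_unitNat {a b : A} (f : a ⟶ b) (v : Arr (X.obj a).carrier) :
    (act (evalHom X b)).map ((arr (unitNat X f).hom).app v) ≫
      (evalArr X f).hom.app ((act (unitHom X a)).obj v) ≫
        (act (X.map f)).map (unitEvalArr X a v).hom =
      (unitEvalArr X b ((act (X.map f)).obj v)).hom := by
  refine (Iso.eq_comp_inv ((evalArr X f).app ((act (unitHom X a)).obj v) ≪≫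
    (act (X.map f)).mapIso (unitEvalArr X a v))).1 ((map_arr_liftHom₂ _ v).trans ?_)
  change 𝟙 _ ≫ (unitEvalArr X b ((act (X.map f)).obj v)).hom ≫ 𝟙 _ ≫ 𝟙 _ ≫
    (act (X.map f)).map (unitEvalArr X a v).inv ≫ 𝟙 _ ≫
      (evalArr X f).inv.app ((act (unitHom X a)).obj v) ≫ 𝟙 _ = _
  rw [Category.id_comp, Category.id_comp, Category.id_comp, Category.id_comp, Category.comp_id]
  rfl

lemma map_arr_evalUnitIso (a : A) (p : Arr (strictObj X a).carrier) :
    (act (evalHom X a)).map ((arr (evalUnitIso X a).hom).app p) =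
      (unitEvalArr X a ((act (evalHom X a)).obj p)).hom := by
  refine (map_arr_liftHom₂ _ p).trans ?_
  change 𝟙 _ ≫ (unitEvalArr X a ((act (evalHom X a)).obj p)).hom ≫ 𝟙 _ ≫ 𝟙 _ = _
  rw [Category.id_comp, Category.comp_id, Category.comp_id]

variable [Strict A]

lemma evalIso_naturality {a b : A} {f g : a ⟶ b} (η : f ⟶ g) (p : Arr (strictObj X a).carrier) :
    (act (evalHom X b)).map ((arr ((inclObj (strictification X)).map₂ η)).app p) ≫
        (squareArr (evalIso X g)).hom.app p =
      (squareArr (evalIso X f)).hom.app p ≫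
        (arr (X.map₂ η)).app ((act (evalHom X a)).obj p) :=
  evalArr_map₂ X η p

lemma evalIso_id (a : A) (p : Arr (strictObj X a).carrier) :
    (squareArr (evalIso X (𝟙 a))).hom.app p ≫ (idArr X a).hom.app ((act (evalHom X a)).obj p) =
      (act (evalHom X a)).map ((idArr (inclObj (strictification X)) a).hom.app p) :=
  (evalArr_id X a p).eq ((isEqToHom_idArr (strictification X) a p).map _)

lemma evalIso_comp {a b c : A} (f : a ⟶ b) (g : b ⟶ c) (p : Arr (strictObj X a).carrier) :
    (squareArr (evalIso X (f ≫ g))).hom.app p ≫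
        (compArr X f g).hom.app ((act (evalHom X a)).obj p) =
      (act (evalHom X c)).map ((compArr (inclObj (strictification X)) f g).hom.app p) ≫
        (squareArr (evalIso X g)).hom.app ((act (strictMap X f)).obj p) ≫
          (act (X.map g)).map ((squareArr (evalIso X f)).hom.app p) := by
  have h := (isEqToHom_compArr (strictification X) f g p).map (act (evalHom X c))
  exact ((evalArr_comp X f g p).trans (EqUpTo.isEqToHom_comp h _).symm).eq

/-- The evaluation of words of formal 1-cells, as a pseudonatural transformation. -/
def evalTrans : inclObj (strictification X) ⟶ X :=
  transOfArr (F := inclObj (strictification X)) (evalHom X) (evalIso X) (evalIso_naturality X)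
    (evalIso_id X) (evalIso_comp X)

/-- The inclusion of the 1-cells as a pointwise inverse of the evaluation. -/
def evalInverse : PointwiseInverse (evalTrans X) where
  faithful a := inferInstanceAs (act (evalHom X a)).Faithful
  inv := unitHom X
  invComp := unitEvalIso X
  compInv := evalUnitIso X
  nat := unitNat X
  map_nat f v := map_arr_unitNat X f v
  map_compInv a p := map_arr_evalUnitIso X a p

/-- The unit of the strictification. -/
def unitTrans : X ⟶ inclObj (strictification X) := (evalInverse X).trans

lemma unitTrans_isInternalEquivalence : IsInternalEquivalence (unitTrans X) :=
  ⟨evalTrans X, ⟨(evalInverse X).transComp⟩, ⟨(evalInverse X).compTrans⟩⟩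

end Unit

section Transport

variable {A : Type u} [Bicategory.{u, u} A] {F G : A ⥤ᵖ TwoCatPI.{u}} (σ : F ⟶ G)
  (t : ∀ a, F.obj a ⟶ G.obj a) (i : ∀ a, t a ≅ σ.app a)

/-- The pseudonaturality isomorphisms transported along isomorphisms of 1-cells. -/
def transportNat {a b : A} (f : a ⟶ b) : F.map f ≫ t b ≅ t a ≫ G.map f :=
  whiskerLeftIso (F.map f) (i b) ≪≫ σ.naturality f ≪≫ whiskerRightIso (i a).symm (G.map f)

/-- The isomorphisms `transportNat`, evaluated at an arrow. -/
def transportNatArr {a b : A} (f : a ⟶ b) (v : Arr (F.obj a).carrier) :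
    (act (t b)).obj ((act (F.map f)).obj v) ≅ (act (G.map f)).obj ((act (t a)).obj v) :=
  (squareArr (transportNat σ t i f)).app v

lemma transportNatArr_hom {a b : A} (f : a ⟶ b) (v : Arr (F.obj a).carrier) :
    (transportNatArr σ t i f v).hom = (arrIso (i b)).hom.app ((act (F.map f)).obj v) ≫
      (natArr σ f v).hom ≫ (act (G.map f)).map ((arrIso (i a)).inv.app v) :=
  rfl

lemma transportNatArr_comp_map {a b : A} (f : a ⟶ b) (v : Arr (F.obj a).carrier) :
    (transportNatArr σ t i f v).hom ≫ (act (G.map f)).map ((arrIso (i a)).hom.app v) =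
      (arrIso (i b)).hom.app ((act (F.map f)).obj v) ≫ (natArr σ f v).hom :=
  (Iso.eq_comp_inv ((act (G.map f)).mapIso ((arrIso (i a)).app v))).1
    ((transportNatArr_hom σ t i f v).trans (Category.assoc _ _ _).symm)

lemma transportNatArr_map₂ {a b : A} {f g : a ⟶ b} (η : f ⟶ g) (v : Arr (F.obj a).carrier) :
    (act (t b)).map ((arr (F.map₂ η)).app v) ≫ (transportNatArr σ t i g v).hom =
      (transportNatArr σ t i f v).hom ≫ (arr (G.map₂ η)).app ((act (t a)).obj v) := by
  rw [← cancel_mono ((act (G.map g)).mapIso ((arrIso (i a)).app v)).hom, Functor.mapIso_hom,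
    Iso.app_hom, Category.assoc, Category.assoc, transportNatArr_comp_map,
    ← (arr (G.map₂ η)).naturality, reassoc_of% (transportNatArr_comp_map σ t i f v),
    (arrIso (i b)).hom.naturality_assoc, natArr_map₂]

lemma transportNatArr_id (a : A) (v : Arr (F.obj a).carrier) :
    (transportNatArr σ t i (𝟙 a) v).hom ≫ (idArr G a).hom.app ((act (t a)).obj v) =
      (act (t a)).map ((idArr F a).hom.app v) := by
  have hG := (idArr G a).hom.naturality ((arrIso (i a)).hom.app v)
  have hF := (arrIso (i a)).hom.naturality ((idArr F a).hom.app v)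
  refine (cancel_mono ((arrIso (i a)).hom.app v)).1 ?_
  calc ((transportNatArr σ t i (𝟙 a) v).hom ≫ _) ≫ (arrIso (i a)).hom.app v
    _ = ((transportNatArr σ t i (𝟙 a) v).hom ≫ (act (G.map (𝟙 a))).map ((arrIso (i a)).hom.app v)) ≫
        (idArr G a).hom.app ((act (σ.app a)).obj v) :=
      (Category.assoc _ _ _).trans ((congrArg (_ ≫ ·) hG.symm).trans (Category.assoc _ _ _).symm)
    _ = (arrIso (i a)).hom.app ((act (F.map (𝟙 a))).obj v) ≫ (natArr σ (𝟙 a) v).hom ≫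
        (idArr G a).hom.app ((act (σ.app a)).obj v) :=
      (congrArg (· ≫ _) (transportNatArr_comp_map σ t i (𝟙 a) v)).trans (Category.assoc _ _ _)
    _ = _ := (congrArg (_ ≫ ·) (natArr_id σ a v)).trans hF.symm

lemma transportNatArr_comp {a b c : A} (f : a ⟶ b) (g : b ⟶ c) (v : Arr (F.obj a).carrier) :
    (transportNatArr σ t i (f ≫ g) v).hom ≫ (compArr G f g).hom.app ((act (t a)).obj v) =
      (act (t c)).map ((compArr F f g).hom.app v) ≫
        (transportNatArr σ t i g ((act (F.map f)).obj v)).hom ≫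
          (act (G.map g)).map (transportNatArr σ t i f v).hom := by
  have hG := (compArr G f g).hom.naturality ((arrIso (i a)).hom.app v)
  have hF := (arrIso (i c)).hom.naturality ((compArr F f g).hom.app v)
  rw [← cancel_mono ((act (G.map g)).mapIso ((act (G.map f)).mapIso
    ((arrIso (i a)).app v))).hom, Functor.mapIso_hom, Functor.mapIso_hom, Iso.app_hom,
    Category.assoc, Category.assoc, Category.assoc, ← Functor.map_comp, transportNatArr_comp_map,
    Functor.map_comp, reassoc_of% (transportNatArr_comp_map σ t i g ((act (F.map f)).obj v))]
  calc (transportNatArr σ t i (f ≫ g) v).hom ≫ _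
    _ = ((transportNatArr σ t i (f ≫ g) v).hom ≫
          (act (G.map (f ≫ g))).map ((arrIso (i a)).hom.app v)) ≫
        (compArr G f g).hom.app ((act (σ.app a)).obj v) :=
      (congrArg (_ ≫ ·) hG.symm).trans (Category.assoc _ _ _).symm
    _ = (arrIso (i c)).hom.app ((act (F.map (f ≫ g))).obj v) ≫ (natArr σ (f ≫ g) v).hom ≫
        (compArr G f g).hom.app ((act (σ.app a)).obj v) :=
      (congrArg (· ≫ _) (transportNatArr_comp_map σ t i (f ≫ g) v)).trans (Category.assoc _ _ _)
    _ = ((arrIso (i c)).hom.app ((act (F.map (f ≫ g))).obj v) ≫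
          (act (σ.app c)).map ((compArr F f g).hom.app v)) ≫
        (natArr σ g ((act (F.map f)).obj v)).hom ≫ (act (G.map g)).map (natArr σ f v).hom :=
      (congrArg (_ ≫ ·) (natArr_comp σ f g v)).trans (Category.assoc _ _ _).symm
    _ = _ := (congrArg (· ≫ _) hF.symm).trans (Category.assoc _ _ _)

/-- The transport of a pseudonatural transformation along isomorphisms of its components. -/
def transportTrans : F ⟶ G :=
  transOfArr t (transportNat σ t i) (transportNatArr_map₂ σ t i) (transportNatArr_id σ t i)
    (transportNatArr_comp σ t i)

/-- The transport is isomorphic to the given transformation. -/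
def transportTransIso : transportTrans σ t i ≅ σ :=
  Pseudofunctor.StrongTrans.isoMk i fun f => by
    change F.map f ◁ (i _).hom ≫ (σ.naturality f).hom =
      (F.map f ◁ (i _).hom ≫ (σ.naturality f).hom ≫ (i _).inv ▷ G.map f) ≫ (i _).hom ▷ G.map f
    simp

end Transport

section Lifting

variable {A : Type u} [Bicategory.{u, u} A] {Y Y' : StrictPseudofunctor A TwoCatTwoI.{u}}

lemma inclObj_mapId (Y : StrictPseudofunctor A TwoCatTwoI.{u}) (a : A) :
    ((inclObj Y).mapId a).hom = (Y.mapId a).hom.cell := Category.comp_id _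

lemma inclObj_mapComp (Y : StrictPseudofunctor A TwoCatTwoI.{u}) {a b c : A} (f : a ⟶ b)
    (g : b ⟶ c) : ((inclObj Y).mapComp f g).hom = (Y.mapComp f g).hom.cell := Category.comp_id _

/-- A pseudonatural transformation whose components are 2-functors, as a transformation of functors
to `2Cat_{2,i}`. -/
def restrictTrans (T : inclObj Y ⟶ inclObj Y') (hT : ∀ a, IsTwoFunctor (T.app a).fn) :
    Y.toPseudofunctor ⟶ Y'.toPseudofunctor where
  app a := ⟨T.app a, hT a⟩
  naturality f := LocallyFull.isoMk (T.naturality f)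
  naturality_naturality η := LocallyFull.hom₂_ext (T.naturality_naturality η)
  naturality_id a := LocallyFull.hom₂_ext (by
    have h := T.naturality_id a
    rw [inclObj_mapId, inclObj_mapId] at h
    exact h)
  naturality_comp f g := LocallyFull.hom₂_ext (by
    have h := T.naturality_comp f g
    rw [inclObj_mapComp, inclObj_mapComp] at h
    exact h)

lemma postcompTrans_naturality (α : Y.toPseudofunctor ⟶ Y'.toPseudofunctor) {a b : A}
    (f : a ⟶ b) :
    ((postcompTrans (LocallyFull.inclusion twoFunctors.{u}).toPseudofunctor α).naturality f).hom =
      (α.naturality f).hom.cell :=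
  (Category.id_comp _).trans (Category.comp_id _)

lemma postcompTrans_restrictTrans (T : inclObj Y ⟶ inclObj Y')
    (hT : ∀ a, IsTwoFunctor (T.app a).fn) :
    postcompTrans (LocallyFull.inclusion twoFunctors.{u}).toPseudofunctor
      (restrictTrans T hT) = T := by
  refine eq_of_modification (⟨{ app a := 𝟙 (T.app a), naturality f := ?_ }⟩) (fun a => rfl)
    (fun a => rfl)
  refine Eq.trans ?_ (congrArg (· ≫ _) (postcompTrans_naturality (restrictTrans T hT) f).symm)
  change _ ◁ 𝟙 _ ≫ (T.naturality f).hom = (T.naturality f).hom ≫ 𝟙 _ ▷ _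
  simp

/-- Modifications between the underlying transformations are modifications. -/
def restrictModification {α β : Y.toPseudofunctor ⟶ Y'.toPseudofunctor}
    (Γ : postcompTrans (LocallyFull.inclusion twoFunctors.{u}).toPseudofunctor α ⟶
      postcompTrans (LocallyFull.inclusion twoFunctors.{u}).toPseudofunctor β) : α ⟶ β :=
  ⟨{ app a := ⟨Γ.as.app a⟩
     naturality f := LocallyFull.hom₂_ext (by
      have h := Γ.as.naturality f
      rw [postcompTrans_naturality, postcompTrans_naturality] at h
      exact h) }⟩

end Lifting

section Inclusion

variable {A : Type u} [Bicategory.{u, u} A] {Y Y' : TwoFunctorCat A TwoCatTwoI.{u}}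

lemma inclusionJ_map₂_bijective (τ τ' : Y ⟶ Y') :
    Function.Bijective ((inclusionJ A).map₂ : (τ ⟶ τ') → _) := by
  refine ⟨fun Γ Γ' h => ?_, fun Γ => ⟨⟨restrictModification Γ⟩, ?_⟩⟩
  · refine LocallyFull.hom₂_ext (Pseudofunctor.StrongTrans.homCategory.ext fun a => ?_)
    exact LocallyFull.hom₂_ext (congrArg (fun Γ => Γ.as.app a) h)
  · rfl

end Inclusion

section Extension

/-- All 1-cells of a bicategory, as generators. -/
def allCells (C : Type u₁) [Bicategory.{w₁, v₁} C] : Generators.{w₁, v₁, v₁} C where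
  Gen x y := x ⟶ y
  ev f := f

variable {A : Type u} [Bicategory.{u, u} A] {X : A ⥤ᵖ TwoCatPI.{u}}
  {Y : StrictPseudofunctor A TwoCatTwoI.{u}} (σ : X ⟶ inclObj Y)

lemma natural_obj {a b : A} (f : a ⟶ b) (x : (X.obj a).carrier) :
    (σ.app b).fn.obj ((X.map f).fn.obj x) = ((inclObj Y).map f).fn.obj ((σ.app a).fn.obj x) :=
  (σ.naturality f).hom.icon.obj_eq x

/-- The value `(Y f)(σ v)` of the extension of `σ` at the formal 1-cell `f(v)`. -/
def extGen {a : A} {x y : (X.obj a).carrier} (e : (formalCells X a).Gen x y) :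
    (allCells ((inclObj Y).obj a).carrier).Gen ((σ.app a).fn.obj x) ((σ.app a).fn.obj y) :=
  (homCast ((congrArg (σ.app a).fn.obj e.src_eq).trans (natural_obj σ e.f e.v.src))
    ((congrArg (σ.app a).fn.obj e.tgt_eq).trans (natural_obj σ e.f e.v.tgt))).obj
    (((inclObj Y).map e.f).fn.map ((σ.app e.b).fn.map e.v.hom))

lemma of_extGen {a : A} {x y : (X.obj a).carrier} (e : (formalCells X a).Gen x y) :
    Arr.of ((allCells ((inclObj Y).obj a).carrier).ev (extGen σ e)) =
      (act ((inclObj Y).map e.f)).obj ((act (σ.app e.b)).obj e.v) :=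
  Arr.of_homCast _ _ _

/-- The comparison of `σ` at the value of a formal 1-cell with `extGen`. -/
def extGenIso {a : A} {x y : (X.obj a).carrier} (e : (formalCells X a).Gen x y) :
    (σ.app a).fn.map ((formalCells X a).ev e) ≅
      (allCells ((inclObj Y).obj a).carrier).ev (extGen σ e) :=
  Arr.toIso (eqToIso (congrArg (act (σ.app a)).obj (of_ev X e)) ≪≫ natArr σ e.f e.v ≪≫
    eqToIso (of_extGen σ e).symm)

/-- The components of the extension of `σ` along the unit. -/
def extHom (a : A) : strictObj X a ⟶ (inclObj Y).obj a :=
  ⟨(fullMap (σ.app a).fn (extGen σ) (extGenIso σ)).comp (Full.proj (allCells _))⟩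

lemma extHom_isTwoFunctor (a : A) : IsTwoFunctor (extHom σ a).fn :=
  (fullMap_isTwoFunctor _ _ _).comp Full.proj_isTwoFunctor

/-- The comparison of the extension of `σ` with the evaluation followed by `σ`. -/
def extIso (a : A) : extHom σ a ≅ evalHom X a ≫ σ.app a where
  hom := ⟨fullMapIcon (σ.app a).fn (extGen σ) (extGenIso σ)⟩
  inv := ⟨fullMapIconInv (σ.app a).fn (extGen σ) (extGenIso σ)⟩
  hom_inv_id := hom₂_ext_arr fun p =>
    (Arr.ofIso (Word.mapEval (σ.app a).fn (extGen σ) (extGenIso σ) p.hom)).inv_hom_id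
  inv_hom_id := hom₂_ext_arr fun p =>
    (Arr.ofIso (Word.mapEval (σ.app a).fn (extGen σ) (extGenIso σ) p.hom)).hom_inv_id

/-- The isomorphism `extIso`, evaluated at an arrow. -/
def extArr (a : A) (p : Arr (strictObj X a).carrier) :
    (act (extHom σ a)).obj p ≅ (act (σ.app a)).obj ((act (evalHom X a)).obj p) :=
  (arrIso (extIso σ a)).app p

lemma extArr_congr {a : A} {p q : Arr (strictObj X a).carrier} (h : p = q) :
    EqUpTo (extArr σ a p).hom (extArr σ a q).hom :=
  .app (arr (extIso σ a).hom) h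

lemma extArr_gen_inv {a b : A} (f : b ⟶ a) (v : Arr (X.obj b).carrier) :
    EqUpTo (extArr σ a (gen X f v)).inv (natArr σ f v).hom := by
  let e : (formalCells X a).Gen _ _ := ⟨f, v, rfl, rfl⟩
  exact (fullMapIconInv_arr_gen (σ.app a).fn (extGen σ) (extGenIso σ) e).trans
    (EqUpTo.eqToHom_conj (congrArg (act (σ.app a)).obj (of_ev X e)) (natArr σ f v).hom
      (of_extGen σ e).symm)

lemma extArr_gen {a b : A} (f : b ⟶ a) (v : Arr (X.obj b).carrier) :
    EqUpTo (extArr σ a (gen X f v)).hom (natArr σ f v).inv :=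
  (extArr_gen_inv σ f v).inv (m := (extArr σ a (gen X f v)).symm)

variable [Strict A]

/-- The extension of `σ` along the unit, as a pseudonatural transformation. -/
def extTrans : inclObj (strictification X) ⟶ inclObj Y :=
  transportTrans (evalTrans X ≫ σ) (extHom σ) (extIso σ)

lemma natArr_evalTrans_comp {a b : A} (f : a ⟶ b) (p : Arr (strictObj X a).carrier) :
    (natArr (evalTrans X ≫ σ) f p).hom =
      (act (σ.app b)).map ((evalArr X f).hom.app p) ≫
        (natArr σ f ((act (evalHom X a)).obj p)).hom := by
  change 𝟙 _ ≫ (act (σ.app b)).map ((evalArr X f).hom.app p) ≫ 𝟙 _ ≫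
    (natArr σ f ((act (evalHom X a)).obj p)).hom ≫ 𝟙 _ = _
  rw [Category.id_comp, Category.id_comp, Category.comp_id]

lemma natArr_extTrans {a b : A} (f : a ⟶ b) (p : Arr (strictObj X a).carrier) :
    (natArr (extTrans σ) f p).hom = (extArr σ b ((act (strictMap X f)).obj p)).hom ≫
      ((act (σ.app b)).map ((evalArr X f).hom.app p) ≫
        (natArr σ f ((act (evalHom X a)).obj p)).hom) ≫
          (act ((inclObj Y).map f)).map (extArr σ a p).inv :=
  (transportNatArr_hom (evalTrans X ≫ σ) (extHom σ) (extIso σ) f p).trans <|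
    congrArg (fun k => (extArr σ b ((act (strictMap X f)).obj p)).hom ≫ k ≫
      (act ((inclObj Y).map f)).map (extArr σ a p).inv) (natArr_evalTrans_comp σ f p)

lemma natArr_extTrans_gen {a b c : A} (f : a ⟶ b) (g : b ⟶ c) (v : Arr (X.obj a).carrier) :
    IsEqToHom (natArr (extTrans σ) g (gen X f v)).hom := by
  have hext : EqUpTo (extArr σ c ((act (strictMap X g)).obj (gen X f v))).hom
      (natArr σ (f ≫ g) v).inv :=
    (extArr_congr σ (strictMap_gen X f g v)).trans (extArr_gen σ (f ≫ g) v)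
  have heval := (evalArr_gen X f g v).map (act (σ.app c))
  have hnat := natArr_congr σ g (evalHom_gen X f v)
  have hinv := (extArr_gen_inv σ f v).map (act ((inclObj Y).map g))
  have h : EqUpTo (natArr (extTrans σ) g (gen X f v)).hom
      ((compArr (inclObj Y) f g).hom.app ((act (σ.app a)).obj v)) := by
    rw [natArr_extTrans]
    refine (hext.comp ((heval.comp hnat).comp hinv)).trans (.of_eq ?_)
    rw [Category.assoc, ← natArr_comp, Iso.inv_hom_id_assoc]
  exact h.isEqToHom (isEqToHom_compArr Y f g _)

lemma isEqToHom_naturality_of_gen {T : inclObj (strictification X) ⟶ inclObj Y}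
    (hT : ∀ a, IsTwoFunctor (T.app a).fn)
    (h : ∀ {a b c : A} (f : a ⟶ b) (g : b ⟶ c) (v : Arr (X.obj a).carrier),
      IsEqToHom (natArr T g (gen X f v)).hom) {a b : A} (f : a ⟶ b) :
    IsEqToHom (T.naturality f).hom :=
  isEqToHom_of_arr fun p => strictObj_isEqToHom_arr X
    (F := strictMap X f ≫ T.app b) (G := T.app a ≫ (inclObj Y).map f)
    ((strictMap_isTwoFunctor X f).comp (hT b)) ((hT a).comp (Y.map f).property) _
    (fun g v => h g f v) p

lemma isEqToHom_extTrans_naturality {a b : A} (f : a ⟶ b) :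
    IsEqToHom ((extTrans σ).naturality f).hom :=
  isEqToHom_naturality_of_gen (T := extTrans σ) (extHom_isTwoFunctor σ) (natArr_extTrans_gen σ) f

/-- The comparison of `σ` with the unit followed by the extension of `σ`. -/
def unitExtIso : unitTrans X ≫ extTrans σ ≅ σ :=
  whiskerLeftIso (unitTrans X) (transportTransIso (evalTrans X ≫ σ) (extHom σ) (extIso σ)) ≪≫
    (α_ _ _ _).symm ≪≫ whiskerRightIso (evalInverse X).transComp σ ≪≫ λ_ σ

lemma arr_unitExtIso {a : A} (v : Arr (X.obj a).carrier) :
    (arr ((unitExtIso σ).hom.as.app a)).app v =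
      (extArr σ a ((act (unitHom X a)).obj v)).hom ≫
        (act (σ.app a)).map (unitEvalArr X a v).hom := by
  change (extArr σ a ((act (unitHom X a)).obj v)).hom ≫ 𝟙 _ ≫
    (act (σ.app a)).map (unitEvalArr X a v).hom ≫ 𝟙 _ = _
  rw [Category.id_comp, Category.comp_id]

lemma isEqToHom_unitExtIso (a : A) : IsEqToHom ((unitExtIso σ).hom.as.app a) := by
  refine isEqToHom_of_arr fun v => ?_
  have hext := (extArr_congr σ (unitHom_obj X v)).trans (extArr_gen σ (𝟙 a) v)
  have heval := (unitEvalArr_eqUpTo X v).map (act (σ.app a))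
  have h : EqUpTo ((arr ((unitExtIso σ).hom.as.app a)).app v)
      ((idArr (inclObj Y) a).hom.app ((act (σ.app a)).obj v)) := by
    rw [arr_unitExtIso]
    refine (hext.comp heval).trans (.of_eq ?_)
    rw [← natArr_id, Iso.inv_hom_id_assoc]
  exact h.isEqToHom (isEqToHom_idArr Y a _)

lemma unitTrans_comp_extTrans : unitTrans X ≫ extTrans σ = σ :=
  eq_of_modification (unitExtIso σ).hom (fun a => (isEqToHom_unitExtIso σ a).choose)
    (fun a => (isEqToHom_unitExtIso σ a).choose_spec)

end Extension

section Equivalence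

variable {B : Type u₁} [Bicategory.{w₁, v₁} B] {a b c : B}

lemma whiskerLeft_whiskerLeft {f : a ⟶ b} {g : b ⟶ a} (i : g ≫ f ≅ 𝟙 b) {h k : b ⟶ c}
    (α : h ⟶ k) :
    g ◁ f ◁ α = (α_ g f h).inv ≫ i.hom ▷ h ≫ (λ_ h).hom ≫ α ≫ (λ_ k).inv ≫ i.inv ▷ k ≫
      (α_ g f k).hom := by
  have hα : i.hom ▷ h ≫ (λ_ h).hom ≫ α = (g ≫ f) ◁ α ≫ i.hom ▷ k ≫ (λ_ k).hom := by
    rw [← leftUnitor_naturality, whisker_exchange_assoc]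
  rw [reassoc_of% hα]
  simp

lemma whiskerLeft_injective_of_section {f : a ⟶ b} {g : b ⟶ a} (i : g ≫ f ≅ 𝟙 b)
    {h k : b ⟶ c} : Function.Injective (fun α : h ⟶ k => f ◁ α) := fun α β e => by
  have hg : g ◁ f ◁ α = g ◁ f ◁ β := congrArg (g ◁ ·) e
  rw [whiskerLeft_whiskerLeft i, whiskerLeft_whiskerLeft i] at hg
  simpa only [cancel_epi, cancel_mono, ← Category.assoc] using hg

lemma IsInternalEquivalence.whiskerLeft_bijective {f : a ⟶ b} (hf : IsInternalEquivalence f)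
    (h k : b ⟶ c) : Function.Bijective (fun α : h ⟶ k => f ◁ α) := by
  obtain ⟨g, ⟨j⟩, ⟨i⟩⟩ := hf
  refine ⟨whiskerLeft_injective_of_section i, fun Γ => ⟨(λ_ h).inv ≫ i.inv ▷ h ≫
    (α_ g f h).hom ≫ g ◁ Γ ≫ (α_ g f k).inv ≫ i.hom ▷ k ≫ (λ_ k).hom,
    whiskerLeft_injective_of_section j ?_⟩⟩
  dsimp only
  rw [whiskerLeft_whiskerLeft i]
  simp

lemma IsInternalEquivalence.of_comp_eq_id {f : a ⟶ b} {g : b ⟶ a}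
    (hf : IsInternalEquivalence f) (h : f ≫ g = 𝟙 a) : IsInternalEquivalence g := by
  obtain ⟨f', -, ⟨j⟩⟩ := hf
  have e : g ≅ f' := (λ_ g).symm ≪≫ whiskerRightIso j.symm g ≪≫ α_ _ _ _ ≪≫
    whiskerLeftIso f' (eqToIso h) ≪≫ ρ_ f'
  exact ⟨f, ⟨whiskerRightIso e f ≪≫ j⟩, ⟨eqToIso h⟩⟩

end Equivalence

section UniversalProperty

lemma isEqToHom_of_cell {B : Type u₁} [Bicategory.{w₁, v₁} B] {C : Type u₂} {φ : C → B}
    {P : OneCellClass φ} {x y : LocallyFull P} {f g : x ⟶ y} {α : f ⟶ g}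
    (h : IsEqToHom α.cell) : IsEqToHom α := by
  obtain ⟨e, h⟩ := h
  obtain rfl : f = g := LocallyFull.hom_ext e
  exact ⟨rfl, LocallyFull.hom₂_ext h⟩

lemma isEqToHom_as_app {A : Type u₁} [Bicategory.{w₁, v₁} A] {K : Type u₂}
    [Bicategory.{w₂, v₂} K] {F G : A ⥤ᵖ K} {α β : F ⟶ G} {Γ : α ⟶ β} (h : IsEqToHom Γ) (a : A) :
    IsEqToHom (Γ.as.app a) := by
  obtain ⟨rfl, rfl⟩ := h
  exact .id _

variable {A : Type u} [Bicategory.{u, u} A] [Strict A] (X : A ⥤ᵖ TwoCatPI.{u})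

/-- The strictification, as an object of `[A, 2Cat_{2,i}]`. -/
def strict : TwoFunctorCat A TwoCatTwoI.{u} := ⟨strictification X⟩

/-- The unit of the strictification, as a 1-cell to the image of `inclusionJ`. -/
def unit : X ⟶ (inclusionJ A).obj (strict X) := unitTrans X

variable {X} {Y : TwoFunctorCat A TwoCatTwoI.{u}}

/-- The extension of a pseudonatural transformation along the unit. -/
def extend (σ : X ⟶ (inclusionJ A).obj Y) : strict X ⟶ Y where
  cell := restrictTrans (Y := strictification X) (Y' := Y.obj) (extTrans (Y := Y.obj) σ)
    (extHom_isTwoFunctor (Y := Y.obj) σ)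
  property a b f := by
    obtain ⟨h, e⟩ : IsEqToHom ((restrictTrans (Y := strictification X) (Y' := Y.obj)
        (extTrans (Y := Y.obj) σ) (extHom_isTwoFunctor (Y := Y.obj) σ)).naturality f).hom :=
      isEqToHom_of_cell (isEqToHom_extTrans_naturality (Y := Y.obj) σ f)
    exact ⟨h, Iso.ext e⟩

lemma unit_comp_extend (σ : X ⟶ (inclusionJ A).obj Y) :
    unit X ≫ (inclusionJ A).map (extend σ) = σ :=
  (congrArg (unitTrans X ≫ ·) (postcompTrans_restrictTrans (Y := strictification X) (Y' := Y.obj)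
    (extTrans (Y := Y.obj) σ) (extHom_isTwoFunctor (Y := Y.obj) σ))).trans
    (unitTrans_comp_extTrans (Y := Y.obj) σ)

lemma unit_isInternalEquivalence : IsInternalEquivalence (unit X) :=
  unitTrans_isInternalEquivalence X

lemma unit_whiskerLeft_bijective (τ τ' : strict X ⟶ Y) :
    Function.Bijective (fun Γ : τ ⟶ τ' => unit X ◁ (inclusionJ A).map₂ Γ) :=
  (unit_isInternalEquivalence.whiskerLeft_bijective _ _).comp (inclusionJ_map₂_bijective τ τ')

lemma isEqToHom_arr_naturality (τ : strict X ⟶ Y) {a b : A} (f : b ⟶ a)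
    (p : Arr (strictObj X b).carrier) :
    IsEqToHom ((arr (τ.cell.naturality f).hom.cell).app p) := by
  obtain ⟨h, h'⟩ := τ.property f
  exact isEqToHom_arr (isEqToHom_cell ⟨h, congrArg Iso.hom h'⟩) p

lemma gen_eq_strictMap {a b : A} (f : b ⟶ a) (v : Arr (X.obj b).carrier) :
    gen X f v = (act (strictMap X f)).obj ((act (unitHom X b)).obj v) := by
  rw [unitHom_obj, strictMap_gen, Strict.id_comp]

lemma arr_modification_gen {τ τ' : strict X ⟶ Y} (Γ : τ ⟶ τ')
    (h : IsEqToHom (unit X ◁ (inclusionJ A).map₂ Γ)) {a b : A} (f : b ⟶ a)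
    (v : Arr (X.obj b).carrier) :
    IsEqToHom ((arr (Γ.cell.as.app a).cell).app (gen X f v)) := by
  let p : Arr (strictObj X b).carrier := (act (unitHom X b)).obj v
  have hΓ : IsEqToHom ((arr (Γ.cell.as.app b).cell).app p) :=
    isEqToHom_arr (isEqToHom_as_app h b) v
  have nat : strictMap X f ◁ (Γ.cell.as.app a).cell ≫ (τ'.cell.naturality f).hom.cell =
      (τ.cell.naturality f).hom.cell ≫ (Γ.cell.as.app b).cell ▷ (Y.obj.map f).cell :=
    congrArg LocallyFull.Hom₂.cell (Γ.cell.as.naturality f)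
  rw [gen_eq_strictMap]
  refine IsEqToHom.of_comp ?_ (isEqToHom_arr_naturality τ' f p)
  exact (congrArg (fun α => IsEqToHom ((arr α).app p)) nat).mpr
    ((isEqToHom_arr_naturality τ f p).comp (hΓ.map (act (Y.obj.map f).cell)))

lemma extend_unique {τ τ' : strict X ⟶ Y}
    (h : unit X ≫ (inclusionJ A).map τ = unit X ≫ (inclusionJ A).map τ') : τ = τ' := by
  obtain ⟨Γ, hΓ⟩ := (unit_whiskerLeft_bijective τ τ').2 (eqToHom h)
  have e (a : A) : IsEqToHom (Γ.cell.as.app a) :=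
    isEqToHom_of_cell (isEqToHom_of_arr fun p => strictObj_isEqToHom_arr X
      (τ.cell.app a).property (τ'.cell.app a).property _
      (fun f v => arr_modification_gen Γ ⟨h, hΓ⟩ f v) p)
  exact LocallyFull.hom_ext (eq_of_modification Γ.cell (fun a => (e a).choose)
    (fun a => (e a).choose_spec))

end UniversalProperty

section UniversalArrows

variable {B : Type u₁} [Bicategory.{w₁, v₁} B] {C : Type u₂} [Bicategory.{w₂, v₂} C]

namespace EqUpTo

lemma whiskerLeft {a b c : B} (f : a ⟶ b) {g h g' h' : b ⟶ c} {α : g ⟶ h} {β : g' ⟶ h'}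
    (e : EqUpTo α β) : EqUpTo (f ◁ α) (f ◁ β) := by
  obtain ⟨rfl, rfl, rfl⟩ := e
  exact .of_eq (by simp)

lemma whiskerRight {a b c : B} {g h g' h' : a ⟶ b} {α : g ⟶ h} {β : g' ⟶ h'}
    (e : EqUpTo α β) (f : b ⟶ c) : EqUpTo (α ▷ f) (β ▷ f) := by
  obtain ⟨rfl, rfl, rfl⟩ := e
  exact .of_eq (by simp)

lemma whiskerLeft_congr {a b c : B} {f f' : a ⟶ b} (e : f = f') {g h : b ⟶ c} (α : g ⟶ h) :
    EqUpTo (f ◁ α) (f' ◁ α) := by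
  subst e; exact .refl _

lemma whiskerRight_congr {a b c : B} {f f' : b ⟶ c} (e : f = f') {g h : a ⟶ b} (α : g ⟶ h) :
    EqUpTo (α ▷ f) (α ▷ f') := by
  subst e; exact .refl _

section Strict

variable [Strict B]

lemma id_whiskerLeft {a b : B} {g h : a ⟶ b} (α : g ⟶ h) : EqUpTo (𝟙 a ◁ α) α := by
  refine ⟨Strict.id_comp g, Strict.id_comp h, ?_⟩
  rw [Bicategory.id_whiskerLeft, Strict.leftUnitor_eqToIso, Strict.leftUnitor_eqToIso]
  rfl

lemma whiskerRight_id {a b : B} {g h : a ⟶ b} (α : g ⟶ h) : EqUpTo (α ▷ 𝟙 b) α := by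
  refine ⟨Strict.comp_id g, Strict.comp_id h, ?_⟩
  rw [Bicategory.whiskerRight_id, Strict.rightUnitor_eqToIso, Strict.rightUnitor_eqToIso]
  rfl

lemma comp_whiskerLeft {a b c d : B} (f : a ⟶ b) (f' : b ⟶ c) {g h : c ⟶ d} (α : g ⟶ h) :
    EqUpTo ((f ≫ f') ◁ α) (f ◁ f' ◁ α) := by
  refine ⟨Strict.assoc _ _ _, Strict.assoc _ _ _, ?_⟩
  rw [Bicategory.comp_whiskerLeft, Strict.associator_eqToIso, Strict.associator_eqToIso]
  rfl

lemma whiskerRight_comp {a b c d : B} {g h : a ⟶ b} (α : g ⟶ h) (f : b ⟶ c) (f' : c ⟶ d) :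
    EqUpTo (α ▷ (f ≫ f')) (α ▷ f ▷ f') := by
  refine ⟨(Strict.assoc _ _ _).symm, (Strict.assoc _ _ _).symm, ?_⟩
  rw [Bicategory.whiskerRight_comp, Strict.associator_eqToIso, Strict.associator_eqToIso]
  rfl

lemma whisker_assoc {a b c d : B} (f : a ⟶ b) {g h : b ⟶ c} (α : g ⟶ h) (k : c ⟶ d) :
    EqUpTo ((f ◁ α) ▷ k) (f ◁ α ▷ k) := by
  refine ⟨Strict.assoc _ _ _, Strict.assoc _ _ _, ?_⟩
  rw [Bicategory.whisker_assoc, Strict.associator_eqToIso, Strict.associator_eqToIso]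
  rfl

end Strict

lemma map₂_whiskerLeft (R : StrictPseudofunctor C B) {a b c : C} (f : a ⟶ b) {g h : b ⟶ c}
    (α : g ⟶ h) : EqUpTo (R.map₂ (f ◁ α)) (R.map f ◁ R.map₂ α) := by
  refine ⟨R.map_comp _ _, R.map_comp _ _, ?_⟩
  rw [R.map₂_whisker_left, R.mapComp_eq_eqToIso, R.mapComp_eq_eqToIso]
  rfl

lemma map₂_whiskerRight (R : StrictPseudofunctor C B) {a b c : C} {g h : a ⟶ b}
    (α : g ⟶ h) (f : b ⟶ c) : EqUpTo (R.map₂ (α ▷ f)) (R.map₂ α ▷ R.map f) := by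
  refine ⟨R.map_comp _ _, R.map_comp _ _, ?_⟩
  rw [R.map₂_whisker_right, R.mapComp_eq_eqToIso, R.mapComp_eq_eqToIso]
  rfl

end EqUpTo

/-- A choice of a 2-dimensional universal arrow from each object of `B` to a 2-functor `R`:
`hom_ext` and `whiskerLeft_bijective` are uniqueness on 1-cells and the universal property on
2-cells. -/
structure UniversalArrows (R : StrictPseudofunctor C B) where
  obj : B → C
  unit (b : B) : b ⟶ R.obj (obj b)
  desc {b : B} {c : C} (f : b ⟶ R.obj c) : obj b ⟶ c
  fac {b : B} {c : C} (f : b ⟶ R.obj c) : unit b ≫ R.map (desc f) = f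
  hom_ext {b : B} {c : C} {g h : obj b ⟶ c} : unit b ≫ R.map g = unit b ≫ R.map h → g = h
  whiskerLeft_bijective {b : B} {c : C} (g h : obj b ⟶ c) :
    Function.Bijective (fun α : g ⟶ h => unit b ◁ R.map₂ α)

namespace UniversalArrows

variable {R : StrictPseudofunctor C B} (U : UniversalArrows R)

lemma hom₂_ext {b : B} {c : C} {g h : U.obj b ⟶ c} {α β : g ⟶ h}
    (e : EqUpTo (U.unit b ◁ R.map₂ α) (U.unit b ◁ R.map₂ β)) : α = β :=
  (U.whiskerLeft_bijective g h).1 e.eq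

lemma eqUpTo_of_unit {b : B} {c : C} {g h g' h' : U.obj b ⟶ c} {α : g ⟶ h} {β : g' ⟶ h'}
    (e : EqUpTo (U.unit b ◁ R.map₂ α) (U.unit b ◁ R.map₂ β)) : EqUpTo α β := by
  obtain rfl : g = g' := U.hom_ext e.choose
  obtain rfl : h = h' := U.hom_ext e.choose_spec.choose
  exact .of_eq (U.hom₂_ext e)

/-- The 2-cell `desc g ⟶ desc h` that `α` induces by the universal property on 2-cells. -/
noncomputable def desc₂ {b : B} {c : C} {g h : b ⟶ R.obj c} (α : g ⟶ h) : U.desc g ⟶ U.desc h :=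
  ((U.whiskerLeft_bijective (U.desc g) (U.desc h)).2
    (eqToHom (U.fac g) ≫ α ≫ eqToHom (U.fac h).symm)).choose

lemma fac₂ {b : B} {c : C} {g h : b ⟶ R.obj c} (α : g ⟶ h) :
    EqUpTo (U.unit b ◁ R.map₂ (U.desc₂ α)) α :=
  ⟨U.fac g, U.fac h, ((U.whiskerLeft_bijective (U.desc g) (U.desc h)).2
    (eqToHom (U.fac g) ≫ α ≫ eqToHom (U.fac h).symm)).choose_spec⟩

/-- The action of the left 2-adjoint on 1-cells. -/
def map {a b : B} (f : a ⟶ b) : U.obj a ⟶ U.obj b := U.desc (f ≫ U.unit b)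

lemma unit_map {a b : B} (f : a ⟶ b) : U.unit a ≫ R.map (U.map f) = f ≫ U.unit b := U.fac _

/-- The action of the left 2-adjoint on 2-cells. -/
noncomputable def map₂ {a b : B} {f g : a ⟶ b} (α : f ⟶ g) : U.map f ⟶ U.map g :=
  U.desc₂ (α ▷ U.unit b)

lemma unit_map₂ {a b : B} {f g : a ⟶ b} (α : f ⟶ g) :
    EqUpTo (U.unit a ◁ R.map₂ (U.map₂ α)) (α ▷ U.unit b) := U.fac₂ _

lemma map₂_id {a b : B} (f : a ⟶ b) : U.map₂ (𝟙 f) = 𝟙 _ :=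
  U.hom₂_ext ((U.unit_map₂ _).trans (by
    simp only [id_whiskerRight, R.map₂_id, whiskerLeft_id]
    exact .of_isEqToHom (.id _) (.id _) (U.unit_map f).symm))

lemma map₂_comp {a b : B} {f g h : a ⟶ b} (α : f ⟶ g) (β : g ⟶ h) :
    U.map₂ (α ≫ β) = U.map₂ α ≫ U.map₂ β :=
  U.hom₂_ext ((U.unit_map₂ _).trans (by
    simp only [comp_whiskerRight, R.map₂_comp, whiskerLeft_comp]
    exact (U.unit_map₂ α).symm.comp (U.unit_map₂ β).symm))

/-- The components of the counit. -/
def counit (c : C) : U.obj (R.obj c) ⟶ c := U.desc (𝟙 (R.obj c))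

lemma unit_counit (c : C) : U.unit (R.obj c) ≫ R.map (U.counit c) = 𝟙 (R.obj c) := U.fac _

variable [Strict B]

lemma map_id (a : B) : U.map (𝟙 a) = 𝟙 (U.obj a) :=
  U.hom_ext (by rw [U.unit_map, R.map_id, Strict.id_comp, Strict.comp_id])

lemma map_comp {a b c : B} (f : a ⟶ b) (g : b ⟶ c) : U.map (f ≫ g) = U.map f ≫ U.map g :=
  U.hom_ext (by
    rw [U.unit_map, R.map_comp, ← Strict.assoc (U.unit a), U.unit_map, Strict.assoc f (U.unit b),
      U.unit_map, Strict.assoc])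

lemma map₂_whiskerLeft {a b c : B} (f : a ⟶ b) {g h : b ⟶ c} (α : g ⟶ h) :
    EqUpTo (U.map₂ (f ◁ α)) (U.map f ◁ U.map₂ α) :=
  U.eqUpTo_of_unit <| (U.unit_map₂ _).trans <| (EqUpTo.whisker_assoc _ _ _).trans <|
    ((U.unit_map₂ α).symm.whiskerLeft f).trans <| (EqUpTo.comp_whiskerLeft _ _ _).symm.trans <|
    (EqUpTo.whiskerLeft_congr (U.unit_map f).symm _).trans <|
    (EqUpTo.comp_whiskerLeft _ _ _).trans <|
    ((EqUpTo.map₂_whiskerLeft R _ _).whiskerLeft _).symm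

lemma map₂_whiskerRight {a b c : B} {f g : a ⟶ b} (α : f ⟶ g) (h : b ⟶ c) :
    EqUpTo (U.map₂ (α ▷ h)) (U.map₂ α ▷ U.map h) :=
  U.eqUpTo_of_unit <| (U.unit_map₂ _).trans <| (EqUpTo.whiskerRight_comp _ _ _).symm.trans <|
    (EqUpTo.whiskerRight_congr (U.unit_map h).symm _).trans <|
    (EqUpTo.whiskerRight_comp _ _ _).trans <| ((U.unit_map₂ α).symm.whiskerRight _).trans <|
    (EqUpTo.whisker_assoc _ _ _).trans <| ((EqUpTo.map₂_whiskerRight R _ _).whiskerLeft _).symm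

lemma map_unit_counit (b : B) : U.map (U.unit b) ≫ U.counit (U.obj b) = 𝟙 (U.obj b) :=
  U.hom_ext (by
    rw [R.map_comp, ← Strict.assoc, U.unit_map, Strict.assoc, U.unit_counit, R.map_id])

lemma counit_naturality {c c' : C} (f : c ⟶ c') :
    U.map (R.map f) ≫ U.counit c' = U.counit c ≫ f :=
  U.hom_ext (by
    rw [R.map_comp, R.map_comp, ← Strict.assoc, ← Strict.assoc, U.unit_map, U.unit_counit,
      Strict.assoc, U.unit_counit, Strict.comp_id, Strict.id_comp])

lemma counit_naturality₂ {c c' : C} {f g : c ⟶ c'} (α : f ⟶ g) :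
    EqUpTo (U.map₂ (R.map₂ α) ▷ U.counit c') (U.counit c ◁ α) :=
  U.eqUpTo_of_unit <| ((EqUpTo.map₂_whiskerRight R _ _).whiskerLeft _).trans <|
    (EqUpTo.whisker_assoc _ _ _).symm.trans <| ((U.unit_map₂ _).whiskerRight _).trans <|
    (EqUpTo.whiskerRight_comp _ _ _).symm.trans <|
    (EqUpTo.whiskerRight_congr (U.unit_counit c') _).trans <|
    (EqUpTo.whiskerRight_id _).trans <| (EqUpTo.id_whiskerLeft _).symm.trans <|
    (EqUpTo.whiskerLeft_congr (U.unit_counit c).symm _).trans <|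
    (EqUpTo.comp_whiskerLeft _ _ _).trans <|
    ((EqUpTo.map₂_whiskerLeft R _ _).whiskerLeft _).symm

variable [Strict C]

/-- The left 2-adjoint determined by universal arrows. -/
noncomputable def left : StrictPseudofunctor B C :=
  StrictPseudofunctor.mk''
    { obj := U.obj
      map := U.map
      map₂ := U.map₂
      map₂_id := U.map₂_id
      map₂_comp := U.map₂_comp
      map_id := U.map_id
      map_comp := U.map_comp
      map₂_whisker_left f _ _ α := (U.map₂_whiskerLeft f α).choose_spec.choose_spec
      map₂_whisker_right α f := (U.map₂_whiskerRight α f).choose_spec.choose_spec }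

/-- The 2-adjunction determined by universal arrows. -/
noncomputable def adjunction : TwoAdjunction U.left R where
  unit :=
    { app := U.unit
      naturality f := (U.unit_map f).symm
      naturality₂ α := (U.unit_map₂ α).symm.comp_eqToHom _ _ }
  counit :=
    { app := U.counit
      naturality f := U.counit_naturality f
      naturality₂ α := (U.counit_naturality₂ α).comp_eqToHom _ _ }
  left_triangle b := U.map_unit_counit b
  right_triangle c := U.unit_counit c

end UniversalArrows

end UniversalArrows

/-- The strictifications and their units, as universal arrows to `inclusionJ A`. -/
def universalArrows (A : Type u) [Bicategory.{u, u} A] [Strict A] :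
    UniversalArrows (inclusionJ A) where
  obj := strict
  unit := unit
  desc := extend
  fac := unit_comp_extend
  hom_ext := extend_unique
  whiskerLeft_bijective := unit_whiskerLeft_bijective

end TwoDim

theorem theorem4p14 (A : Type u) [Bicategory.{u, u} A] [Strict A] :
    ∃ (Q : StrictPseudofunctor (A ⥤ᵖ TwoCatPI.{u}) (TwoFunctorCat A TwoCatTwoI.{u}))
      (adj : TwoAdjunction Q (inclusionJ A)),
      (∀ X : A ⥤ᵖ TwoCatPI.{u}, IsInternalEquivalence (adj.unit.app X)) ∧
      (∀ Y : TwoFunctorCat A TwoCatTwoI.{u},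
        IsInternalEquivalence ((inclusionJ A).map (adj.counit.app Y))) :=
  ⟨(universalArrows A).left, (universalArrows A).adjunction,
    fun _ => unit_isInternalEquivalence, fun Y =>
      unit_isInternalEquivalence.of_comp_eq_id ((universalArrows A).unit_counit Y)⟩
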